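/- Let $N\ge 1$, $\hbar\neq 0$, and let $\gamma_N=(\gamma_{N1},\dots,\gamma_{NN})\in\mathbb C^N$ be a fixed label. Let $M$ be the space of meromorphic functions in the $\tfrac12N(N-1)$ variables $\gamma_{nj}$, $1\le j\le n\le N-1$, and let $e^{\pm i\hbar\partial_{\gamma_{nj}}}$ act on $M$ by the shift $\gamma_{nj}\mapsto\gamma_{nj}\pm i\hbar$. Let $Y(\mathfrak{gl}(N))$ be the Yangian: the associative algebra generated by $T^{(r)}_{ij}$ ($1\le i,j\le N$, $r\ge 0$) with the relations, for $T_{ij}(\lambda)=\lambda\delta_{ij}+\sum_{r\ge0}T^{(r)}_{ij}\lambda^{-r}$ and $R(\lambda)=I\otimes I+i\hbar P/\lambda$ ($P$ the permutation matrix), $$R(\lambda-\mu)(T(\lambda)\otimes I)(I\otimes T(\mu))=(I\otimes T(\mu))(T(\lambda)\otimes I)R(\lambda-\mu).$$ For an $n\times n$ sub-matrix $X$ of $T$ put $$\det{}_q X(\lambda)=\sum_{p\in S_n}\mathrm{sign}(p)\,X_{p(1),1}(\lambda-i\hbar\rho_1)\cdots X_{p(n),n}(\lambda-i\hbar\rho_n),\qquad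 \rho_k=\tfrac12(n-2k+1).$$ Let $\mathbf A_n(\lambda)$ ($1\le n\le N$) be the quantum determinant of the sub-matrix with rows and columns $1,\dots,n$, and for $1\le n\le N-1$ let $\mathbf B_n(\lambda)$ (respectively $\mathbf C_n(\lambda)$) be that of the sub-matrix with rows $1,\dots,n$ and columns $1,\dots,n-1,n+1$ (respectively rows $1,\dots,n-1,n+1$ and columns $1,\dots,n$). Let $\pi_N:Y(\mathfrak{gl}(N))\to\mathcal U(\mathfrak{gl}(N))$ be the homomorphism $T_{jk}(\lambda)\mapsto\lambda\delta_{jk}-i\hbar E_{jk}$. **Proposition 4.1.** (1) There is a unique representation of $\mathcal U(\mathfrak{gl}(N))$ on $M$ (the Gelfand–Zetlin representation) in which $$E_{nn}=\frac1{i\hbar}\Big(\sum_{j=1}^n\gamma_{nj}-\sum_{j=1}^{n-1}\gamma_{n-1,j}\Big)\quad(1\le n\le N),$$ $$E_{n,n+1}=-\frac1{i\hbar}\sum_{j=1}^n\frac{\prod_{r=1}^{n+1}(\gamma_{nj}-\gamma_{n+1,r}-\frac{i\hbar}2)}{\prod_{s\ne j}(\gamma_{nj}-\gamma_{ns})}e^{-i\hbar\partial_{\gamma_{nj}}},\qquad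 E_{n+1,n}=\frac1{i\hbar}\sum_{j=1}^n\frac{\prod_{r=1}^{n-1}(\gamma_{nj}-\gamma_{n-1,r}+\frac{i\hbar}2)}{\prod_{s\ne j}(\gamma_{nj}-\gamma_{ns})}e^{i\hbar\partial_{\gamma_{nj}}}\quad(1\le n\le N-1).$$ (2) Under $\pi_N$ followed by this representation, the Drinfeld generators $\mathbf A_n(\lambda),\mathbf B_n(\lambda),\mathbf C_n(\lambda)$ act on $M$ as $$\mathcal A_n(\lambda)=\prod_{j=1}^n(\lambda-\gamma_{nj})\quad(1\le n\le N),$$ $$\mathcal B_n(\lambda)=\sum_{j=1}^n\prod_{s\ne j}\frac{\lambda-\gamma_{ns}}{\gamma_{nj}-\gamma_{ns}}\prod_{r=1}^{n+1}\Big(\gamma_{nj}-\gamma_{n+1,r}-\frac{i\hbar}2\Big)e^{-i\hbar\partial_{\gamma_{nj}}}\quad(1\le n\le N-1),$$ $$\mathcal C_n(\lambda)=-\sum_{j=1}^n\prod_{s\ne j}\frac{\lambda-\gamma_{ns}}{\gamma_{nj}-\gamma_{ns}}\prod_{r=1}^{n-1}\Big(\gamma_{nj}-\gamma_{n-1,r}+\frac{i\hbar}2\Big)e^{i\hbar\partial_{\gamma_{nj}}}\quad(1\le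 n\le N-1).$$ (3) These operators define a representation of the Yangian: there is a unique representation of $Y(\mathfrak{gl}(N))$ on $M$ in which $\mathbf A_n(\lambda),\mathbf B_n(\lambda),\mathbf C_n(\lambda)$ act as $\mathcal A_n(\lambda),\mathcal B_n(\lambda),\mathcal C_n(\lambda)$. -/

import Mathlib

open Filter Topology

noncomputable section

namespace GZ

set_option linter.unusedSectionVars false

/-! ### Meromorphic functions of several variables -/

/-- The filter of all sets that contain a dense open set. -/
def generic (X : Type*) [TopologicalSpace X] : Filter X where
  sets := {s | Dense (interior s)}
  univ_sets := by simp
  sets_of_superset := fun hs hst => hs.mono (interior_mono hst)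
  inter_sets := fun {s t} hs ht => by
    simp only [Set.mem_ofPred_eq, interior_inter] at *
    exact hs.inter_of_isOpen_left ht isOpen_interior

lemma mem_generic {X : Type*} [TopologicalSpace X] {s : Set X} :
    s ∈ generic X ↔ Dense (interior s) := Iff.rfl

lemma eventually_inf_generic {X : Type*} [TopologicalSpace X] {x : X} {p : X → Prop} :
    (∀ᶠ y in 𝓝 x ⊓ generic X, p y) ↔
      ∃ U : Set X, IsOpen U ∧ x ∈ U ∧ U ⊆ closure (interior {y | p y}) := by
  constructor
  · intro h
    obtain ⟨a, ha, b, hb, hab⟩ := mem_inf_iff.1 (show {y | p y} ∈ 𝓝 x ⊓ generic X from h)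
    refine ⟨interior a, isOpen_interior, mem_interior_iff_mem_nhds.2 ha, fun y hy => ?_⟩
    rw [hab, interior_inter]
    exact (mem_generic.1 hb).open_subset_closure_inter isOpen_interior hy
  · rintro ⟨U, hU, hx, hs⟩
    refine mem_of_superset (inter_mem_inf (hU.mem_nhds hx)
      (show interior {y | p y} ∪ (closure (interior {y | p y}))ᶜ ∈ generic X from ?_)) ?_
    · rw [mem_generic, (isOpen_interior.union isClosed_closure.isOpen_compl).interior_eq]
      intro y
      by_cases hy : y ∈ closure (interior {y | p y})
      · exact closure_mono Set.subset_union_left hy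
      · exact subset_closure (Or.inr hy)
    · rintro y ⟨hyU, hy | hy⟩
      · exact interior_subset hy
      · exact absurd (hs hyU) hy

lemma generic_of_local {X : Type*} [TopologicalSpace X] {p : X → Prop}
    (h : ∀ x, ∀ᶠ y in 𝓝 x ⊓ generic X, p y) : ∀ᶠ y in generic X, p y := by
  intro x
  obtain ⟨U, -, hx, hU⟩ := eventually_inf_generic.1 (h x)
  exact hU hx

instance nhds_inf_generic_neBot {X : Type*} [TopologicalSpace X] (x : X) :
    (𝓝 x ⊓ generic X).NeBot := by
  refine ⟨fun h => ?_⟩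
  have h' : ∀ᶠ y in 𝓝 x ⊓ generic X, False := by rw [h]; trivial
  obtain ⟨U, -, hx, hU⟩ := eventually_inf_generic.1 h'
  simpa using hU hx

variable {ι : Type*} [Fintype ι]

/-- A function of several complex variables is (a representative of) a meromorphic function if
near every point `x` it is a quotient `p / q` of holomorphic functions with `q` not identically
zero near `x`; the equality need only hold on a dense open subset of a neighbourhood of `x`
(off the polar set), so the values at poles and at points of indeterminacy play no role. -/
def IsMero (f : (ι → ℂ) → ℂ) : Prop :=
  ∀ x, ∃ p q : (ι → ℂ) → ℂ, AnalyticAt ℂ p x ∧ AnalyticAt ℂ q x ∧ (¬ ∀ᶠ y in 𝓝 x, q y = 0) ∧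
    f =ᶠ[𝓝 x ⊓ generic (ι → ℂ)] fun y => p y / q y

lemma generic_ne_zero {q : (ι → ℂ) → ℂ} {x : ι → ℂ} (hq : AnalyticAt ℂ q x)
    (h : ¬ ∀ᶠ y in 𝓝 x, q y = 0) : ∀ᶠ y in 𝓝 x ⊓ generic (ι → ℂ), q y ≠ 0 := by
  obtain ⟨r, hr, hqr⟩ := hq.exists_ball_analyticOnNhd
  refine eventually_inf_generic.2 ⟨Metric.ball x r, Metric.isOpen_ball, Metric.mem_ball_self hr, ?_⟩
  intro z hz
  by_contra hcon
  apply h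
  have h1 : ∀ᶠ y in 𝓝 z, y ∉ interior {y | q y ≠ 0} := by
    have := isClosed_closure.isOpen_compl.mem_nhds hcon
    filter_upwards [this] with y hy hy' using hy (subset_closure hy')
  have h2 : ∀ᶠ y in 𝓝 z, q y = 0 := by
    filter_upwards [h1, Metric.isOpen_ball.mem_nhds hz] with y hy hyb
    by_contra hne
    exact hy (mem_interior_iff_mem_nhds.2
      ((hqr y hyb).continuousAt.eventually_ne hne))
  have h3 := hqr.eqOn_zero_of_preconnected_of_eventuallyEq_zero
    (convex_ball x r).isPreconnected hz h2
  filter_upwards [Metric.ball_mem_nhds x hr] with y hy using h3 hy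

lemma not_eventually_zero {q : (ι → ℂ) → ℂ} {x : ι → ℂ}
    (h : ∀ᶠ y in 𝓝 x ⊓ generic (ι → ℂ), q y ≠ 0) : ¬ ∀ᶠ y in 𝓝 x, q y = 0 := fun h0 => by
  obtain ⟨y, hy, hy0⟩ := (h.and (h0.filter_mono inf_le_left)).exists
  exact hy hy0

lemma IsMero.of_analytic {f : (ι → ℂ) → ℂ} (hf : ∀ x, AnalyticAt ℂ f x) : IsMero f := fun x =>
  ⟨f, fun _ => 1, hf x, analyticAt_const, by
    intro h; simpa using h.self_of_nhds, by simp [EventuallyEq]⟩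

lemma IsMero.add {f g : (ι → ℂ) → ℂ} (hf : IsMero f) (hg : IsMero g) : IsMero (f + g) := by
  intro x
  obtain ⟨p, q, hp, hq, h0, he⟩ := hf x
  obtain ⟨p', q', hp', hq', h0', he'⟩ := hg x
  have n := generic_ne_zero hq h0
  have n' := generic_ne_zero hq' h0'
  refine ⟨fun y => p y * q' y + q y * p' y, fun y => q y * q' y, (hp.mul hq').add (hq.mul hp'),
    hq.mul hq', not_eventually_zero ?_, ?_⟩
  · filter_upwards [n, n'] with y a b using mul_ne_zero a b
  · filter_upwards [n, n', he, he'] with y a b c d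
    simp only [Pi.add_apply, c, d, div_add_div _ _ a b]

lemma IsMero.mul {f g : (ι → ℂ) → ℂ} (hf : IsMero f) (hg : IsMero g) : IsMero (f * g) := by
  intro x
  obtain ⟨p, q, hp, hq, h0, he⟩ := hf x
  obtain ⟨p', q', hp', hq', h0', he'⟩ := hg x
  have n := generic_ne_zero hq h0
  have n' := generic_ne_zero hq' h0'
  refine ⟨fun y => p y * p' y, fun y => q y * q' y, hp.mul hp',
    hq.mul hq', not_eventually_zero ?_, ?_⟩
  · filter_upwards [n, n'] with y a b using mul_ne_zero a b
  · filter_upwards [he, he'] with y c d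
    simp only [Pi.mul_apply, c, d, div_mul_div_comm]

/-- Near each point a meromorphic function vanishes generically or is generically nonzero. -/
lemma IsMero.dichotomy {f : (ι → ℂ) → ℂ} (hf : IsMero f) (x : ι → ℂ) :
    (∀ᶠ y in 𝓝 x ⊓ generic (ι → ℂ), f y = 0) ∨ ∀ᶠ y in 𝓝 x ⊓ generic (ι → ℂ), f y ≠ 0 := by
  obtain ⟨p, q, hp, hq, h0, he⟩ := hf x
  by_cases hp0 : ∀ᶠ y in 𝓝 x, p y = 0
  · left
    filter_upwards [he, hp0.filter_mono inf_le_left] with y a b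
    simp [a, b]
  · right
    filter_upwards [he, generic_ne_zero hp hp0, generic_ne_zero hq h0] with y a b c
    rw [a]; exact div_ne_zero b c

lemma IsMero.inv {f : (ι → ℂ) → ℂ} (hf : IsMero f) : IsMero f⁻¹ := by
  intro x
  obtain ⟨p, q, hp, hq, h0, he⟩ := hf x
  by_cases hp0 : ∀ᶠ y in 𝓝 x, p y = 0
  · refine ⟨fun _ => 0, fun _ => 1, analyticAt_const, analyticAt_const, ?_, ?_⟩
    · intro h; simpa using h.self_of_nhds
    · filter_upwards [he, hp0.filter_mono inf_le_left] with y a b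
      simp [a, b]
  · refine ⟨q, p, hq, hp, hp0, ?_⟩
    filter_upwards [he] with y a
    simp [a]

lemma isOpen_eventually_inf_generic {X : Type*} [TopologicalSpace X] (p : X → Prop) :
    IsOpen {x | ∀ᶠ y in 𝓝 x ⊓ generic X, p y} := by
  refine isOpen_iff_mem_nhds.2 fun x hx => ?_
  obtain ⟨U, hU, hxU, hs⟩ := eventually_inf_generic.1 hx
  filter_upwards [hU.mem_nhds hxU] with z hz using eventually_inf_generic.2 ⟨U, hU, hz, hs⟩

lemma IsMero.global_dichotomy {f : (ι → ℂ) → ℂ} (hf : IsMero f) :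
    (∀ᶠ y in generic (ι → ℂ), f y = 0) ∨ ∀ᶠ y in generic (ι → ℂ), f y ≠ 0 := by
  have hcl : IsClopen {x | ∀ᶠ y in 𝓝 x ⊓ generic (ι → ℂ), f y = 0} := by
    refine ⟨⟨?_⟩, isOpen_eventually_inf_generic _⟩
    convert isOpen_eventually_inf_generic (fun y => f y ≠ 0) using 1
    ext x
    constructor
    · intro h
      exact (hf.dichotomy x).resolve_left h
    · intro h h'
      have h1 : ∀ᶠ y in 𝓝 x ⊓ generic (ι → ℂ), f y ≠ 0 := h
      have h2 : ∀ᶠ y in 𝓝 x ⊓ generic (ι → ℂ), f y = 0 := h'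
      obtain ⟨y, a, b⟩ := (h1.and h2).exists
      exact a b
  rcases isClopen_iff.1 hcl with h | h
  · right
    refine generic_of_local fun x => (hf.dichotomy x).resolve_left fun hx => ?_
    have : x ∈ ({x | ∀ᶠ y in 𝓝 x ⊓ generic (ι → ℂ), f y = 0} : Set _) := hx
    simp [h] at this
  · left
    refine generic_of_local fun x => ?_
    have : x ∈ ({x | ∀ᶠ y in 𝓝 x ⊓ generic (ι → ℂ), f y = 0} : Set _) := by rw [h]; trivial
    exact this

variable (ι) in
/-- The algebra of representatives of meromorphic functions. -/
def meroRep : Subalgebra ℂ ((ι → ℂ) → ℂ) where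
  carrier := {f | IsMero f}
  mul_mem' := fun hf hg => IsMero.mul hf hg
  add_mem' := fun hf hg => IsMero.add hf hg
  algebraMap_mem' := fun _ => IsMero.of_analytic fun _ => analyticAt_const

variable (ι) in
/-- The representatives of zero: the functions that vanish on a dense open set. -/
def meroNull : Ideal (meroRep ι) where
  carrier := {f | ∀ᶠ y in generic (ι → ℂ), f.1 y = 0}
  zero_mem' := by simp
  add_mem' := fun {f g} hf hg => by
    simp only [Set.mem_ofPred_eq] at *
    filter_upwards [hf, hg] with y a b
    simp [a, b]
  smul_mem' := fun c f hf => by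
    simp only [Set.mem_ofPred_eq] at *
    filter_upwards [hf] with y a
    simp [a]

instance meroNull_isMaximal : (meroNull ι).IsMaximal := by
  refine Ideal.isMaximal_iff.2 ⟨?_, ?_⟩
  · intro h
    have h' : ∀ᶠ y in generic (ι → ℂ), (1 : ℂ) = 0 := h
    obtain ⟨y, hy⟩ := (h'.filter_mono (inf_le_right : 𝓝 (0 : ι → ℂ) ⊓ _ ≤ _)).exists
    exact one_ne_zero hy
  · intro J f hJ hf hfJ
    have hne : ∀ᶠ y in generic (ι → ℂ), f.1 y ≠ 0 := (IsMero.global_dichotomy f.2).resolve_left hf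
    let g : meroRep ι := ⟨f.1⁻¹, IsMero.inv f.2⟩
    have h1 : 1 - g * f ∈ meroNull ι := by
      show ∀ᶠ y in generic (ι → ℂ), (1 : ℂ) - (f.1 y)⁻¹ * f.1 y = 0
      filter_upwards [hne] with y hy
      rw [inv_mul_cancel₀ hy, sub_self]
    have h2 := J.add_mem (hJ h1) (J.mul_mem_left g hfJ)
    simpa using h2

variable (ι) in
/-- The space of meromorphic functions on `ℂ^ι`. -/
def Mero : Type _ := meroRep ι ⧸ meroNull ι

instance meroQuotField : Field (meroRep ι ⧸ meroNull ι) := Ideal.Quotient.field (meroNull ι)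

/-- The meromorphic functions on `ℂ^ι` form a field. -/
instance Mero.instField : Field (Mero ι) := inferInstanceAs (Field (meroRep ι ⧸ meroNull ι))

instance Mero.instAlgebra : Algebra ℂ (Mero ι) :=
  inferInstanceAs (Algebra ℂ (meroRep ι ⧸ meroNull ι))

variable (ι) in
/-- The class of a representative. -/
def Mero.mk : meroRep ι →ₐ[ℂ] Mero ι := Ideal.Quotient.mkₐ ℂ (meroNull ι)

lemma Mero.mk_surjective : Function.Surjective (Mero.mk ι) :=
  Ideal.Quotient.mk_surjective

lemma Mero.mk_eq_mk {f g : meroRep ι} :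
    Mero.mk ι f = Mero.mk ι g ↔ ∀ᶠ y in generic (ι → ℂ), f.1 y = g.1 y := by
  refine Ideal.Quotient.eq.trans ?_
  show (∀ᶠ y in generic (ι → ℂ), f.1 y - g.1 y = 0) ↔ _
  simp only [sub_eq_zero]

/-- The coordinate function `γ ↦ γ i`. -/
def coord (i : ι) : Mero ι :=
  Mero.mk ι ⟨fun z => z i, IsMero.of_analytic fun z =>
    (ContinuousLinearMap.proj (R := ℂ) (φ := fun _ : ι => ℂ) i).analyticAt z⟩

lemma eventually_translate {x v : ι → ℂ} {p : (ι → ℂ) → Prop}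
    (h : ∀ᶠ y in 𝓝 (x + v) ⊓ generic (ι → ℂ), p y) :
    ∀ᶠ y in 𝓝 x ⊓ generic (ι → ℂ), p (y + v) := by
  obtain ⟨U, hU, hx, hs⟩ := eventually_inf_generic.1 h
  refine eventually_inf_generic.2 ⟨(Homeomorph.addRight v) ⁻¹' U,
    hU.preimage (Homeomorph.addRight v).continuous, hx, ?_⟩
  have : {y | p (y + v)} = (Homeomorph.addRight v) ⁻¹' {y | p y} := rfl
  rw [this, ← Homeomorph.preimage_interior, ← Homeomorph.preimage_closure]
  exact Set.preimage_mono hs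

lemma IsMero.translate {f : (ι → ℂ) → ℂ} (hf : IsMero f) (v : ι → ℂ) :
    IsMero fun y => f (y + v) := by
  intro x
  obtain ⟨p, q, hp, hq, h0, he⟩ := hf (x + v)
  have ha : AnalyticAt ℂ (fun y : ι → ℂ => y + v) x := analyticAt_id.add analyticAt_const
  exact ⟨fun y => p (y + v), fun y => q (y + v), hp.comp_of_eq ha rfl, hq.comp_of_eq ha rfl,
    not_eventually_zero (eventually_translate (generic_ne_zero hq h0)), eventually_translate he⟩

/-- Translation of representatives, `f ↦ f (· + v)`. -/
def shiftRep (v : ι → ℂ) : meroRep ι →ₐ[ℂ] meroRep ι where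
  toFun f := ⟨fun y => f.1 (y + v), IsMero.translate f.2 v⟩
  map_one' := rfl
  map_mul' _ _ := rfl
  map_zero' := rfl
  map_add' _ _ := rfl
  commutes' _ := rfl

lemma shiftRep_null (v : ι → ℂ) : meroNull ι ≤ (meroNull ι).comap (shiftRep v) := by
  intro f hf
  exact generic_of_local fun x =>
    eventually_translate (x := x) (v := v) (p := fun y => f.1 y = 0) (Filter.Eventually.filter_mono inf_le_right hf)

/-- The operator `e^{c ∂_i}` on meromorphic functions: translation of the `i`-th variable by `c`,
`(e^{c ∂_i} f)(γ) = f(γ_1, …, γ_i + c, …)`. -/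
def shift [DecidableEq ι] (i : ι) (c : ℂ) : Module.End ℂ (Mero ι) :=
  (show Mero ι →ₐ[ℂ] Mero ι from Ideal.quotientMapₐ (meroNull ι) (shiftRep (Pi.single i c))
    (shiftRep_null (Pi.single i c))).toLinearMap

lemma shift_mk [DecidableEq ι] (i : ι) (c : ℂ) (f : meroRep ι) :
    shift i c (Mero.mk ι f) = Mero.mk ι (shiftRep (Pi.single i c) f) := rfl

/-- The operator of multiplication by a meromorphic function. -/
abbrev mulOp : Mero ι →ₐ[ℂ] Module.End ℂ (Mero ι) := Algebra.lmul ℂ (Mero ι)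

/-! ### Laurent series in `λ⁻¹` -/

/-- `LaurentSeries R` is used for formal series in `λ⁻¹` with finitely many positive powers of
`λ`: the coefficient with index `m` is the coefficient of `λ^{-m}`. This is the element `λ`. -/
def lam (R : Type*) [Ring R] : LaurentSeries R := HahnSeries.single (-1) 1

/-- The constant series `a`. -/
abbrev cst {R : Type*} [Ring R] (a : R) : LaurentSeries R := HahnSeries.C a

/-- The Laurent expansion at infinity of `(λ - c)^k`, for an integer `k`. -/
def lamSubPow (c : ℂ) (k : ℤ) : LaurentSeries ℂ := (lam ℂ - cst c) ^ k

/-! ### The Yangian -/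

/-- The coefficients of `T(λ) = λ I + ∑_{r ≥ 0} T^{(r)} λ^{-r}`: the matrix coefficient of
`λ^{-r}`, for every integer `r`. -/
def coeffT {N : ℕ} {A : Type*} [Ring A] (T : ℕ → Matrix (Fin N) (Fin N) A) :
    ℤ → Matrix (Fin N) (Fin N) A
  | Int.ofNat r => T r
  | Int.negSucc 0 => 1
  | Int.negSucc (_ + 1) => 0

/-- The permutation matrix `P_{ik,jl} = δ_{il} δ_{kj}`. -/
def permP (N : ℕ) (A : Type*) [Ring A] : Matrix (Fin N × Fin N) (Fin N × Fin N) A :=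
  Matrix.of fun a b => if a.1 = b.2 ∧ a.2 = b.1 then 1 else 0

/-- `T ⊗ I`, with entries `(T ⊗ I)_{ik,jl} = T_{ij} δ_{kl}`. -/
def tens₁ {N : ℕ} {A : Type*} [Ring A] (T : Matrix (Fin N) (Fin N) A) :
    Matrix (Fin N × Fin N) (Fin N × Fin N) A :=
  Matrix.kronecker T 1

/-- `I ⊗ T`, with entries `(I ⊗ T)_{ik,jl} = δ_{ij} T_{kl}`. -/
def tens₂ {N : ℕ} {A : Type*} [Ring A] (T : Matrix (Fin N) (Fin N) A) :
    Matrix (Fin N × Fin N) (Fin N × Fin N) A :=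
  Matrix.kronecker 1 T

section RTT

variable {N : ℕ} {A : Type*} [Ring A] [Algebra ℂ A]

/-- The coefficient of `λ^{-r} μ^{-s}` in `(λ - μ) R(λ - μ) (T(λ) ⊗ I) (I ⊗ T(μ))`, where
`(λ - μ) R(λ - μ) = (λ - μ) I ⊗ I + iħ P`. -/
def rttLeft (ħ : ℂ) (T : ℤ → Matrix (Fin N) (Fin N) A) (r s : ℤ) :
    Matrix (Fin N × Fin N) (Fin N × Fin N) A :=
  tens₁ (T (r + 1)) * tens₂ (T s) - tens₁ (T r) * tens₂ (T (s + 1))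
    + (Complex.I * ħ) • (permP N A * (tens₁ (T r) * tens₂ (T s)))

/-- The coefficient of `λ^{-r} μ^{-s}` in `(I ⊗ T(μ)) (T(λ) ⊗ I) (λ - μ) R(λ - μ)`. -/
def rttRight (ħ : ℂ) (T : ℤ → Matrix (Fin N) (Fin N) A) (r s : ℤ) :
    Matrix (Fin N × Fin N) (Fin N × Fin N) A :=
  tens₂ (T s) * tens₁ (T (r + 1)) - tens₂ (T (s + 1)) * tens₁ (T r)
    + (Complex.I * ħ) • (tens₂ (T s) * tens₁ (T r) * permP N A)

lemma tens₁_mul_tens₂ (X Y : Matrix (Fin N) (Fin N) A) (a b : Fin N × Fin N) :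
    (tens₁ X * tens₂ Y) a b = X a.1 b.1 * Y a.2 b.2 := by
  simp [tens₁, tens₂, Matrix.mul_apply, Matrix.kroneckerMap_apply, Fintype.sum_prod_type,
    Matrix.one_apply]

lemma tens₂_mul_tens₁ (X Y : Matrix (Fin N) (Fin N) A) (a b : Fin N × Fin N) :
    (tens₂ Y * tens₁ X) a b = Y a.2 b.2 * X a.1 b.1 := by
  simp [tens₁, tens₂, Matrix.mul_apply, Matrix.kroneckerMap_apply, Fintype.sum_prod_type,
    Matrix.one_apply]

lemma permP_mul (X : Matrix (Fin N × Fin N) (Fin N × Fin N) A) (a b : Fin N × Fin N) :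
    (permP N A * X) a b = X (a.2, a.1) b := by
  rw [Matrix.mul_apply, Finset.sum_eq_single (a.2, a.1)]
  · simp [permP]
  · rintro ⟨c, d⟩ - h
    have : ¬ (a.1 = d ∧ a.2 = c) := by rintro ⟨rfl, rfl⟩; exact h rfl
    simp [permP, this]
  · simp

lemma mul_permP (X : Matrix (Fin N × Fin N) (Fin N × Fin N) A) (a b : Fin N × Fin N) :
    (X * permP N A) a b = X a (b.2, b.1) := by
  rw [Matrix.mul_apply, Finset.sum_eq_single (b.2, b.1)]
  · simp [permP]
  · rintro ⟨c, d⟩ - h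
    have : ¬ (c = b.2 ∧ d = b.1) := by rintro ⟨rfl, rfl⟩; exact h rfl
    simp [permP, this]
  · simp

lemma rttLeft_apply (ħ : ℂ) (T : ℤ → Matrix (Fin N) (Fin N) A) (r s : ℤ) (a b : Fin N × Fin N) :
    rttLeft ħ T r s a b = T (r + 1) a.1 b.1 * T s a.2 b.2 - T r a.1 b.1 * T (s + 1) a.2 b.2
      + (Complex.I * ħ) • (T r a.2 b.1 * T s a.1 b.2) := by
  simp [rttLeft, tens₁_mul_tens₂, permP_mul]

lemma rttRight_apply (ħ : ℂ) (T : ℤ → Matrix (Fin N) (Fin N) A) (r s : ℤ) (a b : Fin N × Fin N) :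
    rttRight ħ T r s a b = T s a.2 b.2 * T (r + 1) a.1 b.1 - T (s + 1) a.2 b.2 * T r a.1 b.1
      + (Complex.I * ħ) • (T s a.2 b.1 * T r a.1 b.2) := by
  simp [rttRight, tens₂_mul_tens₁, mul_permP]

end RTT

/-- The generators `T_{jk}^{(r)}`, `r ≥ 0`, of the free algebra. -/
def freeT (N r : ℕ) : Matrix (Fin N) (Fin N) (FreeAlgebra ℂ (ℕ × Fin N × Fin N)) :=
  Matrix.of fun j k => FreeAlgebra.ι ℂ (r, j, k)

/-- The defining relations of the Yangian: all matrix entries of all coefficients of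
`R(λ - μ) (T(λ) ⊗ I) (I ⊗ T(μ)) = (I ⊗ T(μ)) (T(λ) ⊗ I) R(λ - μ)`, multiplied by `λ - μ`. -/
inductive YangianRel (N : ℕ) (ħ : ℂ) : FreeAlgebra ℂ (ℕ × Fin N × Fin N) →
    FreeAlgebra ℂ (ℕ × Fin N × Fin N) → Prop
  | rtt (r s : ℤ) (a b : Fin N × Fin N) :
      YangianRel N ħ (rttLeft ħ (coeffT (freeT N)) r s a b) (rttRight ħ (coeffT (freeT N)) r s a b)

/-- The Yangian `Y(gl(N))`, as an associative algebra. -/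
abbrev Yangian (N : ℕ) (ħ : ℂ) : Type := RingQuot (YangianRel N ħ)

/-- The generators `T_{jk}^{(r)}` of the Yangian. -/
def yangianT (N : ℕ) (ħ : ℂ) (r : ℕ) : Matrix (Fin N) (Fin N) (Yangian N ħ) :=
  Matrix.of fun j k => RingQuot.mkAlgHom ℂ (YangianRel N ħ) (freeT N r j k)

/-- The Laurent series `T_{jk}(λ - c)`, that is `∑_r t_r (λ - c)^{-r}` re-expanded in powers of
`λ⁻¹`, where `t_r` (`r ≥ -1`) are the coefficients of `T_{jk}(λ)`. -/
def shiftedT (N : ℕ) (ħ : ℂ) (c : ℂ) (j k : Fin N) : LaurentSeries (Yangian N ħ) :=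
  HahnSeries.ofSuppBddBelow
    (fun m : ℤ => ∑ r ∈ Finset.Icc (-1) m, (lamSubPow c (-r)).coeff m • coeffT (yangianT N ħ) r j k)
    ⟨-1, fun m hm => by
      by_contra h
      exact hm (by simp [Finset.Icc_eq_empty h])⟩

/-- The quantum determinant of the `n × n` sub-matrix of `T(λ)` with rows `row 0, row 1, …` and
columns `col 0, col 1, …`: the sum over `p` of
`sign p · T_{row (p 1), col 1}(λ - iħ ρ_1) ⋯ T_{row (p n), col n}(λ - iħ ρ_n)`, where
`ρ_k = (n - 2 k + 1) / 2` for `k = 1, …, n`; here `k` is counted from `0`. -/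
def qdet (N : ℕ) (ħ : ℂ) {n : ℕ} (row col : Fin n → Fin N) : LaurentSeries (Yangian N ħ) :=
  ∑ p : Equiv.Perm (Fin n), ((Equiv.Perm.sign p : ℤˣ) : ℤ) •
    (List.ofFn fun k : Fin n =>
      shiftedT N ħ (Complex.I * ħ * (((n : ℂ) - 2 * ((k : ℕ) + 1 : ℂ) + 1) / 2))
        (row (p k)) (col k)).prod

/-- The index list `1, …, n` (counted from `0` in `Fin N`). -/
def firstIdx {N n : ℕ} (hn : n ≤ N) : Fin n → Fin N := Fin.castLE hn

/-- The index list `1, …, n - 1, n + 1`, with `n = i + 1` (counted from `0` in `Fin N`). -/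
def skipIdx {N i : ℕ} (hi : i + 1 < N) : Fin (i + 1) → Fin N :=
  Fin.snoc (α := fun _ => Fin N) (fun k : Fin i => (⟨k, by omega⟩ : Fin N)) ⟨i + 1, hi⟩

/-- The Drinfeld generator `A_n(λ)`. -/
def drinfeldA (N : ℕ) (ħ : ℂ) {n : ℕ} (hn : n ≤ N) : LaurentSeries (Yangian N ħ) :=
  qdet N ħ (firstIdx hn) (firstIdx hn)

/-- The Drinfeld generator `B_n(λ)`, `n = i + 1 < N`. -/
def drinfeldB (N : ℕ) (ħ : ℂ) {i : ℕ} (hi : i + 1 < N) : LaurentSeries (Yangian N ħ) :=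
  qdet N ħ (firstIdx hi.le) (skipIdx hi)

/-- The Drinfeld generator `C_n(λ)`, `n = i + 1 < N`. -/
def drinfeldC (N : ℕ) (ħ : ℂ) {i : ℕ} (hi : i + 1 < N) : LaurentSeries (Yangian N ħ) :=
  qdet N ħ (skipIdx hi) (firstIdx hi.le)

/-! ### The homomorphism to the universal enveloping algebra -/

/-- The Lie algebra `gl(N)`, with the commutator bracket. -/
abbrev gl (N : ℕ) : Type := Matrix (Fin N) (Fin N) ℂ

instance (N : ℕ) : LieRing (gl N) := LieRing.ofAssociativeRing

/-- The enveloping algebra `U(gl(N))`. -/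
abbrev Ugl (N : ℕ) : Type := UniversalEnvelopingAlgebra ℂ (gl N)

/-- The generator `E_{jk}` of `U(gl(N))`. -/
def genE (N : ℕ) (j k : Fin N) : Ugl N :=
  UniversalEnvelopingAlgebra.ι ℂ (Matrix.single j k (1 : ℂ) : gl N)

/-- The images of the generators: `T^{(0)}_{jk} ↦ -iħ E_{jk}` and `T^{(r)}_{jk} ↦ 0` for `r > 0`,
i.e. `T_{jk}(λ) ↦ λ δ_{jk} - iħ E_{jk}`. -/
def evalT (N : ℕ) (ħ : ℂ) (r : ℕ) : Matrix (Fin N) (Fin N) (Ugl N) :=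
  Matrix.of fun j k => if r = 0 then -(Complex.I * ħ) • genE N j k else 0

lemma genE_commutator (N : ℕ) (i j k l : Fin N) :
    genE N i j * genE N k l - genE N k l * genE N i j
      = (if j = k then genE N i l else 0) - (if l = i then genE N k j else 0) := by
  let _ : LieRing (Ugl N) := LieRing.ofAssociativeRing
  have h : UniversalEnvelopingAlgebra.ι ℂ
      ((Matrix.single i j (1 : ℂ) * Matrix.single k l (1 : ℂ)
        - Matrix.single k l (1 : ℂ) * Matrix.single i j (1 : ℂ) : gl N))
      = genE N i j * genE N k l - genE N k l * genE N i j :=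
    (UniversalEnvelopingAlgebra.ι ℂ (L := gl N)).map_lie
      (Matrix.single i j (1 : ℂ)) (Matrix.single k l (1 : ℂ))
  rw [← h, map_sub]
  unfold genE
  congr 1
  · split_ifs with hjk
    · subst hjk; simp
    · rw [Matrix.single_mul_single_of_ne _ _ _ _ hjk, map_zero]
  · split_ifs with hli
    · subst hli; simp
    · rw [Matrix.single_mul_single_of_ne _ _ _ _ hli, map_zero]

lemma coeffT_map {N : ℕ} {A B : Type*} [Ring A] [Ring B] [Algebra ℂ A] [Algebra ℂ B]
    (f : A →ₐ[ℂ] B) (T : ℕ → Matrix (Fin N) (Fin N) A) (S : ℕ → Matrix (Fin N) (Fin N) B)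
    (h : ∀ r i j, f (T r i j) = S r i j) (r : ℤ) (i j : Fin N) :
    f (coeffT T r i j) = coeffT S r i j := by
  match r with
  | Int.ofNat r => exact h r i j
  | Int.negSucc 0 => simp only [coeffT, Matrix.one_apply]; split_ifs <;> simp
  | Int.negSucc (_ + 1) => simp [coeffT]

lemma evalT_rtt (N : ℕ) (ħ : ℂ) (r s : ℤ) (a b : Fin N × Fin N) :
    rttLeft ħ (coeffT (evalT N ħ)) r s a b = rttRight ħ (coeffT (evalT N ħ)) r s a b := by
  obtain ⟨i, k⟩ := a
  obtain ⟨j, l⟩ := b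
  have ht : ∀ (r : ℤ) (a b : Fin N), coeffT (evalT N ħ) r a b =
      ((if r = -1 then 1 else 0) * (if a = b then 1 else 0) : ℂ) • (1 : Ugl N)
        + (if r = 0 then -(Complex.I * ħ) else 0) • genE N a b := fun r a b => by
    match r with
    | Int.ofNat 0 => simp [coeffT, evalT]
    | Int.ofNat (n + 1) =>
      have h1 : ((n : ℤ) + 1) ≠ -1 := by omega
      have h2 : ((n : ℤ) + 1) ≠ 0 := by omega
      simp [coeffT, evalT, h1, h2]
    | Int.negSucc 0 =>
      by_cases h : a = b <;> simp [coeffT, Matrix.one_apply, h]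
    | Int.negSucc (n + 1) =>
      have h1 : Int.negSucc (n + 1) ≠ -1 := by omega
      have h2 : Int.negSucc (n + 1) ≠ 0 := by omega
      simp only [coeffT, h1, h2, if_false, zero_mul, zero_smul, add_zero, Matrix.zero_apply]
  have key : genE N i j * genE N k l = genE N k l * genE N i j
      + ((if j = k then 1 else 0 : ℂ) • genE N i l - (if l = i then 1 else 0 : ℂ) • genE N k j) := by
    rw [← sub_eq_iff_eq_add', genE_commutator]
    simp only [ite_smul, one_smul, zero_smul]
  rw [rttLeft_apply, rttRight_apply]
  simp only [ht, mul_add, add_mul, smul_mul_assoc, mul_smul_comm, one_mul, mul_one, key]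
  have e1 : (k = j) = (j = k) := propext eq_comm
  have e2 : (i = l) = (l = i) := propext eq_comm
  have f1 : (r + 1 = -1) = (r = -2) := propext (by omega)
  have f2 : (s + 1 = -1) = (s = -2) := propext (by omega)
  have f3 : (r + 1 = 0) = (r = -1) := propext (by omega)
  have f4 : (s + 1 = 0) = (s = -1) := propext (by omega)
  simp only [e1, e2, f1, f2, f3, f4]
  have n1 : ((0 : ℤ) = -1) = False := by simp
  have n2 : ((-1 : ℤ) = 0) = False := by simp
  have n3 : ((0 : ℤ) = -2) = False := by simp
  have n4 : ((-1 : ℤ) = -2) = False := by simp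
  generalize (if j = k then 1 else 0 : ℂ) = d
  generalize (if l = i then 1 else 0 : ℂ) = d'
  by_cases r1 : r = -1 <;> by_cases r0 : r = 0 <;> by_cases s1 : s = -1 <;>
    by_cases s0 : s = 0 <;> first | omega | (simp only [r1, r0, s1, s0, n1, n2, n3, n4, if_true, if_false]; module)

/-- The homomorphism `π_N : Y(gl(N)) → U(gl(N))`, `T_{jk}(λ) ↦ λ δ_{jk} - iħ E_{jk}`. -/
def evalHom (N : ℕ) (ħ : ℂ) : Yangian N ħ →ₐ[ℂ] Ugl N :=
  RingQuot.liftAlgHom ℂ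
    ⟨FreeAlgebra.lift ℂ fun x : ℕ × Fin N × Fin N => evalT N ħ x.1 x.2.1 x.2.2, by
      rintro _ _ ⟨r, s, a, b⟩
      have h := coeffT_map (FreeAlgebra.lift ℂ
        fun x : ℕ × Fin N × Fin N => evalT N ħ x.1 x.2.1 x.2.2) (freeT N) (evalT N ħ)
        (fun r i j => by simp [freeT])
      have h' := evalT_rtt N ħ r s a b
      rw [rttLeft_apply, rttRight_apply] at *
      simpa only [map_add, map_sub, map_mul, map_smul, h] using h'⟩

lemma evalHom_T (N : ℕ) (ħ : ℂ) (r : ℕ) (j k : Fin N) :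
    evalHom N ħ (yangianT N ħ r j k) = evalT N ħ r j k := by
  simp [evalHom, yangianT, freeT]

/-! ### The Gelfand–Zetlin representation -/

/-- The index set of the variables `γ_{nj}`, `1 ≤ j ≤ n ≤ N - 1` (with `j` counted from `0`). -/
abbrev Vars (N : ℕ) : Type := Σ n : Fin N, Fin n

/-- The space of meromorphic functions in the variables `γ_1, …, γ_{N-1}`. -/
abbrev GZSpace (N : ℕ) : Type := Mero (Vars N)

/-- `γ_{nj}` as an element of the space of meromorphic functions: a variable for `n < N`, and the
constant given by the label for `n = N`. -/
def gam {N : ℕ} (label : Fin N → ℂ) {n : ℕ} (hn : n ≤ N) (j : Fin n) : GZSpace N :=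
  if h : n < N then coord (⟨⟨n, h⟩, j⟩ : Vars N)
  else algebraMap ℂ (GZSpace N) (label (Fin.castLE hn j))

/-- `iħ` as a constant function. -/
def ih (N : ℕ) (ħ : ℂ) : GZSpace N := algebraMap ℂ (GZSpace N) (Complex.I * ħ)

/-- `e^{c ∂_{γ_{nj}}}`, for `n < N`. -/
def gamShift {N n : ℕ} (hn : n < N) (j : Fin n) (c : ℂ) : Module.End ℂ (GZSpace N) :=
  shift (⟨⟨n, hn⟩, j⟩ : Vars N) c

/-- `∏_{r=1}^{n+1} (γ_{nj} - γ_{n+1,r} - iħ/2)` with `n = i + 1`. -/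
def upFactor {N : ℕ} (ħ : ℂ) (label : Fin N → ℂ) {i : ℕ} (hi : i + 1 < N) (j : Fin (i + 1)) :
    GZSpace N :=
  ∏ r : Fin (i + 2), (gam label hi.le j - gam label hi r - ih N ħ / 2)

/-- `∏_{r=1}^{n-1} (γ_{nj} - γ_{n-1,r} + iħ/2)` with `n = i + 1`. -/
def downFactor {N : ℕ} (ħ : ℂ) (label : Fin N → ℂ) {i : ℕ} (hi : i + 1 < N) (j : Fin (i + 1)) :
    GZSpace N :=
  ∏ r : Fin i, (gam label hi.le j - gam label (n := i) (by omega) r + ih N ħ / 2)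

/-- `ρ` is the Gelfand–Zetlin representation of `U(gl(N))` with the given label: it is given by
the difference operators below on `E_{nn}` (`n = i + 1 ≤ N`), `E_{n,n+1}` and `E_{n+1,n}`
(`n = i + 1 < N`). -/
structure IsGZRep (N : ℕ) (ħ : ℂ) (label : Fin N → ℂ)
    (ρ : Ugl N →ₐ[ℂ] Module.End ℂ (GZSpace N)) : Prop where
  diag : ∀ (i : ℕ) (hi : i + 1 ≤ N),
    ρ (genE N ⟨i, hi⟩ ⟨i, hi⟩) = mulOp ((ih N ħ)⁻¹ *
      (∑ j : Fin (i + 1), gam label hi j - ∑ j : Fin i, gam label (n := i) (by omega) j))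
  raise : ∀ (i : ℕ) (hi : i + 1 < N),
    ρ (genE N ⟨i, by omega⟩ ⟨i + 1, hi⟩) = ∑ j : Fin (i + 1),
      mulOp (-(ih N ħ)⁻¹ * (upFactor ħ label hi j /
        ∏ s ∈ Finset.univ.erase j, (gam label hi.le j - gam label hi.le s))) *
      gamShift hi j (-(Complex.I * ħ))
  lower : ∀ (i : ℕ) (hi : i + 1 < N),
    ρ (genE N ⟨i + 1, hi⟩ ⟨i, by omega⟩) = ∑ j : Fin (i + 1),
      mulOp ((ih N ħ)⁻¹ * (downFactor ħ label hi j /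
        ∏ s ∈ Finset.univ.erase j, (gam label hi.le j - gam label hi.le s))) *
      gamShift hi j (Complex.I * ħ)

/-- `∏_{s ≠ j} (λ - γ_{ns}) / (γ_{nj} - γ_{ns})`, a polynomial in `λ`. -/
def lagrange {N : ℕ} (label : Fin N → ℂ) {n : ℕ} (hn : n ≤ N) (j : Fin n) :
    LaurentSeries (GZSpace N) :=
  ∏ s ∈ Finset.univ.erase j,
    (lam (GZSpace N) - cst (gam label hn s)) * cst (gam label hn j - gam label hn s)⁻¹

/-- A homomorphism `Φ` from the Yangian to the operators on the space of meromorphic functions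
takes the Drinfeld generators `A_n(λ)`, `B_n(λ)`, `C_n(λ)` (coefficient by coefficient in `λ`) to
the explicit difference operators. -/
structure DrinfeldFormulas (N : ℕ) (ħ : ℂ) (label : Fin N → ℂ)
    (Φ : Yangian N ħ →ₐ[ℂ] Module.End ℂ (GZSpace N)) : Prop where
  formA : ∀ (n : ℕ) (hn : n ≤ N),
    (drinfeldA N ħ hn).map Φ =
      (∏ j : Fin n, (lam (GZSpace N) - cst (gam label hn j))).map mulOp
  formB : ∀ (i : ℕ) (hi : i + 1 < N),
    (drinfeldB N ħ hi).map Φ = ∑ j : Fin (i + 1),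
      (lagrange label hi.le j * cst (upFactor ħ label hi j)).map mulOp *
        cst (gamShift hi j (-(Complex.I * ħ)))
  formC : ∀ (i : ℕ) (hi : i + 1 < N),
    (drinfeldC N ħ hi).map Φ = -∑ j : Fin (i + 1),
      (lagrange label hi.le j * cst (downFactor ħ label hi j)).map mulOp *
        cst (gamShift hi j (Complex.I * ħ))

end GZ

end

open Filter Topology

noncomputable section

namespace GZ

set_option linter.unusedSectionVars false

/-! All computations take place over a field K with elements x_{nj} and commuting automorphisms
τ_{nj}, where τ_{nj} moves only x_{nj}, by a fixed step (`Shifts`). The raising and lowering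
operators are both instances of `ladder`, with opposite steps ±iħ, so most relations are proved once
and used for both families.

The representation of U(gl(N)) exists because the operators satisfy the Serre relations
(`Shifts.serreData`) and because these relations present gl(N) (`SerreData.exists_algHom`). Two of
the relations have content. In a cubic relation the coefficient of τ_{nj} τ_{nk} is antisymmetric in
j and k (`Shifts.exchange`, `Shifts.cubic`). In the bracket of a raising and a lowering operator of
one level the terms with j ≠ k vanish, and the rest is the sum of the residues of a quotient of
monic polynomials of equal degree (`sum_prod_div_prod_erase`, `Shifts.lie_ladder_self`).

For the Drinfeld generators, put h = iħ. The minors B_n and C_n are brackets of A_n with E_{n,n+1}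
and E_{n+1,n} (`qminor_first_skip`, `qminor_skip_first`), so it is enough to show that A_n is
multiplication by ∏_j (λ - γ_{nj}); this goes by induction on n (`GZOps.qminor_first`). Expand
A_{n+1} along its last column. The cofactors are brackets of E_{n+1,r} with A_n, up to a shift of λ
by h/2. The two top coefficients in λ are right by the formula for E_{n+1,n+1}, so A_{n+1} minus its
expected value has degree less than n, and it vanishes if it vanishes under left substitution of the
n roots of the shifted A_n (`eq_zero_of_leftEval_eq_zero`). At such a root the A_n term drops out.
The remaining sum is, after a shift of γ_{nk}, the last-column expansion of B_n, whose value there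
is already known (`GZOps.leftEval_qminor`).

The Yangian representation is the pullback along π_N. It is unique because the Drinfeld generators
determine all T^{(s)} (`yangian_hom_ext`): if two homomorphisms agree on T^{(r)} for r < s, the
first coefficient of a quantum determinant at which their images can differ is linear in the
difference on T^{(s)}. The A_n give the diagonal entries, B_n and C_n give the simple off-diagonal
entries of T^{(0)}, and commutators with T^{(0)} give the rest. -/

/-- The elementary difference operator `f ↦ a · τ f`. -/
def diffOp {K : Type*} [Field K] [Algebra ℂ K] (a : K) (τ : K →ₐ[ℂ] K) : Module.End ℂ K :=
  Algebra.lmul ℂ K a * τ.toLinearMap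

@[simp] lemma diffOp_apply {K : Type*} [Field K] [Algebra ℂ K] (a : K) (τ : K →ₐ[ℂ] K) (f : K) :
    diffOp a τ f = a * τ f := rfl

/-! ### Difference operators over a field with commuting shifts -/

/-- Commuting automorphisms `τ n j` of a field, for `j < n < N`, that lower `x n j` by `t` and fix
the other elements `x m k`. -/
structure Shifts {K : Type*} [Field K] [Algebra ℂ K] (N : ℕ) (x : ℕ → ℕ → K) (t : K)
    (τ : ℕ → ℕ → K →ₐ[ℂ] K) : Prop where
  self : ∀ {n j}, n < N → j < n → τ n j (x n j) = x n j - t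
  ne_level : ∀ {n m} (j k), n ≠ m → τ n j (x m k) = x m k
  ne_index : ∀ {j k} (n), j ≠ k → τ n j (x n k) = x n k
  comm : ∀ n j m k f, τ n j (τ m k f) = τ m k (τ n j f)
  fix : ∀ n j, τ n j t = t
  ne_zero : t ≠ 0

namespace Shifts

variable {K : Type*} [Field K] [Algebra ℂ K] {N : ℕ} {x : ℕ → ℕ → K} {t : K}
  {τ : ℕ → ℕ → K →ₐ[ℂ] K}

/-- The field elements `x n j`, `j < n < N`, do not differ from elements fixed by `τ n j`. -/
lemma sub_ne (h : Shifts N x t τ) {n j : ℕ} (hn : n < N) (hj : j < n) {c : K}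
    (hc : τ n j c = c) : x n j - c ≠ 0 := by
  intro h0
  have h1 := congrArg (τ n j) h0
  rw [map_sub, map_zero, hc, h.self hn hj] at h1
  have : t = 0 := by linear_combination h0 - h1
  exact h.ne_zero this

lemma sub_ne_index (h : Shifts N x t τ) {n j k : ℕ} (hn : n < N) (hj : j < n) (hk : j ≠ k) :
    x n j - x n k ≠ 0 := h.sub_ne hn hj (h.ne_index n hk)

lemma sub_add_ne_index (h : Shifts N x t τ) {n j k : ℕ} (hn : n < N) (hj : j < n) (hk : j ≠ k) :
    x n j - x n k + t ≠ 0 := by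
  have := h.sub_ne (c := x n k - t) hn hj (by rw [map_sub, h.ne_index n hk, h.fix])
  rwa [← sub_add] at this

lemma sub_sub_ne_index (h : Shifts N x t τ) {n j k : ℕ} (hn : n < N) (hj : j < n) (hk : j ≠ k) :
    x n j - x n k - t ≠ 0 := by
  have := h.sub_ne (c := x n k + t) hn hj (by rw [map_add, h.ne_index n hk, h.fix])
  rwa [← sub_sub] at this

/-- `p j / ∏_{s ≠ j} (x_{nj} - x_{ns})`. -/
def _root_.GZ.lagCoeff {K : Type*} [Field K] (x : ℕ → ℕ → K) (n : ℕ) (p : ℕ → K) (j : ℕ) : K :=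
  p j / ∏ s ∈ (Finset.range n).erase j, (x n j - x n s)

lemma map_lagCoeff_of_level_ne (h : Shifts N x t τ) {n m : ℕ} (k : ℕ) (hm : m ≠ n) (p : ℕ → K)
    (j : ℕ) : τ m k (lagCoeff x n p j) = τ m k (p j) /
      ∏ s ∈ (Finset.range n).erase j, (x n j - x n s) := by
  simp only [lagCoeff, map_div₀, map_prod, map_sub, h.ne_level _ _ hm]

/-- Isolates the one factor x_j - x_k of the denominator of d_j that the shift of x_k changes. -/
lemma lagCoeff_eq (p : ℕ → K) {n j k : ℕ} (hk : k < n) (hjk : j ≠ k) :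
    lagCoeff x n p j = p j / ((x n j - x n k) *
      ∏ s ∈ ((Finset.range n).erase j).erase k, (x n j - x n s)) := by
  rw [lagCoeff, Finset.mul_prod_erase _ (fun s => x n j - x n s)]
  simp [hk, hjk.symm]

lemma map_lagCoeff (h : Shifts N x t τ) (p : ℕ → K) {n j k : ℕ} (hn : n < N) (hj : j < n)
    (hjk : j ≠ k) (hp : τ n j (p k) = p k) :
    τ n j (lagCoeff x n p k) = p k / ((x n k - x n j + t) *
      ∏ s ∈ ((Finset.range n).erase j).erase k, (x n k - x n s)) := by
  rw [lagCoeff_eq p hj hjk.symm, map_div₀, hp, map_mul, map_sub, h.self hn hj, h.ne_index n hjk,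
    map_prod, Finset.erase_right_comm]
  congr 2
  · ring
  · refine Finset.prod_congr rfl fun s hs => ?_
    simp only [Finset.mem_erase] at hs
    rw [map_sub, h.ne_index n hjk, h.ne_index n hs.2.1.symm]

/-- The exchange relation of the coefficients of a difference operator. -/
lemma exchange (h : Shifts N x t τ) (p : ℕ → K) {n j k : ℕ} (hn : n < N) (hj : j < n) (hk : k < n)
    (hjk : j ≠ k) (hpj : τ n k (p j) = p j) (hpk : τ n j (p k) = p k) :
    (x n j - x n k - t) * (lagCoeff x n p j * τ n j (lagCoeff x n p k)) +
      (x n k - x n j - t) * (lagCoeff x n p k * τ n k (lagCoeff x n p j)) = 0 := by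
  rw [h.map_lagCoeff p hn hj hjk hpk, h.map_lagCoeff p hn hk hjk.symm hpj,
    lagCoeff_eq p hk hjk, lagCoeff_eq p hj hjk.symm, Finset.erase_right_comm (a := k)]
  have h1 := h.sub_ne_index hn hj hjk
  have h2 := h.sub_ne_index hn hk hjk.symm
  have h3 := h.sub_add_ne_index hn hj hjk
  have h4 := h.sub_add_ne_index hn hk hjk.symm
  have p1 : ∏ s ∈ ((Finset.range n).erase j).erase k, (x n j - x n s) ≠ 0 :=
    Finset.prod_ne_zero_iff.2 fun s hs => h.sub_ne_index hn hj (by simp at hs; omega)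
  have p2 : ∏ s ∈ ((Finset.range n).erase j).erase k, (x n k - x n s) ≠ 0 :=
    Finset.prod_ne_zero_iff.2 fun s hs => h.sub_ne_index hn hk (by simp at hs; omega)
  field_simp
  ring

/-- Symmetrising shows that twice the sum is zero; characteristic zero then removes the factor 2. -/
lemma sum_sum_eq_zero {ι : Type*} (s : Finset ι) (F : ι → ι → K)
    (hF : ∀ j ∈ s, ∀ k ∈ s, F j k + F k j = 0) : ∑ j ∈ s, ∑ k ∈ s, F j k = 0 := by
  have : CharZero K := charZero_of_injective_algebraMap (algebraMap ℂ K).injective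
  have h1 : ∑ j ∈ s, ∑ k ∈ s, (F j k + F k j) = 0 :=
    Finset.sum_eq_zero fun j hj => Finset.sum_eq_zero fun k hk => hF j hj k hk
  simp only [Finset.sum_add_distrib] at h1
  rw [Finset.sum_comm (f := fun j k => F k j), ← two_mul] at h1
  simpa using h1

/-- By `exchange`, (x_j - x_k - t) d_j τ_j(d_k) is antisymmetric in j and k, while τ_j τ_k f and q
are symmetric. Hence a weight that contains the factor x_j - x_k - t and vanishes on the diagonal
kills the double sum. -/
lemma sum_exchange (h : Shifts N x t τ) (p : ℕ → K) {n : ℕ} (hn : n < N)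
    (hp : ∀ j < n, ∀ k < n, j ≠ k → τ n k (p j) = p j) (w q : ℕ → ℕ → K)
    (hw0 : ∀ j < n, w j j = 0)
    (hw : ∀ j < n, ∀ k < n, j ≠ k → w j k = (x n j - x n k - t) * q j k)
    (hq : ∀ j < n, ∀ k < n, j ≠ k → q j k = q k j) (f : K) :
    ∑ j ∈ Finset.range n, ∑ k ∈ Finset.range n,
      w j k * (lagCoeff x n p j * τ n j (lagCoeff x n p k)) * τ n j (τ n k f) = 0 := by
  refine sum_sum_eq_zero _ _ fun j hj k hk => ?_
  rw [Finset.mem_range] at hj hk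
  rcases eq_or_ne j k with rfl | hjk
  · simp [hw0 j hj]
  · rw [hw j hj k hk hjk, hw k hk j hj hjk.symm, hq k hk j hj hjk.symm, h.comm n k n j]
    linear_combination (q j k * τ n j (τ n k f)) *
      h.exchange p hn hj hk hjk (hp j hj k hk hjk) (hp k hk j hj hjk.symm)

/-- The cubic Serre relation between a difference operator in the variables of level `n` and an
elementary difference operator `c τ'`, in terms of the factors by which they change each other's
coefficients. -/
lemma cubic (h : Shifts N x t τ) (p : ℕ → K) {n : ℕ} (hn : n < N)
    (hp : ∀ j < n, ∀ k < n, j ≠ k → τ n k (p j) = p j) (c : K) (τ' : K →ₐ[ℂ] K)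
    (hcomm : ∀ j < n, ∀ f, τ n j (τ' f) = τ' (τ n j f)) (R R' : ℕ → K) (q : ℕ → ℕ → K)
    (hR : ∀ j < n, τ n j c = R j * c)
    (hR' : ∀ j < n, τ' (lagCoeff x n p j) = R' j * lagCoeff x n p j)
    (hw0 : ∀ j < n, R j * τ n j (R j) - 2 * (R j * τ n j (R' j)) + R' j * τ n j (R' j) = 0)
    (hw : ∀ j < n, ∀ k < n, j ≠ k → R j * τ n j (R k) - 2 * (R j * τ n j (R' k)) +
      R' j * τ n j (R' k) = (x n j - x n k - t) * q j k)
    (hq : ∀ j < n, ∀ k < n, j ≠ k → q j k = q k j) :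
    ⁅∑ j ∈ Finset.range n, diffOp (lagCoeff x n p j) (τ n j),
      ⁅∑ j ∈ Finset.range n, diffOp (lagCoeff x n p j) (τ n j), diffOp c τ'⁆⁆ = 0 := by
  ext f
  -- With X the sum and Y = c τ', the double bracket is XXY - 2 XYX + YXX. Moving all coefficients
  -- to the left, these three products contribute the three summands of the weight.
  have key := h.sum_exchange p hn hp (fun j k => c * (R j * τ n j (R k) - 2 * (R j * τ n j (R' k)) +
      R' j * τ n j (R' k))) (fun j k => c * q j k) (fun j hj => by rw [hw0 j hj, mul_zero])
      (fun j hj k hk hjk => by rw [hw j hj k hk hjk]; ring)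
      (fun j hj k hk hjk => by rw [hq j hj k hk hjk]) (τ' f)
  set X := ∑ j ∈ Finset.range n, diffOp (lagCoeff x n p j) (τ n j) with hX
  have hXf : ∀ g, X g = ∑ j ∈ Finset.range n, lagCoeff x n p j * τ n j g := fun g => by
    simp [hX, LinearMap.sum_apply]
  have h1 : ⁅X, ⁅X, diffOp c τ'⁆⁆ f = X (X (c * τ' f)) - X (c * τ' (X f)) -
      (X (c * τ' (X f)) - c * τ' (X (X f))) := by
    simp [Ring.lie_def, Module.End.mul_apply, LinearMap.sub_apply]
  rw [h1, LinearMap.zero_apply, ← key]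
  simp only [hXf _, map_sum, map_mul]
  simp only [Finset.mul_sum, ← Finset.sum_sub_distrib]
  refine Finset.sum_congr rfl fun j hj => Finset.sum_congr rfl fun k hk => ?_
  rw [Finset.mem_range] at hj hk
  simp only [← hcomm j hj, ← hcomm k hk, hR k hk, hR j hj, hR' k hk, hR' j hj, map_mul]
  ring

end Shifts

/-! ### Gelfand–Zetlin operators: cubic Serre relations and brackets of different levels -/

/-- The numerators `-t⁻¹ ∏_{r < m} (x_{nj} - x_{mr} - t/2)` of the Gelfand–Zetlin operators. -/
def ladderNum {K : Type*} [Field K] (x : ℕ → ℕ → K) (t : K) (n m j : ℕ) : K :=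
  -t⁻¹ * ∏ r ∈ Finset.range m, (x n j - x m r - t / 2)

/-- The Gelfand–Zetlin operators: for `m = n + 1` and `t = iħ` this is `E_{n,n+1}`, and for
`m = n - 1` and `t = -iħ` it is `E_{n+1,n}`. -/
def ladder {K : Type*} [Field K] [Algebra ℂ K] (x : ℕ → ℕ → K) (t : K)
    (τ : ℕ → ℕ → K →ₐ[ℂ] K) (n m : ℕ) : Module.End ℂ K :=
  ∑ j ∈ Finset.range n, diffOp (lagCoeff x n (ladderNum x t n m) j) (τ n j)

lemma ringLie_sum {R ι : Type*} [Ring R] (a : R) (s : Finset ι) (f : ι → R) :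
    ⁅a, ∑ i ∈ s, f i⁆ = ∑ i ∈ s, ⁅a, f i⁆ := by
  simp only [Ring.lie_def, Finset.mul_sum, Finset.sum_mul, Finset.sum_sub_distrib]

lemma sum_ringLie {R ι : Type*} [Ring R] (a : R) (s : Finset ι) (f : ι → R) :
    ⁅∑ i ∈ s, f i, a⁆ = ∑ i ∈ s, ⁅f i, a⁆ := by
  simp only [Ring.lie_def, Finset.mul_sum, Finset.sum_mul, Finset.sum_sub_distrib]

namespace Shifts

variable {K : Type*} [Field K] [Algebra ℂ K] {N : ℕ} {x : ℕ → ℕ → K} {t t' : K}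
  {τ τ' : ℕ → ℕ → K →ₐ[ℂ] K}

lemma map_ladderNum_of_index (h : Shifts N x t τ) (ht' : ∀ n j, τ n j t' = t') {n m j k : ℕ}
    (hnm : n ≠ m) (hjk : j ≠ k) : τ n k (ladderNum x t' n m j) = ladderNum x t' n m j := by
  simp only [ladderNum, map_mul, map_neg, map_inv₀, ht', map_prod, map_sub, map_div₀,
    h.ne_index n hjk.symm, h.ne_level _ _ hnm, map_ofNat]

lemma map_ladderNum_of_level (h : Shifts N x t τ) (ht' : ∀ n j, τ n j t' = t') {n m l : ℕ}
    (hn : l ≠ n) (hm : l ≠ m) (j k : ℕ) :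
    τ l k (ladderNum x t' n m j) = ladderNum x t' n m j := by
  simp only [ladderNum, map_mul, map_neg, map_inv₀, ht', map_prod, map_sub, map_div₀,
    h.ne_level _ _ hn, h.ne_level _ _ hm, map_ofNat]

lemma map_lagCoeff_ladderNum (h : Shifts N x t τ) (ht' : ∀ n j, τ n j t' = t') {n m l : ℕ}
    (hn : l ≠ n) (hm : l ≠ m) (j k : ℕ) :
    τ l k (lagCoeff x n (ladderNum x t' n m) j) = lagCoeff x n (ladderNum x t' n m) j := by
  rw [h.map_lagCoeff_of_level_ne _ hn, h.map_ladderNum_of_level ht' hn hm, lagCoeff]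

/-- The effect of a shift of `x m r` on a coefficient of `ladder x t' τ n m`. -/
lemma map_lagCoeff_ladderNum_of_neighbour (h : Shifts N x t τ) (ht' : ∀ n j, τ n j t' = t')
    {n m r : ℕ} (hnm : m ≠ n) (hm : m < N) (hr : r < m) (j : ℕ) :
    (x n j - x m r - t' / 2) * τ m r (lagCoeff x n (ladderNum x t' n m) j) =
      (x n j - x m r - t' / 2 + t) * lagCoeff x n (ladderNum x t' n m) j := by
  have hP : ladderNum x t' n m j = -t'⁻¹ * ((x n j - x m r - t' / 2) *
      ∏ s ∈ (Finset.range m).erase r, (x n j - x m s - t' / 2)) := by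
    rw [ladderNum, Finset.mul_prod_erase _ (fun s => x n j - x m s - t' / 2) (by simpa using hr)]
  have hQ : τ m r (∏ s ∈ (Finset.range m).erase r, (x n j - x m s - t' / 2)) =
      ∏ s ∈ (Finset.range m).erase r, (x n j - x m s - t' / 2) := by
    rw [map_prod]
    refine Finset.prod_congr rfl fun s hs => ?_
    rw [map_sub, map_sub, map_div₀, ht', h.ne_level _ _ hnm, map_ofNat,
      h.ne_index m (Finset.ne_of_mem_erase hs).symm]
  rw [h.map_lagCoeff_of_level_ne _ hnm, lagCoeff, hP]
  simp only [map_mul, map_neg, map_inv₀, hQ, map_sub, map_div₀, ht', map_ofNat, h.self hm hr,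
    h.ne_level _ _ hnm]
  ring

lemma sub_half_ne (h : Shifts N x t τ) {n m j : ℕ} (hn : n < N) (hj : j < n) (hnm : n ≠ m) (r : ℕ)
    {c : K} (hc : τ n j c = c) : x n j - x m r - c ≠ 0 := by
  have := h.sub_ne (c := x m r + c) hn hj (by rw [map_add, h.ne_level _ _ hnm, hc])
  rwa [← sub_sub] at this

/-- The inner operator is a sum of terms c τ_{mr}, treated one at a time by `cubic`. The shifts of
level n fix c, while τ_{mr} multiplies the j-th coefficient by (u_j + t)/u_j, where u_j = x_{nj} -
x_{mr} - t/2. -/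
lemma serre_self_neighbour (h : Shifts N x t τ) {n m l : ℕ} (hn : n < N) (hm : m < N)
    (hnm : n ≠ m) (hnl : n ≠ l) :
    ⁅ladder x t τ n m, ⁅ladder x t τ n m, ladder x t τ m l⁆⁆ = 0 := by
  rw [ladder.eq_1 _ _ _ m l, ringLie_sum, ringLie_sum]
  refine Finset.sum_eq_zero fun r hr => ?_
  rw [Finset.mem_range] at hr
  have h2 : ∀ j < n, τ n j (t / 2) = t / 2 := fun j hj => by rw [map_div₀, h.fix, map_ofNat]
  have u0 : ∀ j < n, x n j - x m r - t / 2 ≠ 0 := fun j hj =>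
    h.sub_half_ne hn hj hnm r (h2 j hj)
  have u1 : ∀ j < n, x n j - x m r - t / 2 - t ≠ 0 := fun j hj => by
    have := h.sub_half_ne hn hj hnm r (c := t / 2 + t) (by rw [map_add, h.fix, h2 j hj])
    rwa [← sub_sub] at this
  -- The choice of q comes from 1 - 2(1 + t/u_k) + (1 + t/u_j)(1 + t/u_k) = -t (u_j - u_k - t)/(u_j
  -- u_k). For j = k the shift also changes u_j to u_j - t, and the weight vanishes.
  refine h.cubic _ hn (fun j hj k hk hjk => h.map_ladderNum_of_index h.fix hnm hjk) _ _
    (fun j _ f => h.comm _ _ _ _ _) (fun _ => 1)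
    (fun j => (x n j - x m r - t / 2 + t) / (x n j - x m r - t / 2))
    (fun j k => -t / ((x n j - x m r - t / 2) * (x n k - x m r - t / 2))) ?_ ?_ ?_ ?_ ?_
  · intro j hj
    rw [h.map_lagCoeff_ladderNum h.fix hnm hnl, one_mul]
  · intro j hj
    rw [div_mul_eq_mul_div, eq_div_iff (u0 j hj)]
    linear_combination h.map_lagCoeff_ladderNum_of_neighbour h.fix hnm.symm hm hr j
  · intro j hj
    have a := u0 j hj
    have b := u1 j hj
    have e : τ n j (x n j - x m r - t / 2) = x n j - x m r - t / 2 - t := by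
      rw [map_sub, map_sub, h2 j hj, h.self hn hj, h.ne_level _ _ hnm]; ring
    simp only [map_div₀, map_add, h.fix, e, map_one]
    field_simp
    ring
  · intro j hj k hk hjk
    have a := u0 j hj
    have b := u0 k hk
    have e : τ n j (x n k - x m r - t / 2) = x n k - x m r - t / 2 := by
      rw [map_sub, map_sub, h2 j hj, h.ne_index n hjk, h.ne_level _ _ hnm]
    simp only [map_div₀, map_add, h.fix, e, map_one]
    field_simp
    ring
  · intro j hj k hk hjk
    rw [mul_comm (x n j - x m r - t / 2)]

/-- The mirror image of `serre_self_neighbour`: now the shifts in the double operator change the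
coefficient of the single one, and not conversely, so the two correction factors of `cubic` exchange
their roles. -/
lemma serre_neighbour_self (h : Shifts N x t τ) {n m l : ℕ} (hm : m < N)
    (hnm : n ≠ m) (hml : m ≠ l) (hnl : n ≠ l) :
    ⁅ladder x t τ m l, ⁅ladder x t τ m l, ladder x t τ n m⁆⁆ = 0 := by
  rw [ladder.eq_1 _ _ _ n m, ringLie_sum, ringLie_sum]
  refine Finset.sum_eq_zero fun j hj => ?_
  rw [Finset.mem_range] at hj
  have h2 : ∀ r < m, τ m r (t / 2) = t / 2 := fun r hr => by rw [map_div₀, h.fix, map_ofNat]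
  have u0 : ∀ r < m, x n j - x m r - t / 2 ≠ 0 := fun r hr => by
    have := h.sub_half_ne hm hr hnm.symm j (c := -(t / 2)) (by rw [map_neg, h2 r hr])
    contrapose! this
    linear_combination -this
  have u1 : ∀ r < m, x n j - x m r - t / 2 + t ≠ 0 := fun r hr => by
    have := h.sub_half_ne hm hr hnm.symm j (c := t - t / 2)
      (by rw [map_sub, h.fix, h2 r hr])
    contrapose! this
    linear_combination -this
  refine h.cubic _ hm (fun j hj k hk hjk => h.map_ladderNum_of_index h.fix hml hjk) _ _
    (fun j _ f => h.comm _ _ _ _ _)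
    (fun r => (x n j - x m r - t / 2 + t) / (x n j - x m r - t / 2)) (fun _ => 1)
    (fun r s => -t / ((x n j - x m r - t / 2) * (x n j - x m s - t / 2))) ?_ ?_ ?_ ?_ ?_
  · intro r hr
    rw [div_mul_eq_mul_div, eq_div_iff (u0 r hr)]
    linear_combination h.map_lagCoeff_ladderNum_of_neighbour h.fix hnm.symm hm hr j
  · intro r hr
    rw [h.map_lagCoeff_ladderNum h.fix hnm hnl, one_mul]
  · intro r hr
    have a := u0 r hr
    have b := u1 r hr
    have e : τ m r (x n j - x m r - t / 2) = x n j - x m r - t / 2 + t := by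
      rw [map_sub, map_sub, h2 r hr, h.self hm hr, h.ne_level _ _ hnm.symm]; ring
    simp only [map_div₀, map_add, h.fix, e, map_one]
    field_simp
    ring
  · intro r hr s hs hrs
    have a := u0 r hr
    have b := u0 s hs
    have e : τ m r (x n j - x m s - t / 2) = x n j - x m s - t / 2 := by
      rw [map_sub, map_sub, h2 r hr, h.ne_index m hrs, h.ne_level _ _ hnm.symm]
    simp only [map_div₀, map_add, h.fix, e, map_one]
    field_simp
    ring
  · intro r hr s hs hrs
    rw [mul_comm (x n j - x m r - t / 2)]

/-- Both products are multiples of the same automorphism αβ, so only their coefficients need to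
agree. -/
lemma _root_.GZ.lie_diffOp (a b : K) (α β : K →ₐ[ℂ] K) (hc : ∀ f, α (β f) = β (α f))
    (hab : a * α b = b * β a) : ⁅diffOp a α, diffOp b β⁆ = 0 := by
  ext f
  simp only [Ring.lie_def, LinearMap.sub_apply, Module.End.mul_apply, diffOp_apply, map_mul, hc,
    LinearMap.zero_apply]
  linear_combination β (α f) * hab

/-- Gelfand–Zetlin operators of unrelated levels commute. -/
lemma lie_ladder_eq_zero (h : Shifts N x t τ) (h' : Shifts N x t' τ')
    (ht' : ∀ n j, τ n j t' = t') (ht : ∀ n j, τ' n j t = t)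
    (hc : ∀ n j m k f, τ n j (τ' m k f) = τ' m k (τ n j f)) {n m n' m' : ℕ} (h1 : n ≠ n')
    (h2 : n ≠ m') (h3 : n' ≠ m) : ⁅ladder x t τ n m, ladder x t' τ' n' m'⁆ = 0 := by
  simp only [ladder, sum_ringLie, ringLie_sum]
  refine Finset.sum_eq_zero fun k _ => Finset.sum_eq_zero fun j _ => ?_
  refine lie_diffOp _ _ _ _ (hc _ _ _ _) ?_
  rw [h.map_lagCoeff_ladderNum ht' h1 h2, h'.map_lagCoeff_ladderNum ht h1.symm h3, mul_comm]

/-- A raising and a lowering operator of neighbouring levels commute. -/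
lemma lie_ladder_neighbour (h : Shifts N x t τ) (h' : Shifts N x (-t) τ')
    (ht : ∀ n j, τ' n j t = t)
    (hc : ∀ n j m k f, τ n j (τ' m k f) = τ' m k (τ n j f)) {n m : ℕ} (hn : n < N) (hm : m < N)
    (hnm : n ≠ m) :
    ⁅ladder x t τ n m, ladder x (-t) τ' m n⁆ = 0 := by
  have ht' : ∀ n j, τ n j (-t) = -t := fun n j => by rw [map_neg, h.fix]
  simp only [ladder, sum_ringLie, ringLie_sum]
  refine Finset.sum_eq_zero fun j hj => Finset.sum_eq_zero fun k hk => ?_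
  rw [Finset.mem_range] at hj hk
  refine lie_diffOp _ _ _ _ (hc _ _ _ _) ?_
  have e1 := h.map_lagCoeff_ladderNum_of_neighbour ht' hnm hn hk j
  have e2 := h'.map_lagCoeff_ladderNum_of_neighbour ht hnm.symm hm hj k
  have a : x n k - x m j - t / 2 ≠ 0 := h.sub_half_ne hn hk hnm _ (by
    rw [map_div₀, h.fix, map_ofNat])
  -- With u = x_{nk} - x_{mj} - t/2, each shift multiplies the other operator's coefficient by (u -
  -- t)/u, so both orders of multiplication give the same coefficient.
  have e3 : (x n k - x m j - t / 2) *
      (lagCoeff x n (ladderNum x t n m) k *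
        (τ n k) (lagCoeff x m (ladderNum x (-t) m n) j)) = (x n k - x m j - t / 2) *
      (lagCoeff x m (ladderNum x (-t) m n) j *
        (τ' m j) (lagCoeff x n (ladderNum x t n m) k)) := by
    linear_combination -lagCoeff x n (ladderNum x t n m) k * e1 -
      lagCoeff x m (ladderNum x (-t) m n) j * e2
  exact mul_left_cancel₀ a e3

end Shifts

/-! ### The bracket of a raising and a lowering operator of the same level -/

/-- Sum of the residues of a quotient of two monic polynomials of the same degree. -/
lemma sum_prod_div_prod_erase {F ι κ : Type*} [Field F] [DecidableEq ι] (s : Finset ι)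
    (s' : Finset κ) (v : ι → F) (w : κ → F) (hv : Set.InjOn v s) (hs : s.Nonempty)
    (hcard : s'.card = s.card) :
    ∑ i ∈ s, (∏ r ∈ s', (v i - w r)) / ∏ j ∈ s.erase i, (v i - v j) =
      ∑ i ∈ s, v i - ∑ r ∈ s', w r := by
  open Polynomial in
  set P : F[X] := ∏ r ∈ s', (X - C (w r)) with hP
  set Q : F[X] := ∏ i ∈ s, (X - C (v i)) with hQ
  have mP : P.Monic := monic_prod_of_monic _ _ fun _ _ => monic_X_sub_C _
  have mQ : Q.Monic := monic_prod_of_monic _ _ fun _ _ => monic_X_sub_C _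
  have dP : P.natDegree = s'.card := natDegree_finsetProd_X_sub_C_eq_card s' w
  have dQ : Q.natDegree = s.card := natDegree_finsetProd_X_sub_C_eq_card s v
  -- P - Q agrees with P at the roots of Q and has smaller degree, so Lagrange interpolation writes
  -- its coefficient of degree |s| - 1 as the sum on the left.
  have hd : (P - Q).degree < s.card := by
    have := degree_sub_lt_left (p := P) (q := Q)
      (by rw [degree_eq_natDegree mP.ne_zero, degree_eq_natDegree mQ.ne_zero, dP, dQ, hcard])
      mP.ne_zero (by rw [mP.leadingCoeff, mQ.leadingCoeff])
    rwa [degree_eq_natDegree mP.ne_zero, dP, hcard] at this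
  have hpos : 0 < s.card := hs.card_pos
  have cP : P.coeff (s.card - 1) = -∑ r ∈ s', w r := by
    have : P.nextCoeff = -∑ r ∈ s', w r := prod_X_sub_C_nextCoeff w
    rwa [nextCoeff_of_natDegree_pos (by omega), dP, hcard] at this
  have cQ : Q.coeff (s.card - 1) = -∑ r ∈ s, v r := by
    have : Q.nextCoeff = -∑ r ∈ s, v r := prod_X_sub_C_nextCoeff v
    rwa [nextCoeff_of_natDegree_pos (by omega), dQ] at this
  have key := Lagrange.coeff_eq_sum hv hd
  rw [coeff_sub, cP, cQ] at key
  have e : ∀ i ∈ s, (P - Q).eval (v i) = ∏ r ∈ s', (v i - w r) := fun i hi => by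
    rw [eval_sub, hP, hQ, eval_prod, eval_prod, Finset.prod_eq_zero hi (by simp)]
    simp
  rw [Finset.sum_congr rfl fun i hi => by rw [← e i hi], ← key]
  ring

namespace Shifts

variable {K : Type*} [Field K] [Algebra ℂ K] {N : ℕ} {x : ℕ → ℕ → K} {t : K}
  {τ τ' : ℕ → ℕ → K →ₐ[ℂ] K}

/-- The shifts of x_j and x_k go in opposite directions, so each changes the difference x_j - x_k in
the other's denominator by the same amount, and the two products have equal coefficients. -/
lemma lie_diffOp_index (h : Shifts N x t τ) (h' : Shifts N x (-t) τ')
    (hc : ∀ n j m k f, τ n j (τ' m k f) = τ' m k (τ n j f)) (p p' : ℕ → K) {n j k : ℕ}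
    (hn : n < N) (hj : j < n) (hk : k < n) (hjk : j ≠ k) (hp : τ' n k (p j) = p j)
    (hp' : τ n j (p' k) = p' k) :
    ⁅diffOp (lagCoeff x n p j) (τ n j), diffOp (lagCoeff x n p' k) (τ' n k)⁆ = 0 := by
  refine lie_diffOp _ _ _ _ (hc _ _ _ _) ?_
  rw [h.map_lagCoeff _ hn hj hjk hp', h'.map_lagCoeff _ hn hk hjk.symm hp, lagCoeff_eq p hk hjk,
    lagCoeff_eq p' hj hjk.symm, Finset.erase_right_comm (a := k)]
  have h1 := h.sub_ne_index hn hj hjk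
  have h2 := h.sub_ne_index hn hk hjk.symm
  have h3 := h.sub_add_ne_index hn hk hjk.symm
  have h4 : x n j - x n k + -t ≠ 0 := by
    rw [← sub_eq_add_neg]; exact h.sub_sub_ne_index hn hj hjk
  have p1 : ∏ s ∈ ((Finset.range n).erase j).erase k, (x n j - x n s) ≠ 0 :=
    Finset.prod_ne_zero_iff.2 fun s hs => h.sub_ne_index hn hj (by simp at hs; omega)
  have p2 : ∏ s ∈ ((Finset.range n).erase j).erase k, (x n k - x n s) ≠ 0 :=
    Finset.prod_ne_zero_iff.2 fun s hs => h.sub_ne_index hn hk (by simp at hs; omega)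
  field_simp
  ring

/-- The commutator of the raising and the lowering operator of the same level. -/
lemma lie_ladder_self (h : Shifts N x t τ) (h' : Shifts N x (-t) τ')
    (hc : ∀ n j m k f, τ n j (τ' m k f) = τ' m k (τ n j f))
    (hinv : ∀ n j f, τ n j (τ' n j f) = f) {n m l : ℕ} (hn : n < N) (hn0 : 0 < n) (hnm : n ≠ m)
    (hnl : n ≠ l) (hml : m + l = 2 * n) :
    ⁅ladder x t τ n m, ladder x (-t) τ' n l⁆ =
      Algebra.lmul ℂ K (t⁻¹ * (2 * ∑ j ∈ Finset.range n, x n j - ∑ r ∈ Finset.range m, x m r -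
        ∑ r ∈ Finset.range l, x l r)) := by
  have : CharZero K := charZero_of_injective_algebraMap (algebraMap ℂ K).injective
  have ht : ∀ n j, τ' n j t = t := fun n j => by simpa using h'.fix n j
  have ht' : ∀ n j, τ n j (-t) = -t := fun n j => by rw [map_neg, h.fix]
  have t0 := h.ne_zero
  set d := lagCoeff x n (ladderNum x t n m) with hd
  set b := lagCoeff x n (ladderNum x (-t) n l) with hb
  have h1 : ⁅ladder x t τ n m, ladder x (-t) τ' n l⁆ =
      ∑ j ∈ Finset.range n, ⁅diffOp (d j) (τ n j), diffOp (b j) (τ' n j)⁆ := by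
    rw [ladder, ladder, sum_ringLie]
    refine Finset.sum_congr rfl fun j hj => ?_
    rw [ringLie_sum, Finset.sum_eq_single_of_mem j hj]
    intro k hk hkj
    rw [Finset.mem_range] at hj hk
    exact h.lie_diffOp_index h' hc _ _ hn hj hk hkj.symm
      (h'.map_ladderNum_of_index ht hnm hkj.symm) (h.map_ladderNum_of_index ht' hnl hkj)
  have h2 : ∀ j, ⁅diffOp (d j) (τ n j), diffOp (b j) (τ' n j)⁆ =
      Algebra.lmul ℂ K (d j * τ n j (b j) - b j * τ' n j (d j)) := fun j => by
    ext f
    have e1 : τ' n j (τ n j f) = f := by rw [← hc, hinv]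
    simp only [Ring.lie_def, LinearMap.sub_apply, Module.End.mul_apply, diffOp_apply, map_mul,
      hinv, e1, map_sub, Algebra.coe_lmul_eq_mul, LinearMap.mul_apply']
  rw [h1, Finset.sum_congr rfl fun j _ => h2 j, ← map_sum]
  congr 1
  -- The diagonal terms are residues at the 2n points x_{nj} and x_{nj} + t. The numerator has m + l
  -- = 2n zeros, the variables of the two adjacent levels moved by t/2.
  let v : ℕ ⊕ ℕ → K := Sum.elim (x n) (fun j => x n j + t)
  let w : ℕ ⊕ ℕ → K := Sum.elim (fun r => x m r + t / 2) (fun r => x l r + t / 2)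
  have hv : Set.InjOn v ((Finset.range n).disjSum (Finset.range n)) := by
    rintro (i | i) hi (j | j) hj hij <;>
      simp only [Finset.mem_coe, Finset.inl_mem_disjSum, Finset.inr_mem_disjSum,
        Finset.mem_range] at hi hj <;>
      simp only [v, Sum.elim_inl, Sum.elim_inr] at hij
    · by_contra hne
      exact h.sub_ne_index hn hi (fun e => hne (by rw [e])) (sub_eq_zero.2 hij)
    · exfalso
      rcases eq_or_ne i j with rfl | hne
      · exact t0 (by linear_combination -hij)
      · exact h.sub_sub_ne_index hn hi hne (by linear_combination hij)
    · exfalso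
      rcases eq_or_ne i j with rfl | hne
      · exact t0 (by linear_combination hij)
      · exact h.sub_add_ne_index hn hi hne (by linear_combination hij)
    · by_contra hne
      exact h.sub_ne_index hn hi (fun e => hne (by rw [e])) (by linear_combination hij)
  have key := sum_prod_div_prod_erase ((Finset.range n).disjSum (Finset.range n))
    ((Finset.range m).disjSum (Finset.range l)) v w hv ⟨Sum.inl 0, by simp [hn0]⟩ (by
      simp [Finset.card_disjSum, hml, two_mul])
  have er1 : ∀ j < n, ((Finset.range n).disjSum (Finset.range n)).erase (Sum.inl j) =
      ((Finset.range n).erase j).disjSum (Finset.range n) := fun j hj => by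
    ext (i | i) <;> simp
  have er2 : ∀ j < n, ((Finset.range n).disjSum (Finset.range n)).erase (Sum.inr j) =
      (Finset.range n).disjSum ((Finset.range n).erase j) := fun j hj => by
    ext (i | i) <;> simp
  rw [Finset.sum_disjSum, Finset.sum_disjSum, Finset.sum_disjSum, ← Finset.sum_add_distrib] at key
  have hterm : ∀ j ∈ Finset.range n, d j * τ n j (b j) - b j * τ' n j (d j) =
      t⁻¹ * ((∏ r ∈ (Finset.range m).disjSum (Finset.range l), (v (Sum.inl j) - w r)) /
        ∏ k ∈ ((Finset.range n).disjSum (Finset.range n)).erase (Sum.inl j),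
          (v (Sum.inl j) - v k) +
        (∏ r ∈ (Finset.range m).disjSum (Finset.range l), (v (Sum.inr j) - w r)) /
        ∏ k ∈ ((Finset.range n).disjSum (Finset.range n)).erase (Sum.inr j),
          (v (Sum.inr j) - v k)) := by
    intro j hj
    have hj' := Finset.mem_range.1 hj
    rw [er1 j hj', er2 j hj']
    simp only [Finset.prod_disjSum, v, w, Sum.elim_inl, Sum.elim_inr, add_sub_add_right_eq_sub]
    rw [← Finset.mul_prod_erase _ (fun s => x n j - (x n s + t)) hj,
      ← Finset.mul_prod_erase _ (fun s => x n j + t - x n s) hj]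
    have q1 : τ n j (b j) = t⁻¹ * (∏ r ∈ Finset.range l, (x n j - (x l r + t / 2))) /
        ∏ s ∈ (Finset.range n).erase j, (x n j - (x n s + t)) := by
      rw [hb, lagCoeff, ladderNum, map_div₀, map_mul, map_neg, map_inv₀, ht', map_prod, map_prod]
      congr 1
      · congr 1
        · rw [inv_neg, neg_neg]
        · refine Finset.prod_congr rfl fun r hr => ?_
          rw [map_sub, map_sub, map_div₀, ht', h.ne_level _ _ hnl, h.self hn hj', map_ofNat]
          ring
      · refine Finset.prod_congr rfl fun r hr => ?_
        rw [map_sub, h.self hn hj', h.ne_index n (Finset.ne_of_mem_erase hr).symm]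
        ring
    have q2 : τ' n j (d j) = -t⁻¹ * (∏ r ∈ Finset.range m, (x n j + t - (x m r + t / 2))) /
        ∏ s ∈ (Finset.range n).erase j, (x n j + t - x n s) := by
      rw [hd, lagCoeff, ladderNum, map_div₀, map_mul, map_neg, map_inv₀, ht, map_prod, map_prod]
      congr 1
      · congr 1
        refine Finset.prod_congr rfl fun r hr => ?_
        rw [map_sub, map_sub, map_div₀, ht, h'.ne_level _ _ hnm, h'.self hn hj', map_ofNat]
        ring
      · refine Finset.prod_congr rfl fun r hr => ?_
        rw [map_sub, h'.self hn hj', h'.ne_index n (Finset.ne_of_mem_erase hr).symm]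
        ring
    have q3 : d j = -t⁻¹ * (∏ r ∈ Finset.range m, (x n j - (x m r + t / 2))) /
        ∏ s ∈ (Finset.range n).erase j, (x n j - x n s) := by
      simp only [hd, lagCoeff, ladderNum, ← sub_sub]
    have q4 : b j = t⁻¹ * (∏ r ∈ Finset.range l, (x n j + t - (x l r + t / 2))) /
        ∏ s ∈ (Finset.range n).erase j, (x n j - x n s) := by
      rw [hb, lagCoeff, ladderNum, inv_neg, neg_neg]
      congr 2
      refine Finset.prod_congr rfl fun r hr => ?_
      ring
    rw [q1, q2, q3, q4]
    have n1 : ∏ s ∈ (Finset.range n).erase j, (x n j - x n s) ≠ 0 :=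
      Finset.prod_ne_zero_iff.2 fun s hs => h.sub_ne_index hn hj' (by simp at hs; omega)
    have n2 : ∏ s ∈ (Finset.range n).erase j, (x n j - (x n s + t)) ≠ 0 :=
      Finset.prod_ne_zero_iff.2 fun s hs => by
        rw [← sub_sub]; exact h.sub_sub_ne_index hn hj' (by simp at hs; omega)
    have n3 : ∏ s ∈ (Finset.range n).erase j, (x n j + t - x n s) ≠ 0 :=
      Finset.prod_ne_zero_iff.2 fun s hs => by
        rw [add_sub_right_comm]; exact h.sub_add_ne_index hn hj' (by simp at hs; omega)
    rw [show x n j - (x n j + t) = -t by ring, show x n j + t - x n j = t by ring]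
    generalize ∏ s ∈ (Finset.range n).erase j, (x n j - x n s) = A1 at *
    generalize ∏ s ∈ (Finset.range n).erase j, (x n j - (x n s + t)) = A2 at *
    generalize ∏ s ∈ (Finset.range n).erase j, (x n j + t - x n s) = A3 at *
    generalize ∏ r ∈ Finset.range m, (x n j - (x m r + t / 2)) = B1
    generalize ∏ r ∈ Finset.range m, (x n j + t - (x m r + t / 2)) = B2
    generalize ∏ r ∈ Finset.range l, (x n j - (x l r + t / 2)) = B3
    generalize ∏ r ∈ Finset.range l, (x n j + t - (x l r + t / 2)) = B4
    field_simp
    ring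
  rw [Finset.sum_congr rfl hterm, ← Finset.mul_sum, key]
  congr 1
  simp only [v, w, Sum.elim_inl, Sum.elim_inr, Finset.sum_add_distrib, Finset.sum_const,
    Finset.card_range, nsmul_eq_mul]
  -- The translations cancel: the poles contribute n t in total and the zeros (m + l) t/2.
  have : (m : K) + l = 2 * n := by exact_mod_cast hml
  linear_combination (-t / 2) * this

end Shifts

/-! ### The Serre presentation of `gl(N)` -/

/-- `gl(N)` is generated as a Lie algebra by `E_{ii}`, `E_{i,i+1}` and `E_{i+1,i}`. -/
lemma gl_induction {N : ℕ} {P : gl N → Prop} (h0 : P 0) (hadd : ∀ x y, P x → P y → P (x + y))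
    (hsmul : ∀ (c : ℂ) x, P x → P (c • x)) (hlie : ∀ x y, P x → P y → P (x * y - y * x))
    (hd : ∀ i, P (Matrix.single i i 1))
    (hu : ∀ (i : ℕ) (hi : i + 1 < N), P (Matrix.single ⟨i, by omega⟩ ⟨i + 1, hi⟩ 1))
    (hl : ∀ (i : ℕ) (hi : i + 1 < N), P (Matrix.single ⟨i + 1, hi⟩ ⟨i, by omega⟩ 1)) (x : gl N) :
    P x := by
  have hup : ∀ (d i : ℕ) (hi : i + 1 + d < N),
      P (Matrix.single ⟨i, by omega⟩ ⟨i + 1 + d, hi⟩ 1) := by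
    intro d
    induction d with
    | zero => exact fun i hi => hu i hi
    | succ d ih =>
      intro i hi
      have := hlie _ _ (ih i (by omega)) (hu (i + 1 + d) hi)
      rwa [Matrix.single_mul_single_same, Matrix.single_mul_single_of_ne _ _ _ _ (by
        simp only [ne_eq, Fin.mk.injEq]; omega), sub_zero, one_mul] at this
  have hlow : ∀ (d i : ℕ) (hi : i + 1 + d < N),
      P (Matrix.single ⟨i + 1 + d, hi⟩ ⟨i, by omega⟩ 1) := by
    intro d
    induction d with
    | zero => exact fun i hi => hl i hi
    | succ d ih =>
      intro i hi
      have := hlie _ _ (hl (i + 1 + d) hi) (ih i (by omega))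
      rwa [Matrix.single_mul_single_same, Matrix.single_mul_single_of_ne _ _ _ _ (by
        simp only [ne_eq, Fin.mk.injEq]; omega), sub_zero, one_mul] at this
  have hs : ∀ i j, P (Matrix.single i j 1) := by
    rintro ⟨i, hi⟩ ⟨j, hj⟩
    rcases lt_trichotomy i j with h | h | h
    · obtain ⟨d, rfl⟩ := Nat.exists_eq_add_of_le h
      exact hup d i hj
    · subst h; exact hd _
    · obtain ⟨d, rfl⟩ := Nat.exists_eq_add_of_le h
      exact hlow d j hi
  have hsum : ∀ (s : Finset (Fin N × Fin N)), P (∑ a ∈ s, x a.1 a.2 • Matrix.single a.1 a.2 1) :=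
    fun s => Finset.sum_induction _ P hadd h0 fun a _ => hsmul _ _ (hs _ _)
  have := hsum Finset.univ
  rw [Fintype.sum_prod_type] at this
  convert this using 1
  conv_lhs => rw [Matrix.matrix_eq_sum_single x]
  simp [Matrix.smul_single]

/-- Elements `e k`, `f k`, `H i` of a Lie algebra that satisfy the Serre relations of `gl(N)`. -/
structure SerreData {L : Type*} [LieRing L] (N : ℕ) (e f H : ℕ → L) : Prop where
  HH : ∀ {i j}, i < N → j < N → ⁅H i, H j⁆ = 0
  He : ∀ {i k}, i < N → k + 1 < N →
    ⁅H i, e k⁆ = ((if i = k then 1 else 0) - (if i = k + 1 then 1 else 0) : ℤ) • e k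
  Hf : ∀ {i k}, i < N → k + 1 < N →
    ⁅H i, f k⁆ = -((if i = k then 1 else 0) - (if i = k + 1 then 1 else 0) : ℤ) • f k
  ef : ∀ {k l}, k + 1 < N → l + 1 < N → ⁅e k, f l⁆ = if k = l then H k - H (k + 1) else 0
  ee : ∀ {k l}, k + 1 < l → l + 1 < N → ⁅e k, e l⁆ = 0
  ff : ∀ {k l}, k + 1 < l → l + 1 < N → ⁅f k, f l⁆ = 0
  e_succ : ∀ {k}, k + 2 < N → ⁅e k, ⁅e k, e (k + 1)⁆⁆ = 0
  e_pred : ∀ {k}, k + 2 < N → ⁅e (k + 1), ⁅e (k + 1), e k⁆⁆ = 0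
  f_succ : ∀ {k}, k + 2 < N → ⁅f k, ⁅f k, f (k + 1)⁆⁆ = 0
  f_pred : ∀ {k}, k + 2 < N → ⁅f (k + 1), ⁅f (k + 1), f k⁆⁆ = 0

/-- The iterated brackets `[…[[e i, e (i+1)], e (i+2)] …, e (i+d)]`. -/
def iterBracket {L : Type*} [LieRing L] (e : ℕ → L) (i : ℕ) : ℕ → L
  | 0 => e i
  | d + 1 => ⁅iterBracket e i d, e (i + d + 1)⁆

/-- The elements that correspond to the matrix units. -/
def serreE {L : Type*} [LieRing L] (e f H : ℕ → L) (i j : ℕ) : L :=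
  if i < j then iterBracket e i (j - i - 1)
  else if i = j then H i else -iterBracket (-f) j (i - j - 1)

namespace SerreData

variable {L : Type*} [LieRing L] {N : ℕ} {e f H : ℕ → L}

/-- The Chevalley involution E_{ij} ↦ -E_{ji}. It transfers statements about raising elements to
lowering ones, and it explains the signs in `serreE` below the diagonal. -/
lemma symm (h : SerreData N e f H) : SerreData N (-f) (-e) (-H) where
  HH hi hj := by simp [h.HH hi hj]
  He hi hk := by
    rw [Pi.neg_apply, Pi.neg_apply, lie_neg, neg_lie, neg_neg, h.Hf hi hk, neg_smul, smul_neg]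
  Hf hi hk := by
    rw [Pi.neg_apply, Pi.neg_apply, lie_neg, neg_lie, neg_neg, h.He hi hk, neg_smul, smul_neg,
      neg_neg]
  ef {k l} hk hl := by
    simp only [Pi.neg_apply, lie_neg, neg_lie, neg_neg]
    rw [← lie_skew, h.ef hl hk]
    by_cases hkl : k = l
    · subst hkl; simp; abel
    · simp [hkl, Ne.symm hkl]
  ee hk hl := by simp [h.ff hk hl]
  ff hk hl := by simp [h.ee hk hl]
  e_succ hk := by simp [h.f_succ hk]
  e_pred hk := by simp [h.f_pred hk]
  f_succ hk := by simp [h.e_succ hk]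
  f_pred hk := by simp [h.e_pred hk]

lemma ee' (h : SerreData N e f H) {k l : ℕ} (hk : k + 1 < N) (hl : l + 1 < N)
    (hkl : k + 1 < l ∨ l + 1 < k) : ⁅e k, e l⁆ = 0 := by
  rcases hkl with hkl | hkl
  · exact h.ee hkl hl
  · rw [← lie_skew, h.ee hkl hk, neg_zero]

lemma lie_iterBracket_far (h : SerreData N e f H) {k i d : ℕ} (hk : k + 1 < N) (hd : i + d + 1 < N)
    (hki : k + 1 < i ∨ i + d + 1 < k) : ⁅e k, iterBracket e i d⁆ = 0 := by
  induction d with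
  | zero => exact h.ee' hk (by omega) (by omega)
  | succ d ih =>
    rw [iterBracket, leibniz_lie, ih (by omega) (by omega), h.ee' hk (by omega) (by omega),
      zero_lie, lie_zero, add_zero]

/-- The brackets grow on the right by definition; since distant generators commute, the Jacobi
identity lets them grow on the left as well. -/
lemma lie_iterBracket_pred (h : SerreData N e f H) {k d : ℕ} (hd : k + d + 2 < N) :
    ⁅e k, iterBracket e (k + 1) d⁆ = iterBracket e k (d + 1) := by
  induction d with
  | zero => rfl
  | succ d ih =>
    rw [iterBracket, leibniz_lie, ih (by omega), h.ee' (by omega) (by omega) (by omega), lie_zero,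
      add_zero, iterBracket.eq_2 _ k (d + 1)]
    congr 2
    omega

lemma lie_iterBracket_last (e : ℕ → L) (i d : ℕ) :
    ⁅e (i + d + 1), iterBracket e i d⁆ = -iterBracket e i (d + 1) := by
  rw [iterBracket, lie_skew]

/-- Write e_0, e_1, e_2 for the three generators. As e_1 kills [e_0, e_1], the element is [[e_0,
e_1], [e_1, e_2]]. Expanding this in the other way and using [e_1, [e_1, e_2]] = 0 gives minus the
element itself, so it is zero over ℂ. -/
lemma lie_iterBracket_two [LieAlgebra ℂ L] (h : SerreData N e f H) {i : ℕ} (hi : i + 3 < N) :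
    ⁅e (i + 1), iterBracket e i 2⁆ = 0 := by
  have h1 : iterBracket e i 2 = ⁅⁅e i, e (i + 1)⁆, e (i + 2)⁆ := rfl
  have hb : ⁅e (i + 1), ⁅e i, e (i + 1)⁆⁆ = 0 := by
    rw [← lie_skew (e i) (e (i + 1)), lie_neg, h.e_pred (by omega), neg_zero]
  have h2 : ⁅e (i + 1), iterBracket e i 2⁆ = ⁅⁅e i, e (i + 1)⁆, ⁅e (i + 1), e (i + 2)⁆⁆ := by
    rw [h1, leibniz_lie, hb, zero_lie, zero_add]
  have h3 : ⁅e i, ⁅e (i + 1), e (i + 2)⁆⁆ = iterBracket e i 2 := by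
    rw [leibniz_lie, h.ee (k := i) (l := i + 2) (by omega) (by omega), lie_zero, add_zero, h1]
  have h4 : ⁅e (i + 1), iterBracket e i 2⁆ = -⁅e (i + 1), iterBracket e i 2⁆ := by
    conv_lhs => rw [h2, lie_lie, h.e_succ (by omega), lie_zero, zero_sub, h3]
  have h5 : (2 : ℂ) • ⁅e (i + 1), iterBracket e i 2⁆ = 0 := by
    rw [two_smul]; exact eq_neg_iff_add_eq_zero.1 h4
  simpa using h5

/-- Peel off an end factor that commutes with e_k: the last one if k is small, the first one if k is
large. The brackets of length two are the cubic relations, and the middle factor of a bracket of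
length three is `lie_iterBracket_two`. -/
lemma lie_iterBracket_interior [LieAlgebra ℂ L] (h : SerreData N e f H) {k i d : ℕ}
    (hd : i + d + 1 < N) (hik : i ≤ k) (hkd : k ≤ i + d) : ⁅e k, iterBracket e i d⁆ = 0 := by
  induction d generalizing i with
  | zero =>
    obtain rfl : k = i := by omega
    exact lie_self _
  | succ d ih =>
    rcases Nat.lt_or_ge k (i + d) with h1 | h1
    · rw [iterBracket, leibniz_lie, ih (by omega) hik (by omega),
        h.ee' (by omega) (by omega) (by omega), zero_lie, lie_zero, add_zero]
    rcases d with _ | d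
    · obtain rfl | rfl : k = i ∨ k = i + 1 := by omega
      · exact h.e_succ (by omega)
      · rw [iterBracket, iterBracket, ← lie_skew (e i) (e (i + 0 + 1)), lie_neg,
          h.e_pred (by omega), neg_zero]
    · obtain ⟨rfl, rfl⟩ | h2 : (d = 0 ∧ k = i + 1) ∨ i + 1 < k := by omega
      · exact h.lie_iterBracket_two (by omega)
      · rw [← h.lie_iterBracket_pred (by omega), leibniz_lie, ih (by omega) (by omega) (by omega),
          h.ee' (by omega) (by omega) (by omega), zero_lie, lie_zero, add_zero]

lemma lie_H_iterBracket (h : SerreData N e f H) {k i d : ℕ} (hk : k < N) (hd : i + d + 1 < N) :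
    ⁅H k, iterBracket e i d⁆ =
      ((if k = i then 1 else 0) - (if k = i + d + 1 then 1 else 0) : ℤ) • iterBracket e i d := by
  induction d with
  | zero => exact h.He hk hd
  | succ d ih =>
    rw [iterBracket, leibniz_lie, ih (by omega), h.He hk (by omega), smul_lie, lie_smul, ← add_smul]
    congr 1
    exact sub_add_sub_cancel _ _ _

/-- Contracting f_k with an end factor leaves H_k - H_{k+1}, which acts on the remaining bracket by
its weight. Contracting with an interior factor leaves the bracket of two distant pieces, which is
zero. -/
lemma lie_f_iterBracket (h : SerreData N e f H) {k i d : ℕ} (hk : k + 1 < N)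
    (hd : i + (d + 1) + 1 < N) : ⁅f k, iterBracket e i (d + 1)⁆ =
      (if k = i then iterBracket e (i + 1) d else 0) -
        (if k = i + d + 1 then iterBracket e i d else 0) := by
  have hfe : ∀ {k l}, k + 1 < N → l + 1 < N →
      ⁅f k, e l⁆ = -(if k = l then H l - H (l + 1) else 0) := fun {k l} hk hl => by
    rw [← lie_skew, h.ef hl hk]
    simp only [eq_comm]
  induction d generalizing i with
  | zero =>
    change ⁅f k, ⁅e i, e (i + 1)⁆⁆ =
      (if k = i then e (i + 1) else 0) - (if k = i + 1 then e i else 0)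
    rw [leibniz_lie, hfe hk (by omega), hfe hk (by omega)]
    rcases eq_or_ne k i with rfl | h1
    · have h1 : k ≠ k + 1 + 1 := by omega
      simp [h1, h.He (i := k) (k := k + 1) (by omega) (by omega),
        h.He (i := k + 1) (k := k + 1) (by omega) (by omega)]
    · rcases eq_or_ne k (i + 1) with rfl | h2
      · have h2 : i + 1 + 1 ≠ i := by omega
        simp only [h1, if_true, if_false, neg_zero, zero_lie, zero_add, zero_sub, lie_neg, lie_skew]
        simp [h2, h.He (i := i + 1) (k := i) (by omega) (by omega),
          h.He (i := i + 1 + 1) (k := i) (by omega) (by omega)]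
      · simp [h1, h2]
  | succ d ih =>
    rw [iterBracket, leibniz_lie, ih (by omega), hfe hk (by omega)]
    rcases eq_or_ne k i with rfl | h1
    · have : k ≠ k + (d + 1) + 1 := by omega
      have h2 : k ≠ k + d + 1 := by omega
      simp only [if_true, this, h2, if_false, neg_zero, lie_zero, add_zero, sub_zero]
      rw [iterBracket.eq_2 _ (k + 1) d]
      congr 2
      omega
    · rcases eq_or_ne k (i + d + 1) with rfl | h2
      · have h3 : i + d + 1 ≠ i + (d + 1) + 1 := by omega
        simp only [h1, h3, if_true, if_false, neg_zero, lie_zero, add_zero, zero_sub, neg_lie,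
          sub_zero]
        rw [← lie_skew, h.lie_iterBracket_far (by omega) (by omega) (by omega)]
        simp
      · rcases eq_or_ne k (i + (d + 1) + 1) with rfl | h3
        · simp only [h1, h2, if_true, if_false, sub_zero, zero_lie, zero_add, zero_sub]
          rw [lie_neg, lie_skew, sub_lie, h.lie_H_iterBracket (by omega) (by omega),
            h.lie_H_iterBracket (by omega) (by omega), ← sub_smul]
          have h4 : i + (d + 1) + 1 ≠ i := by omega
          have h5 : i + (d + 1) + 1 + 1 ≠ i := by omega
          simp [h4, h5]
        · simp [h1, h2, h3]

lemma serreE_symm (i j : ℕ) : serreE (-f) (-e) (-H) i j = -serreE e f H j i := by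
  rcases lt_trichotomy i j with h | rfl | h
  · simp [serreE, h, h.not_gt, h.ne']
  · simp [serreE]
  · simp [serreE, h, h.not_gt, h.ne']

/-- Above the diagonal e_k extends the bracket at one end or kills it. Below the diagonal the
involution `symm` turns e_k into a lowering element, so `lie_f_iterBracket` applies. -/
lemma lie_e_serreE [LieAlgebra ℂ L] (h : SerreData N e f H) {k i j : ℕ} (hk : k + 1 < N)
    (hi : i < N) (hj : j < N) : ⁅e k, serreE e f H i j⁆ =
      (if k + 1 = i then serreE e f H k j else 0) -
        (if j = k then serreE e f H i (k + 1) else 0) := by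
  have hdown : ∀ i d, serreE e f H (i + 1 + d) i = -iterBracket (-f) i d := fun i d => by
    rw [serreE, if_neg (by omega), if_neg (by omega)]
    congr 2
    omega
  have hup : ∀ i d, serreE e f H i (i + 1 + d) = iterBracket e i d := fun i d => by
    rw [serreE, if_pos (by omega)]
    congr 1
    omega
  have hdiag : ∀ i, serreE e f H i i = H i := fun i => by simp [serreE]
  rcases lt_trichotomy i j with hij | rfl | hij
  · obtain ⟨d, rfl⟩ := Nat.exists_eq_add_of_le hij
    rw [hup]
    rcases eq_or_ne (k + 1) i with rfl | h1
    · rw [h.lie_iterBracket_pred (by omega), if_pos rfl, if_neg (by omega), sub_zero, ← hup]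
      congr 1
      omega
    · rw [if_neg h1, zero_sub]
      rcases eq_or_ne (i + 1 + d) k with rfl | h2
      · rw [if_pos rfl, show i + 1 + d = i + d + 1 by omega, lie_iterBracket_last, ← hup]
        congr 2
        omega
      · rw [if_neg h2, neg_zero]
        by_cases h3 : i ≤ k ∧ k ≤ i + d
        · exact h.lie_iterBracket_interior (by omega) h3.1 h3.2
        · exact h.lie_iterBracket_far hk (by omega) (by omega)
  · rw [hdiag, ← lie_skew, h.He hi hk]
    have hk1 := hup k 0
    rcases eq_or_ne i k with rfl | h1
    · simpa [iterBracket] using hk1.symm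
    · rcases eq_or_ne i (k + 1) with rfl | h2
      · simpa [iterBracket] using hk1.symm
      · simp [h1, h2, Ne.symm h2]
  · obtain ⟨d, rfl⟩ := Nat.exists_eq_add_of_le hij
    rw [hdown]
    have he : ⁅e k, -iterBracket (-f) j d⁆ = ⁅(-e) k, iterBracket (-f) j d⁆ := by simp
    rw [he]
    rcases d with _ | d
    · have := h.symm.ef (k := j) (l := k) (by omega) hk
      rw [iterBracket, ← lie_skew, this]
      rcases eq_or_ne j k with rfl | h1
      · simp [hdiag]; abel
      · simp [h1, h1.symm]
    · rw [h.symm.lie_f_iterBracket hk (by omega)]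
      rcases eq_or_ne k j with rfl | h1
      · rw [if_pos rfl, if_neg (by omega), if_neg (by omega), if_pos rfl,
          show k + 1 + (d + 1) = k + 1 + 1 + d by omega, hdown]
        simp
      · rw [if_neg h1, if_neg (Ne.symm h1)]
        rcases eq_or_ne k (j + d + 1) with rfl | h2
        · rw [if_pos rfl, if_pos (by omega), show j + d + 1 = j + 1 + d by omega, hdown]
          simp
        · rw [if_neg h2, if_neg (by omega)]

lemma lie_f_serreE [LieAlgebra ℂ L] (h : SerreData N e f H) {k i j : ℕ} (hk : k + 1 < N)
    (hi : i < N) (hj : j < N) : ⁅f k, serreE e f H i j⁆ =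
      (if k = i then serreE e f H (k + 1) j else 0) -
        (if j = k + 1 then serreE e f H i k else 0) := by
  have := h.symm.lie_e_serreE hk hj hi
  simp only [serreE_symm, Pi.neg_apply, lie_neg, neg_lie, neg_neg] at this
  rw [this]
  by_cases h1 : k = i <;> by_cases h2 : j = k + 1 <;> simp [h1, h2, eq_comm] <;> grind

lemma lie_H_serreE (h : SerreData N e f H) {k i j : ℕ} (hk : k < N) (hi : i < N) (hj : j < N) :
    ⁅H k, serreE e f H i j⁆ =
      (if k = i then serreE e f H k j else 0) - (if j = k then serreE e f H i k else 0) := by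
  have key : ⁅H k, serreE e f H i j⁆ =
      ((if k = i then 1 else 0) - (if k = j then 1 else 0) : ℤ) • serreE e f H i j := by
    rcases lt_trichotomy i j with hij | rfl | hij
    · obtain ⟨d, rfl⟩ := Nat.exists_eq_add_of_le hij
      rw [serreE, if_pos hij, h.lie_H_iterBracket hk (by omega)]
      congr 4
      simp; omega
    · simp [serreE, h.HH hk hi]
    · obtain ⟨d, rfl⟩ := Nat.exists_eq_add_of_le hij
      rw [serreE, if_neg (by omega), if_neg (by omega)]
      have := h.symm.lie_H_iterBracket (k := k) (i := j) (d := j.succ + d - j - 1) hk (by omega)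
      simp only [Pi.neg_apply, neg_lie] at this
      rw [lie_neg, this, smul_neg, ← neg_smul, neg_sub, show j + (j.succ + d - j - 1) + 1 =
        j.succ + d by omega]
  rw [key, sub_smul]
  congr 1
  · rcases eq_or_ne k i with rfl | h1
    · simp
    · simp [h1]
  · rcases eq_or_ne k j with rfl | h1
    · simp
    · simp [h1, h1.symm]

end SerreData

/-! ### From the Serre relations to a homomorphism of the enveloping algebra -/

section

attribute [local instance 100] LieRing.ofAssociativeRing

/-- Elements that satisfy the Serre relations define a representation of `U(gl(N))`. -/
theorem SerreData.exists_algHom {A : Type*} [Ring A] [Algebra ℂ A] {N : ℕ} {e f H : ℕ → A}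
    (h : SerreData N e f H) :
    ∃ ρ : Ugl N →ₐ[ℂ] A, ∀ i j : Fin N, ρ (genE N i j) = serreE e f H i j := by
  let φ : gl N →ₗ[ℂ] A :=
    { toFun := fun M => ∑ a : Fin N × Fin N, M a.1 a.2 • serreE e f H a.1 a.2
      map_add' := fun x y => by
        simp only [Matrix.add_apply, add_smul, Finset.sum_add_distrib]
      map_smul' := fun c x => by
        simp only [Matrix.smul_apply, smul_eq_mul, mul_smul, Finset.smul_sum, RingHom.id_apply] }
  have hφ : ∀ i j, φ (Matrix.single i j 1) = serreE e f H i j := fun i j => by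
    change ∑ a : Fin N × Fin N, (Matrix.single i j 1 : gl N) a.1 a.2 • serreE e f H a.1 a.2 = _
    rw [Finset.sum_eq_single (i, j)]
    · simp
    · rintro ⟨k, l⟩ - hne
      rw [Matrix.single_apply_of_ne, zero_smul]
      rintro ⟨rfl, rfl⟩; exact hne rfl
    · simp
  have hlie : ∀ x y : gl N, φ (x * y - y * x) = ⁅φ x, φ y⁆ := by
    have hgen : ∀ x : gl N, (∀ i j, φ (x * Matrix.single i j 1 - Matrix.single i j 1 * x) =
        ⁅φ x, φ (Matrix.single i j 1)⁆) → ∀ y, φ (x * y - y * x) = ⁅φ x, φ y⁆ := by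
      intro x hx y
      conv_lhs => rw [Matrix.matrix_eq_sum_single y]
      conv_rhs => rw [Matrix.matrix_eq_sum_single y]
      simp only [Finset.mul_sum, Finset.sum_mul, ← Finset.sum_sub_distrib, map_sum, ringLie_sum]
      refine Finset.sum_congr rfl fun i _ => Finset.sum_congr rfl fun j _ => ?_
      have e1 : (Matrix.single i j (y i j) : gl N) = y i j • Matrix.single i j 1 := by
        simp [Matrix.smul_single]
      rw [e1, mul_smul_comm, smul_mul_assoc, ← smul_sub, map_smul, hx, map_smul]
      simp only [Ring.lie_def, mul_smul_comm, smul_mul_assoc, smul_sub]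
    have hsingle : ∀ k l i j : Fin N, φ (Matrix.single k l 1 * Matrix.single i j 1 -
        Matrix.single i j 1 * Matrix.single k l 1) =
        (if l = i then serreE e f H k j else 0) - (if j = k then serreE e f H i l else 0) := by
      intro k l i j
      rw [map_sub]
      congr 1
      · split_ifs with hh
        · subst hh; simp [hφ]
        · rw [Matrix.single_mul_single_of_ne _ _ _ _ hh, map_zero]
      · split_ifs with hh
        · subst hh; simp [hφ]
        · rw [Matrix.single_mul_single_of_ne _ _ _ _ hh, map_zero]
    intro x
    -- By the Jacobi identity the x whose bracket with every y is respected by φ form a Lie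
    -- subalgebra. So only brackets of simple generators with matrix units need checking, never
    -- those of two arbitrary root vectors.
    induction x using gl_induction with
    | h0 => intro y; simp [Ring.lie_def]
    | hadd x x' hx hx' =>
      intro y
      have e1 : (x + x') * y - y * (x + x') = (x * y - y * x) + (x' * y - y * x') := by
        noncomm_ring
      rw [e1, map_add, hx, hx', map_add]
      simp only [Ring.lie_def]; noncomm_ring
    | hsmul c x hx =>
      intro y
      rw [smul_mul_assoc, mul_smul_comm, ← smul_sub, map_smul, hx, map_smul]
      simp only [Ring.lie_def, mul_smul_comm, smul_mul_assoc, smul_sub]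
    | hlie x x' hx hx' =>
      intro y
      have e1 : (x * x' - x' * x) * y - y * (x * x' - x' * x) =
          (x * (x' * y - y * x') - (x' * y - y * x') * x) -
            (x' * (x * y - y * x) - (x * y - y * x) * x') := by noncomm_ring
      rw [e1, map_sub, hx, hx', hx, hx', hx]
      simp only [Ring.lie_def]; noncomm_ring
    | hd k =>
      refine hgen _ fun i j => ?_
      rw [hsingle, hφ, hφ, serreE.eq_1 _ _ _ k k, if_neg (lt_irrefl _), if_pos rfl,
        h.lie_H_serreE k.2 i.2 j.2]
      simp only [Fin.ext_iff]
    | hu k hk =>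
      refine hgen _ fun i j => ?_
      rw [hsingle, hφ, hφ, serreE.eq_1 _ _ _ k (k + 1), if_pos (Nat.lt_succ_self k)]
      have : k + 1 - k - 1 = 0 := by omega
      simp only [Fin.ext_iff, this, iterBracket]
      rw [h.lie_e_serreE hk i.2 j.2]
    | hl k hk =>
      refine hgen _ fun i j => ?_
      have e0 : serreE e f H (k + 1) k = f k := by
        rw [serreE, if_neg (by omega), if_neg (by omega), show k + 1 - k - 1 = 0 by omega]
        simp [iterBracket]
      rw [hsingle, hφ, hφ, e0]
      simp only [Fin.ext_iff]
      rw [h.lie_f_serreE hk i.2 j.2]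
  let Φ : gl N →ₗ⁅ℂ⁆ A := { φ with map_lie' := fun {x y} => hlie x y }
  refine ⟨UniversalEnvelopingAlgebra.lift ℂ Φ, fun i j => ?_⟩
  rw [genE, UniversalEnvelopingAlgebra.lift_ι_apply]
  exact hφ i j

/-- A homomorphism from `U(gl(N))` is determined by its values on the simple generators. -/
theorem Ugl_hom_ext {A : Type*} [Ring A] [Algebra ℂ A] {N : ℕ} {ρ ρ' : Ugl N →ₐ[ℂ] A}
    (hd : ∀ i, ρ (genE N i i) = ρ' (genE N i i))
    (hu : ∀ (i : ℕ) (hi : i + 1 < N), ρ (genE N ⟨i, by omega⟩ ⟨i + 1, hi⟩) =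
      ρ' (genE N ⟨i, by omega⟩ ⟨i + 1, hi⟩))
    (hl : ∀ (i : ℕ) (hi : i + 1 < N), ρ (genE N ⟨i + 1, hi⟩ ⟨i, by omega⟩) =
      ρ' (genE N ⟨i + 1, hi⟩ ⟨i, by omega⟩)) : ρ = ρ' := by
  refine UniversalEnvelopingAlgebra.hom_ext ℂ (LieHom.ext fun x => ?_)
  change ρ (UniversalEnvelopingAlgebra.ι ℂ x) = ρ' (UniversalEnvelopingAlgebra.ι ℂ x)
  induction x using gl_induction with
  | h0 => simp only [map_zero]
  | hadd x x' hx hx' => simp only [map_add, hx, hx']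
  | hsmul c x hx => simp only [map_smul, hx]
  | hlie x x' hx hx' =>
    have e : UniversalEnvelopingAlgebra.ι ℂ (x * x' - x' * x : gl N) =
        UniversalEnvelopingAlgebra.ι ℂ x * UniversalEnvelopingAlgebra.ι ℂ x' -
          UniversalEnvelopingAlgebra.ι ℂ x' * UniversalEnvelopingAlgebra.ι ℂ x :=
      (UniversalEnvelopingAlgebra.ι ℂ (L := gl N)).map_lie x x'
    rw [e]
    simp only [map_sub, map_mul, hx, hx']
  | hd i => exact hd i
  | hu i hi => exact hu i hi
  | hl i hi => exact hl i hi

/-! ### The Serre relations for the Gelfand–Zetlin operators -/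

namespace Shifts

variable {K : Type*} [Field K] [Algebra ℂ K] {N : ℕ} {x : ℕ → ℕ → K} {t : K}
  {τ τ' : ℕ → ℕ → K →ₐ[ℂ] K}

/-- The eigenvalues of the diagonal generators `E_{i+1,i+1}`. -/
def _root_.GZ.weight {K : Type*} [Field K] (x : ℕ → ℕ → K) (t : K) (i : ℕ) : K :=
  t⁻¹ * (∑ j ∈ Finset.range (i + 1), x (i + 1) j - ∑ j ∈ Finset.range i, x i j)

lemma map_sum_level (h : Shifts N x t τ) {n j : ℕ} (hn : n < N) (hj : j < n) (m : ℕ) :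
    τ n j (∑ k ∈ Finset.range m, x m k) =
      ∑ k ∈ Finset.range m, x m k - if m = n then t else 0 := by
  rw [map_sum]
  split_ifs with hm
  · subst hm
    rw [← Finset.add_sum_erase _ _ (Finset.mem_range.2 hj), h.self hn hj,
      ← Finset.add_sum_erase _ _ (Finset.mem_range.2 hj)]
    rw [Finset.sum_congr rfl fun k hk => h.ne_index m (Finset.ne_of_mem_erase hk).symm]
    ring
  · rw [sub_zero]
    exact Finset.sum_congr rfl fun k _ => h.ne_level _ _ (Ne.symm hm)

/-- A shift of level k + 1 changes only the sum of that level, by t. The normalising constant u is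
kept apart from t because the lowering operators have step -u. -/
lemma lie_weight_ladder (h : Shifts N x t τ) {u : K} (hu : ∀ n j, τ n j u = u) {i k m : ℕ}
    (hk : k + 1 < N) :
    ⁅Algebra.lmul ℂ K (weight x u i), ladder x t τ (k + 1) m⁆ =
      Algebra.lmul ℂ K (u⁻¹ * t * ((if i = k then 1 else 0) - (if i = k + 1 then 1 else 0))) *
        ladder x t τ (k + 1) m := by
  rw [ladder, ringLie_sum, Finset.mul_sum]
  refine Finset.sum_congr rfl fun j hj => ?_
  rw [Finset.mem_range] at hj
  ext g
  have hw : τ (k + 1) j (weight x u i) = weight x u i -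
      u⁻¹ * t * ((if i = k then 1 else 0) - (if i = k + 1 then 1 else 0)) := by
    rw [weight, map_mul, map_inv₀, hu, map_sub, h.map_sum_level hk hj, h.map_sum_level hk hj]
    simp only [Nat.add_right_cancel_iff]
    split_ifs <;> ring
  simp only [Ring.lie_def, LinearMap.sub_apply, Module.End.mul_apply, diffOp_apply,
    Algebra.coe_lmul_eq_mul, LinearMap.mul_apply', map_mul, hw]
  ring

/-- The Gelfand–Zetlin operators satisfy the Serre relations. -/
theorem serreData (h : Shifts N x t τ) (h' : Shifts N x (-t) τ')
    (hc : ∀ n j m k f, τ n j (τ' m k f) = τ' m k (τ n j f))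
    (hinv : ∀ n j f, τ n j (τ' n j f) = f) :
    SerreData N (fun k => ladder x t τ (k + 1) (k + 2)) (fun k => ladder x (-t) τ' (k + 1) k)
      (fun i => Algebra.lmul ℂ K (weight x t i)) := by
  have ht : ∀ n j, τ' n j t = t := fun n j => by simpa using h'.fix n j
  have ht' : ∀ n j, τ n j (-t) = -t := fun n j => by rw [map_neg, h.fix]
  refine ⟨?_, ?_, ?_, ?_, ?_, ?_, ?_, ?_, ?_, ?_⟩
  · intro i j _ _
    rw [Ring.lie_def, ← map_mul, ← map_mul, mul_comm, sub_self]
  · intro i k _ hk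
    rw [h.lie_weight_ladder h.fix hk, inv_mul_cancel₀ h.ne_zero]
    ext g
    simp only [Module.End.mul_apply, LinearMap.smul_apply]
    split_ifs <;> simp
  · intro i k _ hk
    rw [h'.lie_weight_ladder ht hk, mul_neg, inv_mul_cancel₀ h.ne_zero]
    ext g
    simp only [Module.End.mul_apply, LinearMap.smul_apply]
    split_ifs <;> simp
  · intro k l hk hl
    split_ifs with hkl
    · subst hkl
      rw [h.lie_ladder_self h' hc hinv hk (by omega) (by omega) (by omega) (by omega), ← map_sub]
      congr 1
      rw [weight, weight]
      ring
    · rcases eq_or_ne l (k + 1) with rfl | hl'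
      · exact h.lie_ladder_neighbour h' ht hc hk hl (by omega)
      · exact h.lie_ladder_eq_zero h' ht' ht hc (by omega) (by omega) (by omega)
  · intro k l hkl hl
    exact h.lie_ladder_eq_zero h h.fix h.fix h.comm (by omega) (by omega) (by omega)
  · intro k l hkl hl
    exact h'.lie_ladder_eq_zero h' h'.fix h'.fix h'.comm (by omega) (by omega) (by omega)
  · intro k hk
    exact h.serre_self_neighbour (by omega) hk (by omega) (by omega)
  · intro k hk
    exact h.serre_neighbour_self hk (by omega) (by omega) (by omega)
  · intro k hk
    exact h'.serre_neighbour_self (by omega) (by omega) (by omega) (by omega)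
  · intro k hk
    exact h'.serre_self_neighbour hk (by omega) (by omega) (by omega)

end Shifts

end

/-! ### Shifts of meromorphic functions -/

section

variable {ι : Type*} [Fintype ι] [DecidableEq ι]

/-- The operator `e^{c ∂_i}` as an endomorphism of the field of meromorphic functions. -/
def shiftHom (i : ι) (c : ℂ) : Mero ι →ₐ[ℂ] Mero ι :=
  Ideal.quotientMapₐ (meroNull ι) (shiftRep (Pi.single i c)) (shiftRep_null (Pi.single i c))

lemma shiftHom_mk (i : ι) (c : ℂ) (f : meroRep ι) :
    shiftHom i c (Mero.mk ι f) = Mero.mk ι (shiftRep (Pi.single i c) f) := rfl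

lemma shiftHom_comm (i j : ι) (c d : ℂ) (f : Mero ι) :
    shiftHom i c (shiftHom j d f) = shiftHom j d (shiftHom i c f) := by
  obtain ⟨f, rfl⟩ := Mero.mk_surjective f
  simp only [shiftHom_mk]
  congr 1
  refine Subtype.ext (funext fun y => ?_)
  change f.1 (y + Pi.single i c + Pi.single j d) = f.1 (y + Pi.single j d + Pi.single i c)
  rw [add_right_comm]

lemma shiftHom_neg (i : ι) (c : ℂ) (f : Mero ι) : shiftHom i (-c) (shiftHom i c f) = f := by
  obtain ⟨f, rfl⟩ := Mero.mk_surjective f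
  simp only [shiftHom_mk]
  congr 1
  refine Subtype.ext (funext fun y => ?_)
  change f.1 (y + Pi.single i (-c) + Pi.single i c) = f.1 y
  rw [add_assoc, ← Pi.single_add, neg_add_cancel, Pi.single_zero, add_zero]

lemma shiftHom_coord_self (i : ι) (c : ℂ) :
    shiftHom i c (coord i) = coord i + algebraMap ℂ (Mero ι) c := by
  rw [← (Mero.mk ι).commutes, coord, shiftHom_mk, ← map_add]
  congr 1
  refine Subtype.ext (funext fun y => ?_)
  change (y + Pi.single i c : ι → ℂ) i = y i + c
  simp

lemma shiftHom_coord_of_ne {i j : ι} (h : i ≠ j) (c : ℂ) : shiftHom i c (coord j) = coord j := by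
  rw [coord, shiftHom_mk]
  congr 1
  refine Subtype.ext (funext fun y => ?_)
  change (y + Pi.single i c : ι → ℂ) j = y j
  simp [h.symm]

end

/-! ### The variables γ with natural number indices, and the Gelfand–Zetlin representation -/

section

variable {N : ℕ}

/-- The functions `γ_{nj}`, indexed by natural numbers. -/
def gamNat (label : Fin N → ℂ) (n j : ℕ) : GZSpace N :=
  if h : n ≤ N ∧ j < n then gam label h.1 ⟨j, h.2⟩ else 0

/-- The shifts of `γ_{nj}`, indexed by natural numbers. -/
def gamShiftNat (N : ℕ) (c : ℂ) (n j : ℕ) : GZSpace N →ₐ[ℂ] GZSpace N :=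
  if h : n < N ∧ j < n then shiftHom (⟨⟨n, h.1⟩, ⟨j, h.2⟩⟩ : Vars N) c else AlgHom.id ℂ _

lemma gam_eq (label : Fin N → ℂ) {n : ℕ} (hn : n ≤ N) (j : Fin n) :
    gam label hn j = gamNat label n j := by
  rw [gamNat, dif_pos ⟨hn, j.2⟩]

lemma gamShift_eq {n : ℕ} (hn : n < N) (j : Fin n) (c : ℂ) :
    gamShift hn j c = (gamShiftNat N c n j).toLinearMap := by
  rw [gamShiftNat, dif_pos ⟨hn, j.2⟩]
  rfl

lemma gamShiftNat_gamNat_of_ne (label : Fin N → ℂ) (c : ℂ) {n j m k : ℕ} (h : n ≠ m ∨ j ≠ k) :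
    gamShiftNat N c n j (gamNat label m k) = gamNat label m k := by
  rw [gamShiftNat]
  split_ifs with h1
  · rw [gamNat]
    split_ifs with h2
    · rw [gam]
      split_ifs with h3
      · refine shiftHom_coord_of_ne (fun e => ?_) c
        simp only [Sigma.mk.injEq, Fin.mk.injEq] at e
        obtain ⟨rfl, e⟩ := e
        simp only [heq_eq_eq, Fin.mk.injEq] at e
        exact h.elim (fun h => h rfl) (fun h => h e)
      · exact AlgHom.commutes _ _
    · exact map_zero _
  · rfl

/-- The minus sign is due to `Shifts` recording the amount subtracted, whereas e^{c∂} adds c. Level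
N consists of constants, which all shifts fix. -/
lemma gamNat_shifts (label : Fin N → ℂ) {c : ℂ} (hc : c ≠ 0) :
    Shifts N (gamNat label) (algebraMap ℂ (GZSpace N) (-c)) (gamShiftNat N c) where
  self {n j} hn hj := by
    rw [gamShiftNat, dif_pos ⟨hn, hj⟩, gamNat, dif_pos ⟨hn.le, hj⟩, gam, dif_pos hn,
      shiftHom_coord_self, map_neg, sub_neg_eq_add]
  ne_level j k h := gamShiftNat_gamNat_of_ne label c (Or.inl h)
  ne_index n h := gamShiftNat_gamNat_of_ne label c (Or.inr h)
  comm n j m k f := by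
    simp only [gamShiftNat]
    split_ifs
    · exact shiftHom_comm _ _ _ _ _
    all_goals rfl
  fix n j := AlgHom.commutes _ _
  ne_zero := by simpa using hc

lemma gamShiftNat_comm (c d : ℂ) (n j m k : ℕ) (f : GZSpace N) :
    gamShiftNat N c n j (gamShiftNat N d m k f) = gamShiftNat N d m k (gamShiftNat N c n j f) := by
  simp only [gamShiftNat]
  split_ifs
  · exact shiftHom_comm _ _ _ _ _
  all_goals rfl

lemma gamShiftNat_neg (c : ℂ) (n j : ℕ) (f : GZSpace N) :
    gamShiftNat N (-c) n j (gamShiftNat N c n j f) = f := by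
  simp only [gamShiftNat]
  split_ifs
  · exact shiftHom_neg _ _ _
  · rfl

lemma prod_erase_fin {M : Type*} [CommMonoid M] {n : ℕ} (j : Fin n) (g : ℕ → M) :
    ∏ s ∈ Finset.univ.erase j, g (s : Fin n) = ∏ s ∈ (Finset.range n).erase j, g s := by
  refine Finset.prod_bij (fun s _ => (s : ℕ)) ?_ ?_ ?_ ?_
  · intro s hs
    simp only [Finset.mem_erase, Finset.mem_univ, and_true, Finset.mem_range] at hs ⊢
    exact ⟨fun e => hs (Fin.ext e), s.2⟩
  · intro a _ b _ e
    exact Fin.ext e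
  · intro b hb
    simp only [Finset.mem_erase, Finset.mem_range] at hb
    exact ⟨⟨b, hb.2⟩, by simpa [Fin.ext_iff] using hb.1, rfl⟩
  · intro _ _
    rfl

lemma upFactor_eq (ħ : ℂ) (label : Fin N → ℂ) {i : ℕ} (hi : i + 1 < N) (j : Fin (i + 1)) :
    upFactor ħ label hi j = ∏ r ∈ Finset.range (i + 2),
      (gamNat label (i + 1) j - gamNat label (i + 2) r - ih N ħ / 2) := by
  simp only [upFactor, gam_eq]
  exact Fin.prod_univ_eq_prod_range
    (fun r => gamNat label (i + 1) j - gamNat label (i + 2) r - ih N ħ / 2) (i + 2)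

lemma downFactor_eq (ħ : ℂ) (label : Fin N → ℂ) {i : ℕ} (hi : i + 1 < N) (j : Fin (i + 1)) :
    downFactor ħ label hi j = ∏ r ∈ Finset.range i,
      (gamNat label (i + 1) j - gamNat label i r + ih N ħ / 2) := by
  simp only [downFactor, gam_eq]
  exact Fin.prod_univ_eq_prod_range
    (fun r => gamNat label (i + 1) j - gamNat label i r + ih N ħ / 2) i

/-- The operators of the Gelfand–Zetlin representation in terms of natural number indices. -/
lemma isGZRep_iff (ħ : ℂ) (label : Fin N → ℂ) (ρ : Ugl N →ₐ[ℂ] Module.End ℂ (GZSpace N)) :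
    IsGZRep N ħ label ρ ↔
      (∀ (i : ℕ) (hi : i < N), ρ (genE N ⟨i, hi⟩ ⟨i, hi⟩) =
        Algebra.lmul ℂ _ (weight (gamNat label) (ih N ħ) i)) ∧
      (∀ (i : ℕ) (hi : i + 1 < N), ρ (genE N ⟨i, by omega⟩ ⟨i + 1, hi⟩) =
        ladder (gamNat label) (ih N ħ) (gamShiftNat N (-(Complex.I * ħ))) (i + 1) (i + 2)) ∧
      (∀ (i : ℕ) (hi : i + 1 < N), ρ (genE N ⟨i + 1, hi⟩ ⟨i, by omega⟩) =
        ladder (gamNat label) (-ih N ħ) (gamShiftNat N (Complex.I * ħ)) (i + 1) i) := by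
  have e1 : ∀ (i : ℕ) (hi : i + 1 ≤ N), mulOp ((ih N ħ)⁻¹ *
      (∑ j : Fin (i + 1), gam label hi j - ∑ j : Fin i, gam label (n := i) (by omega) j)) =
      Algebra.lmul ℂ _ (weight (gamNat label) (ih N ħ) i) := fun i hi => by
    simp only [gam_eq, weight]
    rw [Fin.sum_univ_eq_sum_range (fun j => gamNat label (i + 1) j),
      Fin.sum_univ_eq_sum_range (fun j => gamNat label i j)]
  have e2 : ∀ (i : ℕ) (hi : i + 1 < N), ∑ j : Fin (i + 1),
      mulOp (-(ih N ħ)⁻¹ * (upFactor ħ label hi j /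
        ∏ s ∈ Finset.univ.erase j, (gam label hi.le j - gam label hi.le s))) *
      gamShift hi j (-(Complex.I * ħ)) =
      ladder (gamNat label) (ih N ħ) (gamShiftNat N (-(Complex.I * ħ))) (i + 1) (i + 2) := by
    intro i hi
    rw [ladder, ← Fin.sum_univ_eq_sum_range]
    refine Finset.sum_congr rfl fun j _ => ?_
    simp only [gamShift_eq, gam_eq, upFactor_eq, diffOp, lagCoeff, ladderNum]
    rw [prod_erase_fin j (fun s => gamNat label (i + 1) j - gamNat label (i + 1) s), mul_div_assoc]
  -- Replacing t by -iħ turns the prefactor -1/t into 1/(iħ) and the offset -t/2 into iħ/2.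
  have e3 : ∀ (i : ℕ) (hi : i + 1 < N), ∑ j : Fin (i + 1),
      mulOp ((ih N ħ)⁻¹ * (downFactor ħ label hi j /
        ∏ s ∈ Finset.univ.erase j, (gam label hi.le j - gam label hi.le s))) *
      gamShift hi j (Complex.I * ħ) =
      ladder (gamNat label) (-ih N ħ) (gamShiftNat N (Complex.I * ħ)) (i + 1) i := by
    intro i hi
    rw [ladder, ← Fin.sum_univ_eq_sum_range]
    refine Finset.sum_congr rfl fun j _ => ?_
    simp only [gamShift_eq, gam_eq, downFactor_eq, diffOp, lagCoeff, ladderNum, inv_neg, neg_neg,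
      neg_div, sub_neg_eq_add]
    rw [prod_erase_fin j (fun s => gamNat label (i + 1) j - gamNat label (i + 1) s), mul_div_assoc]
  constructor
  · rintro ⟨h1, h2, h3⟩
    exact ⟨fun i hi => (h1 i hi).trans (e1 i hi), fun i hi => (h2 i hi).trans (e2 i hi),
      fun i hi => (h3 i hi).trans (e3 i hi)⟩
  · rintro ⟨h1, h2, h3⟩
    exact ⟨fun i hi => (h1 i hi).trans (e1 i hi).symm, fun i hi => (h2 i hi).trans (e2 i hi).symm,
      fun i hi => (h3 i hi).trans (e3 i hi).symm⟩

/-- The Gelfand–Zetlin representation exists and is unique. -/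
theorem existsUnique_isGZRep (N : ℕ) {ħ : ℂ} (hħ : ħ ≠ 0) (label : Fin N → ℂ) :
    ∃! ρ : Ugl N →ₐ[ℂ] Module.End ℂ (GZSpace N), IsGZRep N ħ label ρ := by
  let _ : LieRing (Module.End ℂ (GZSpace N)) := LieRing.ofAssociativeRing
  have hc : Complex.I * ħ ≠ 0 := mul_ne_zero Complex.I_ne_zero hħ
  have h1 := gamNat_shifts label (neg_ne_zero.2 hc)
  have h2 := gamNat_shifts label hc
  rw [neg_neg] at h1
  rw [map_neg] at h2
  have hS := h1.serreData h2 (fun n j m k f => gamShiftNat_comm _ _ _ _ _ _ _)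
    (fun n j f => gamShiftNat_neg _ _ _ _)
  obtain ⟨ρ, hρ⟩ := hS.exists_algHom
  have hGZ : IsGZRep N ħ label ρ := by
    refine (isGZRep_iff ħ label ρ).2 ⟨fun i hi => ?_, fun i hi => ?_, fun i hi => ?_⟩
    · rw [hρ, serreE, if_neg (lt_irrefl _), if_pos rfl]
      rfl
    · rw [hρ, serreE, if_pos (Nat.lt_succ_self i), show i + 1 - i - 1 = 0 by omega]
      rfl
    · rw [hρ, serreE, if_neg (by simp), if_neg (by simp), show i + 1 - i - 1 = 0 by omega]
      exact neg_neg _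
  exact ⟨ρ, hGZ, fun ρ' hρ' => Ugl_hom_ext
    (fun i => (hρ'.diag i i.2).trans (hGZ.diag i i.2).symm)
    (fun i hi => (hρ'.raise i hi).trans (hGZ.raise i hi).symm)
    (fun i hi => (hρ'.lower i hi).trans (hGZ.lower i hi).symm)⟩

end

/-! ### Column determinants -/

/-- The column determinant of a matrix with entries in a ring. -/
def ncdet {A : Type*} [Ring A] {n : ℕ} (M : Fin n → Fin n → A) : A :=
  ∑ p : Equiv.Perm (Fin n), ((Equiv.Perm.sign p : ℤˣ) : ℤ) • (List.ofFn fun k => M (p k) k).prod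

section ncdet

variable {A : Type*} [Ring A] {n : ℕ}

lemma ncdet_zero (M : Fin 0 → Fin 0 → A) : ncdet M = 1 := by
  simp [ncdet]

lemma map_ncdet {B : Type*} [Ring B] (f : A →+* B) (M : Fin n → Fin n → A) :
    f (ncdet M) = ncdet fun r k => f (M r k) := by
  simp only [ncdet, map_sum, map_zsmul, map_list_prod, List.map_ofFn]
  rfl

/-- Expansion of the column determinant along the last column. -/
lemma ncdet_succ (M : Fin (n + 1) → Fin (n + 1) → A) :
    ncdet M = ncdet (fun r k => M r.castSucc k.castSucc) * M (Fin.last n) (Fin.last n) -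
      ∑ r, ncdet (fun s k => M (if s = r then Fin.last n else s.castSucc) k.castSucc) *
        M r.castSucc (Fin.last n) := by
  -- A permutation of n + 1 points is a permutation of the first n, followed either by nothing
  -- (`none`) or by a transposition of the last point with r (`some r`), which accounts for the sign
  -- of the cofactors.
  let e : Option (Fin n) × Equiv.Perm (Fin n) ≃ Equiv.Perm (Fin (n + 1)) :=
    Equiv.Perm.decomposeOption.symm.trans (Equiv.permCongr finSuccEquivLast.symm)
  have he : ∀ o q k, e (o, q) k =
      finSuccEquivLast.symm (Equiv.Perm.decomposeOption.symm (o, q) (finSuccEquivLast k)) :=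
    fun o q k => rfl
  have hs : ∀ o q, Equiv.Perm.sign (e (o, q)) =
      Equiv.Perm.sign (Equiv.Perm.decomposeOption.symm (o, q)) := fun o q => by
    simp only [e, Equiv.trans_apply, Equiv.Perm.sign_permCongr]
  rw [ncdet, ← Equiv.sum_comp e, Fintype.sum_prod_type, Fintype.sum_option, sub_eq_add_neg]
  congr 1
  · rw [ncdet, Finset.sum_mul]
    refine Finset.sum_congr rfl fun q _ => ?_
    rw [List.ofFn_succ', List.concat_eq_append, List.prod_append, List.prod_singleton, hs,
      smul_mul_assoc]
    simp [he]
  · rw [← Finset.sum_neg_distrib]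
    refine Finset.sum_congr rfl fun r _ => ?_
    rw [ncdet, Finset.sum_mul, ← Finset.sum_neg_distrib]
    refine Finset.sum_congr rfl fun q _ => ?_
    have h1 : ∀ k : Fin n, e (some r, q) k.castSucc =
        if q k = r then Fin.last n else (q k).castSucc := fun k => by
      rw [he]
      simp only [finSuccEquivLast_castSucc, Equiv.Perm.decomposeOption_symm_apply,
        Equiv.Perm.coe_mul, Function.comp_apply, Equiv.optionCongr_apply, Option.map_some]
      split_ifs with h
      · rw [h, Equiv.swap_apply_right, finSuccEquivLast_symm_none]
      · rw [Equiv.swap_apply_of_ne_of_ne (by simp) (by simpa using h), finSuccEquivLast_symm_some]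
    have h2 : e (some r, q) (Fin.last n) = r.castSucc := by
      rw [he]
      simp
    rw [List.ofFn_succ', List.concat_eq_append, List.prod_append, List.prod_singleton, hs, h2]
    simp [h1, mul_assoc]

/-- The Leibniz rule for an inner derivation that kills all factors but one. -/
lemma ringLie_prod_ofFn (z : A) (g : Fin n → A) (k₀ : Fin n) (h : ∀ k, k ≠ k₀ → ⁅z, g k⁆ = 0) :
    ⁅z, (List.ofFn g).prod⁆ = (List.ofFn fun k => if k = k₀ then ⁅z, g k⁆ else g k).prod := by
  induction n with
  | zero => exact k₀.elim0
  | succ n ih =>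
    have hm : ∀ a b : A, ⁅z, a * b⁆ = ⁅z, a⁆ * b + a * ⁅z, b⁆ := fun a b => by
      simp only [Ring.lie_def]; noncomm_ring
    rw [List.ofFn_succ, List.ofFn_succ, List.prod_cons, List.prod_cons, hm]
    induction k₀ using Fin.cases with
    | zero =>
      have h0 : ⁅z, (List.ofFn fun i => g (Fin.succ i)).prod⁆ = 0 := by
        rw [Ring.lie_def, sub_eq_zero]
        refine Commute.list_prod_right _ _ fun a ha => ?_
        obtain ⟨k, rfl⟩ := (List.mem_ofFn' _ _).1 ha
        exact sub_eq_zero.1 (h _ (Fin.succ_ne_zero k))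
      simp [h0, Fin.succ_ne_zero]
    | succ k₀ =>
      rw [h 0 (Fin.succ_ne_zero k₀).symm, ih (fun i => g i.succ) k₀ fun k hk =>
        h _ (fun e => hk (Fin.succ_injective _ e))]
      simp [(Fin.succ_ne_zero k₀).symm]

/-- The action of a derivation that changes only one column of the matrix. -/
lemma ringLie_ncdet_of_col (z : A) (M : Fin n → Fin n → A) (k₀ : Fin n)
    (h : ∀ r k, k ≠ k₀ → ⁅z, M r k⁆ = 0) :
    ⁅z, ncdet M⁆ = ncdet fun r k => if k = k₀ then ⁅z, M r k⁆ else M r k := by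
  rw [ncdet, ringLie_sum, ncdet]
  refine Finset.sum_congr rfl fun p _ => ?_
  rw [← ringLie_prod_ofFn z (fun k => M (p k) k) k₀ fun k hk => h _ _ hk]
  simp only [Ring.lie_def, mul_smul_comm, smul_mul_assoc, smul_sub]

/-- The action of a derivation that changes only one row of the matrix. -/
lemma ringLie_ncdet_of_row (z : A) (M : Fin n → Fin n → A) (r₀ : Fin n)
    (h : ∀ r k, r ≠ r₀ → ⁅z, M r k⁆ = 0) :
    ⁅z, ncdet M⁆ = ncdet fun r k => if r = r₀ then ⁅z, M r k⁆ else M r k := by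
  rw [ncdet, ringLie_sum, ncdet]
  refine Finset.sum_congr rfl fun p _ => ?_
  have := ringLie_prod_ofFn z (fun k => M (p k) k) (p.symm r₀) fun k hk =>
    h _ _ fun e => hk (by rw [← e, Equiv.symm_apply_apply])
  simp only [Equiv.eq_symm_apply] at this
  rw [← this]
  simp only [Ring.lie_def, mul_smul_comm, smul_mul_assoc, smul_sub]

end ncdet

/-! ### Left substitution in polynomials with operator coefficients -/

section leftEval

open Polynomial

variable {A : Type*} [Ring A] [Algebra ℂ A]

/-- Left substitution `∑ z_k X^k ↦ ∑ u^k z_k`. -/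
def leftEval (u : A) : A[X] →ₗ[ℂ] A :=
  Polynomial.lsum fun k => LinearMap.mulLeft ℂ (u ^ k)

lemma leftEval_monomial (u z : A) (k : ℕ) : leftEval u (monomial k z) = u ^ k * z := by
  simp [leftEval]

lemma leftEval_eq_sum_range (u : A) (P : A[X]) {n : ℕ} (h : ∀ k, n ≤ k → P.coeff k = 0) :
    leftEval u P = ∑ k ∈ Finset.range n, u ^ k * P.coeff k := by
  have hP : P = ∑ k ∈ Finset.range n, monomial k (P.coeff k) := by
    ext k
    simp only [finsetSum_coeff, coeff_monomial, Finset.sum_ite_eq', Finset.mem_range]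
    split_ifs with hk
    · rfl
    · exact h k (not_lt.1 hk)
  conv_lhs => rw [hP, map_sum]
  simp only [leftEval_monomial]

/-- Left substitution is not multiplicative. An operator can be moved inside only at the cost of
conjugating the point, for example a shift that carries u to u'. -/
lemma mul_leftEval {u u' z : A} (h : z * u = u' * z) (P : A[X]) :
    z * leftEval u P = leftEval u' (C z * P) := by
  induction P using Polynomial.induction_on' with
  | add p q hp hq => rw [map_add, mul_add, mul_add, map_add, hp, hq]
  | monomial k a =>
    rw [C_mul_monomial, leftEval_monomial, leftEval_monomial, ← mul_assoc, ← mul_assoc]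
    congr 1
    have : SemiconjBy z u u' := h
    exact this.pow_right k

lemma leftEval_mul_C (u z : A) (P : A[X]) : leftEval u (P * C z) = leftEval u P * z := by
  induction P using Polynomial.induction_on' with
  | add p q hp hq => rw [map_add, add_mul, add_mul, map_add, hp, hq]
  | monomial k a => rw [monomial_mul_C, leftEval_monomial, leftEval_monomial, mul_assoc]

lemma leftEval_X_mul (u : A) (P : A[X]) : leftEval u (X * P) = u * leftEval u P := by
  induction P using Polynomial.induction_on' with
  | add p q hp hq => rw [map_add, mul_add, mul_add, map_add, hp, hq]
  | monomial k a => rw [X_mul_monomial, leftEval_monomial, leftEval_monomial, pow_succ', mul_assoc]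

/-- Multiplicativity holds when the left factor has commuting coefficients in K. In particular the
product vanishes under substitution of a root of q. -/
lemma leftEval_map_mul {K : Type*} [Field K] (m : K →+* A) (μ : K) (q : K[X]) (P : A[X]) :
    leftEval (m μ) (q.map m * P) = m (q.eval μ) * leftEval (m μ) P := by
  induction q using Polynomial.induction_on' with
  | add p q hp hq => simp only [Polynomial.map_add, add_mul, map_add, eval_add, hp, hq]
  | monomial k a =>
    rw [map_monomial, eval_monomial]
    induction k with
    | zero =>
      rw [pow_zero, mul_one, monomial_zero_left,
        ← mul_leftEval (u := m μ) (by rw [← map_mul, ← map_mul, mul_comm])]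
    | succ k ih =>
      rw [← X_mul_monomial, mul_assoc, leftEval_X_mul, ih, ← mul_assoc, ← map_mul]
      congr 2
      ring

lemma leftEval_map {K : Type*} [Field K] (m : K →+* A) (μ : K) (q : K[X]) :
    leftEval (m μ) (q.map m) = m (q.eval μ) := by
  have h1 : leftEval (m μ) (1 : A[X]) = 1 := by
    rw [← C_1, ← monomial_zero_left, leftEval_monomial, pow_zero, mul_one]
  have := leftEval_map_mul m μ q 1
  rwa [mul_one, h1, mul_one] at this

/-- A polynomial of degree less than `n` with operator coefficients vanishes if left substitution
of `n` different functions gives zero. -/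
lemma eq_zero_of_leftEval_eq_zero {K : Type*} [Field K] [Algebra ℂ K] {n : ℕ} (μ : ℕ → K)
    (hμ : ∀ i < n, ∀ j < n, μ i = μ j → i = j) (P : (Module.End ℂ K)[X])
    (hP : ∀ k, n ≤ k → P.coeff k = 0)
    (h : ∀ k < n, leftEval (Algebra.lmul ℂ K (μ k)) P = 0) : P = 0 := by
  classical
  -- Applying all coefficients to a fixed f gives an ordinary polynomial over K of degree less than
  -- n. Left substitution of multiplication operators becomes evaluation, so it has n roots.
  have key : ∀ f, ∑ k ∈ Finset.range n, monomial k (P.coeff k f) = (0 : K[X]) := fun f => by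
    refine Polynomial.eq_zero_of_degree_lt_of_eval_finset_eq_zero
      ((Finset.range n).image μ) ?_ ?_
    · rw [Finset.card_image_of_injOn fun i hi j hj e =>
        hμ i (Finset.mem_range.1 hi) j (Finset.mem_range.1 hj) e, Finset.card_range]
      refine (Polynomial.degree_lt_iff_coeff_zero _ _).2 fun k hk => ?_
      simp only [finsetSum_coeff, coeff_monomial, Finset.sum_ite_eq', Finset.mem_range,
        not_lt.2 hk, if_false]
    · intro y hy
      obtain ⟨k, hk, rfl⟩ := Finset.mem_image.1 hy
      have h1 := h k (Finset.mem_range.1 hk)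
      rw [leftEval_eq_sum_range _ _ hP] at h1
      have h2 := LinearMap.congr_fun h1 f
      simp only [eval_finsetSum, eval_monomial]
      rw [← LinearMap.zero_apply (σ₁₂ := RingHom.id ℂ) (M := K) (M₂ := K) f, ← h2,
        LinearMap.sum_apply]
      refine Finset.sum_congr rfl fun i _ => ?_
      rw [← map_pow, Module.End.mul_apply]
      simp [mul_comm]
  ext k f
  rcases lt_or_ge k n with hk | hk
  · have := congrArg (fun q => q.coeff k) (key f)
    simpa [finsetSum_coeff, coeff_monomial, hk] using this
  · simp [hP k hk]

end leftEval

/-! ### Quantum minors of `λ - iħ E` -/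

open Polynomial

section minors

variable {A : Type*} [Ring A] [Algebra ℂ A] {N : ℕ}

/-- The entries of the matrix `(X - u) I - h E`. -/
def lMat (h : ℂ) (E : Fin N → Fin N → A) (u : ℂ) (j k : Fin N) : A[X] :=
  (if j = k then X - C (algebraMap ℂ A u) else 0) - C (h • E j k)

/-- The shift `h ρ_{k+1}` of the argument in the column `k` of a quantum determinant. -/
def qshift (h : ℂ) (n k : ℕ) : ℂ := h * (((n : ℂ) - 2 * ((k : ℕ) + 1 : ℂ) + 1) / 2)

/-- The quantum minors of `(X - a) I - h E`. -/
def qminor (h : ℂ) (E : Fin N → Fin N → A) {n : ℕ} (a : ℂ) (row col : Fin n → Fin N) : A[X] :=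
  ncdet fun r k => lMat h E (a + qshift h n k) (row r) (col k)

lemma lMat_of_ne (h : ℂ) (E : Fin N → Fin N → A) (u : ℂ) {j k : Fin N} (hjk : j ≠ k) :
    lMat h E u j k = C (-(h • E j k)) := by
  simp [lMat, hjk]

lemma skipIdx_eq {i : ℕ} (hi : i + 1 < N) (k : Fin (i + 1)) :
    skipIdx hi k = if k = Fin.last i then ⟨i + 1, hi⟩ else firstIdx hi.le k := by
  induction k using Fin.lastCases with
  | last => simp [skipIdx]
  | cast k =>
    rw [if_neg (Fin.castSucc_ne_last k)]
    simp [skipIdx, firstIdx, Fin.ext_iff]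

variable {h : ℂ} {E : Fin N → Fin N → A}

/-- The commutation relations of `gl(N)`. -/
def IsGlRep (E : Fin N → Fin N → A) : Prop :=
  ∀ i j k l, ⁅E i j, E k l⁆ = (if j = k then E i l else 0) - (if l = i then E k j else 0)

/-- The scalar part (X - u) I of the matrix is central, but it reappears on the right: the two
Kronecker terms carry the same multiple of X - u when b = j and k = a, and cancel. -/
lemma lie_lMat (hE : IsGlRep E) (u : ℂ) (a b j k : Fin N) :
    ⁅C (E a b), lMat h E u j k⁆ =
      (if b = j then lMat h E u a k else 0) - (if k = a then lMat h E u j b else 0) := by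
  have e1 : ⁅C (E a b), lMat h E u j k⁆ = -C (h • ⁅E a b, E j k⁆) := by
    have hc : C (E a b) * (X - C (algebraMap ℂ A u)) = (X - C (algebraMap ℂ A u)) * C (E a b) := by
      rw [mul_sub, sub_mul, X_mul_C, ← C_mul, ← C_mul, (Algebra.commutes u (E a b))]
    rw [lMat, Ring.lie_def, Ring.lie_def, smul_sub, ← mul_smul_comm, ← smul_mul_assoc, C_sub, C_mul,
      C_mul]
    split_ifs
    · rw [mul_sub, sub_mul, hc]; abel
    · noncomm_ring
  rw [e1, hE]
  simp only [lMat]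
  by_cases h1 : b = j <;> by_cases h2 : k = a
  · subst h1 h2; simp [smul_sub]
  · subst h1; simp [h2, Ne.symm h2]
  · subst h2; simp [h1, Ne.symm h1]
  · simp [h1, h2]

/-- The bracket acts as a derivation that affects row r alone; there is no column term because n is
not a column of the minor. This identifies the cofactors in the last-column expansion as brackets
with the smaller minor. -/
lemma lie_qminor_lower (hE : IsGlRep E) {n : ℕ} (hn : n < N) (r : Fin n) (a : ℂ) :
    ⁅C (E ⟨n, hn⟩ (firstIdx hn.le r)), qminor h E a (firstIdx hn.le) (firstIdx hn.le)⁆ =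
      ncdet fun s k => lMat h E (a + qshift h n k)
        (if s = r then ⟨n, hn⟩ else firstIdx hn.le s) (firstIdx hn.le k) := by
  have hk : ∀ k : Fin n, firstIdx hn.le k ≠ ⟨n, hn⟩ := fun k => by
    simp [firstIdx, Fin.ext_iff, k.2.ne]
  have hr : ∀ s : Fin n, (firstIdx hn.le r = firstIdx hn.le s) = (s = r) := fun s => by
    simp [firstIdx, Fin.ext_iff, eq_comm]
  rw [qminor, ringLie_ncdet_of_row _ _ r]
  · congr 1
    funext s k
    rw [lie_lMat hE, if_neg (hk k), sub_zero]
    simp only [hr]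
    split_ifs <;> rfl
  · intro s k hs
    rw [lie_lMat hE, if_neg (hk k)]
    simp only [hr, hs, if_false, sub_zero]

lemma qminor_skip_first (hE : IsGlRep E) {i : ℕ} (hi : i + 1 < N) (a : ℂ) :
    qminor h E a (skipIdx hi) (firstIdx hi.le) =
      ⁅C (E ⟨i + 1, hi⟩ ⟨i, by omega⟩), qminor h E a (firstIdx hi.le) (firstIdx hi.le)⁆ := by
  have := lie_qminor_lower (h := h) hE hi (Fin.last i) a
  rw [show firstIdx hi.le (Fin.last i) = ⟨i, by omega⟩ from rfl] at this
  rw [this, qminor]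
  simp only [skipIdx_eq]

/-- Dual to the row argument: since i + 1 is not a row of the minor, the bracket affects only the
last column. -/
lemma qminor_first_skip (hE : IsGlRep E) {i : ℕ} (hi : i + 1 < N) (a : ℂ) :
    qminor h E a (firstIdx hi.le) (skipIdx hi) =
      ⁅qminor h E a (firstIdx hi.le) (firstIdx hi.le), C (E ⟨i, by omega⟩ ⟨i + 1, hi⟩)⁆ := by
  have hr : ∀ s : Fin (i + 1), (⟨i + 1, hi⟩ : Fin N) ≠ firstIdx hi.le s := fun s => by
    simp [firstIdx, Fin.ext_iff, s.2.ne']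
  have hk : ∀ k : Fin (i + 1), (firstIdx hi.le k = (⟨i, by omega⟩ : Fin N)) = (k = Fin.last i) :=
    fun k => by simp [firstIdx, Fin.ext_iff]
  have e : ∀ y z : A[X], ⁅y, z⁆ = ⁅-z, y⁆ := fun y z => by simp only [Ring.lie_def]; noncomm_ring
  have e' : ∀ y z : A[X], ⁅-y, z⁆ = -⁅y, z⁆ := fun y z => by
    simp only [Ring.lie_def]; noncomm_ring
  rw [e, qminor, qminor, ringLie_ncdet_of_col _ _ (Fin.last i)]
  · congr 1
    funext s k
    rw [e', lie_lMat hE, if_neg (hr s), zero_sub, neg_neg, skipIdx_eq]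
    simp only [hk]
    split_ifs <;> rfl
  · intro s k hs
    rw [e', lie_lMat hE, if_neg (hr s)]
    simp only [hk, hs, if_false, sub_zero, neg_zero]

/-- Passing from n + 1 to n lowers every ρ_k by 1/2. This is why the base point a must stay general
in the induction on the size of the minor. -/
lemma qshift_succ_castSucc (h : ℂ) (n k : ℕ) (a : ℂ) :
    a + qshift h (n + 1) k = a + h / 2 + qshift h n k := by
  simp only [qshift, Nat.cast_add, Nat.cast_one]
  ring

lemma qminor_first_succ (hE : IsGlRep E) {n : ℕ} (hn : n < N) (a : ℂ) :
    qminor h E a (firstIdx hn) (firstIdx hn) =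
      qminor h E (a + h / 2) (firstIdx hn.le) (firstIdx hn.le) *
          lMat h E (a + qshift h (n + 1) n) ⟨n, hn⟩ ⟨n, hn⟩ -
        ∑ r : Fin n, ⁅C (E ⟨n, hn⟩ (firstIdx hn.le r)),
            qminor h E (a + h / 2) (firstIdx hn.le) (firstIdx hn.le)⁆ *
          C (-(h • E (firstIdx hn.le r) ⟨n, hn⟩)) := by
  have hc : ∀ k : Fin n, firstIdx hn k.castSucc = firstIdx hn.le k := fun k => rfl
  have hl : firstIdx hn (Fin.last n) = ⟨n, hn⟩ := rfl
  have hi : ∀ s r : Fin n, firstIdx hn (if s = r then Fin.last n else s.castSucc) =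
      if s = r then ⟨n, hn⟩ else firstIdx hn.le s := fun s r => by split_ifs <;> rfl
  rw [qminor, ncdet_succ]
  simp only [Fin.val_castSucc, qshift_succ_castSucc, Fin.val_last, hc, hl, hi,
    lie_qminor_lower hE]
  refine congrArg₂ (· - ·) rfl (Finset.sum_congr rfl fun r _ => ?_)
  rw [lMat_of_ne _ _ _ (by simp [firstIdx, Fin.ext_iff, r.2.ne])]

/-- The second description of B_n. Its last column has no entry with λ, so the expansion involves
only the minor of size i and its brackets, parallel to `qminor_first_succ` one level lower. -/
lemma qminor_skip_succ (hE : IsGlRep E) {i : ℕ} (hi : i + 1 < N) (a : ℂ) :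
    qminor h E a (firstIdx hi.le) (skipIdx hi) =
      qminor h E (a + h / 2) (firstIdx (Nat.le_of_succ_le hi.le))
          (firstIdx (Nat.le_of_succ_le hi.le)) * C (-(h • E ⟨i, by omega⟩ ⟨i + 1, hi⟩)) -
        ∑ r : Fin i, ⁅C (E ⟨i, by omega⟩ (firstIdx (Nat.le_of_succ_le hi.le) r)),
            qminor h E (a + h / 2) (firstIdx (Nat.le_of_succ_le hi.le))
              (firstIdx (Nat.le_of_succ_le hi.le))⁆ *
          C (-(h • E (firstIdx (Nat.le_of_succ_le hi.le) r) ⟨i + 1, hi⟩)) := by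
  have hs : ∀ k : Fin i, skipIdx hi k.castSucc = firstIdx (Nat.le_of_succ_le hi.le) k :=
    fun k => by rw [skipIdx_eq, if_neg (Fin.castSucc_ne_last k)]; rfl
  have hl : skipIdx hi (Fin.last i) = ⟨i + 1, hi⟩ := by rw [skipIdx_eq, if_pos rfl]
  have hi' : ∀ s r : Fin i, firstIdx hi.le (if s = r then Fin.last i else s.castSucc) =
      if s = r then ⟨i, by omega⟩ else firstIdx (Nat.le_of_succ_le hi.le) s := fun s r => by
    split_ifs <;> rfl
  have hc : ∀ k : Fin i, firstIdx hi.le k.castSucc = firstIdx (Nat.le_of_succ_le hi.le) k :=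
    fun k => rfl
  have hf : firstIdx hi.le (Fin.last i) = ⟨i, by omega⟩ := rfl
  rw [qminor, ncdet_succ]
  simp only [Fin.val_castSucc, qshift_succ_castSucc, Fin.val_last, hs, hc, hl, hf, hi',
    lie_qminor_lower hE]
  rw [lMat_of_ne _ _ _ (by simp)]
  refine congrArg₂ (· - ·) rfl (Finset.sum_congr rfl fun r _ => ?_)
  rw [lMat_of_ne _ _ _ (by simp only [firstIdx, Fin.ext_iff, ne_eq]; simp; omega)]

end minors

/-! ### The action of the quantum minors -/

/-- Multiplication operators, as a ring homomorphism. -/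
def mulHom (K : Type*) [Field K] [Algebra ℂ K] : K →+* Module.End ℂ K :=
  (Algebra.lmul ℂ K : K →ₐ[ℂ] Module.End ℂ K)

@[simp] lemma mulHom_apply {K : Type*} [Field K] [Algebra ℂ K] (a f : K) :
    mulHom K a f = a * f := rfl

/-- The polynomial `∏_j (X - x_{nj} - a)`. -/
def charPoly {K : Type*} [Field K] (x : ℕ → ℕ → K) (n : ℕ) (a : K) : K[X] :=
  ∏ j ∈ Finset.range n, (X - C (x n j + a))

/-- The polynomial `∏_{s ≠ j} (X - x_{ns} - a) / (x_{nj} - x_{ns})`. -/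
def lagPoly {K : Type*} [Field K] (x : ℕ → ℕ → K) (n : ℕ) (a : K) (j : ℕ) : K[X] :=
  ∏ s ∈ (Finset.range n).erase j, ((X - C (x n s + a)) * C (x n j - x n s)⁻¹)

/-- `∏_{r < m} (x_{nj} - x_{mr} - t/2)`. -/
def linkFactor {K : Type*} [Field K] (x : ℕ → ℕ → K) (t : K) (n m j : ℕ) : K :=
  ∏ r ∈ Finset.range m, (x n j - x m r - t / 2)

/-- The polynomial with operator coefficients
`∑_j ∏_{s ≠ j} (X - x_{ns} - a) / (x_{nj} - x_{ns}) ∏_r (x_{nj} - x_{mr} - t/2) τ_{nj}`. -/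
def ladderPoly {K : Type*} [Field K] [Algebra ℂ K] (x : ℕ → ℕ → K) (t : K)
    (τ : ℕ → ℕ → K →ₐ[ℂ] K) (n m : ℕ) (a : K) : (Module.End ℂ K)[X] :=
  ∑ j ∈ Finset.range n, (lagPoly x n a j * C (linkFactor x t n m j)).map (mulHom K) *
    C (τ n j).toLinearMap

section

variable {K : Type*} [Field K] [Algebra ℂ K] {N : ℕ} {x : ℕ → ℕ → K} {t : K}
  {τ τ' : ℕ → ℕ → K →ₐ[ℂ] K}

lemma charPoly_eval (n : ℕ) (a μ : K) :
    (charPoly x n a).eval μ = ∏ j ∈ Finset.range n, (μ - (x n j + a)) := by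
  simp [charPoly, eval_prod]

lemma charPoly_monic (n : ℕ) (a : K) : (charPoly x n a).Monic :=
  monic_prod_of_monic _ _ fun _ _ => monic_X_sub_C _

lemma charPoly_natDegree (n : ℕ) (a : K) : (charPoly x n a).natDegree = n := by
  rw [charPoly, natDegree_finsetProd_X_sub_C_eq_card _ (fun j => x n j + a), Finset.card_range]

lemma diffOp_mul_mulHom (c q : K) (σ : K →ₐ[ℂ] K) :
    diffOp c σ * mulHom K q = mulHom K (c * σ q) * σ.toLinearMap := by
  ext f
  simp [Module.End.mul_apply, mul_assoc]

/-- Moving the multiplication coefficients of q to the left of the difference operator twists them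
by σ. -/
lemma C_diffOp_mul_map (c : K) (σ : K →ₐ[ℂ] K) (q : K[X]) :
    C (diffOp c σ) * q.map (mulHom K) =
      (C c * q.map (σ : K →+* K)).map (mulHom K) * C σ.toLinearMap := by
  ext k : 1
  rw [coeff_C_mul, coeff_map, diffOp_mul_mulHom, coeff_mul_C, coeff_map, coeff_C_mul, coeff_map]
  rfl

lemma sum_mul_sub_mul_sum {R : Type*} [Ring R] (s : Finset ℕ) (f : ℕ → R) (z : R) :
    z * (∑ j ∈ s, f j) - (∑ j ∈ s, f j) * z = ∑ j ∈ s, (z * f j - f j * z) := by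
  rw [Finset.mul_sum, Finset.sum_mul, ← Finset.sum_sub_distrib]

lemma ringLie_swap {R : Type*} [Ring R] (a b : R) : ⁅a, b⁆ = -⁅b, a⁆ := by
  rw [Ring.lie_def, Ring.lie_def, neg_sub]

lemma ringLie_lie_of_commute {R : Type*} [Ring R] (e g q : R) (h : q * g = g * q) :
    ⁅e * g - g * e, q⁆ = ⁅e, q⁆ * g - g * ⁅e, q⁆ := by
  have h' : e * g * q = e * q * g := by rw [mul_assoc, ← h, mul_assoc]
  have h'' : q * (g * e) = g * q * e := by rw [← mul_assoc, h]
  simp only [Ring.lie_def, sub_mul, mul_sub, h', h'', mul_assoc]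
  abel

lemma sub_mul_eq {R : Type*} [Ring R] (a b c d : R) (h : a - b = d) : a * c - b * c = d * c := by
  rw [← sub_mul, h]

lemma neg_mul_of_eq_neg {R : Type*} [Ring R] (a b z : R) (h : a = -b) : -(a * z) = b * z := by
  rw [h, neg_mul, neg_neg]

lemma sub_of_commute_right {R : Type*} [Ring R] (l T g : R) (h : T * g = g * T) :
    -(l * T) * g - g * -(l * T) = (g * l - l * g) * T := by
  rw [neg_mul, mul_assoc, h]
  noncomm_ring

lemma toLinearMap_mul_mulHom (σ : K →ₐ[ℂ] K) (q : K) :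
    (σ.toLinearMap : Module.End ℂ K) * mulHom K q = mulHom K (σ q) * σ.toLinearMap := by
  ext f
  simp [Module.End.mul_apply]

namespace Shifts

lemma map_charPoly (h : Shifts N x t τ) {n j : ℕ} (hn : n < N) (hj : j < n) {a : K}
    (ha : τ n j a = a) : (charPoly x n a).map (τ n j : K →+* K) =
      charPoly x n a + C t * ∏ s ∈ (Finset.range n).erase j, (X - C (x n s + a)) := by
  have hj' := Finset.mem_range.2 hj
  rw [charPoly, Polynomial.map_prod,
    ← Finset.mul_prod_erase _ (fun i => Polynomial.map _ (X - C (x n i + a))) hj',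
    ← Finset.mul_prod_erase _ (fun i => X - C (x n i + a)) hj',
    Finset.prod_congr rfl (g := fun s => X - C (x n s + a)) fun s hs => ?_]
  · rw [Polynomial.map_sub, map_X, map_C, RingHom.coe_coe, map_add (τ n j), ha, h.self hn hj]
    simp only [map_add, map_sub]
    ring
  · rw [Polynomial.map_sub, map_X, map_C, RingHom.coe_coe, map_add (τ n j), ha,
      h.ne_index n (Finset.ne_of_mem_erase hs).symm]

/-- The j-th shift changes a single factor of the polynomial, by t, so the commutator is the product
of the other factors. The t cancels the t⁻¹ in the ladder coefficients, which leaves a Lagrange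
basis polynomial. -/
lemma lie_charPoly_ladder (h : Shifts N x t τ) {n m : ℕ} (hn : n < N) {a : K}
    (ha : ∀ j, τ n j a = a) :
    ⁅(charPoly x n a).map (mulHom K), C (ladder x t τ n m)⁆ = ladderPoly x t τ n m a := by
  rw [ladder, map_sum]
  refine (sum_mul_sub_mul_sum (R := (Module.End ℂ K)[X]) _ _ _).trans (Finset.sum_congr rfl fun j hj => ?_)
  rw [Finset.mem_range] at hj
  rw [C_diffOp_mul_map, h.map_charPoly hn hj (ha j)]
  have e1 : C (diffOp (lagCoeff x n (ladderNum x t n m) j) (τ n j)) =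
      (C (lagCoeff x n (ladderNum x t n m) j)).map (mulHom K) * C (τ n j).toLinearMap := by
    rw [map_C, ← C_mul]
    rfl
  rw [e1, ← mul_assoc, ← Polynomial.map_mul]
  refine sub_mul_eq (R := (Module.End ℂ K)[X]) _ _ _ _ ?_
  rw [← Polynomial.map_sub]
  congr 1
  have e2 : lagCoeff x n (ladderNum x t n m) j * t = -linkFactor x t n m j *
      ∏ s ∈ (Finset.range n).erase j, (x n j - x n s)⁻¹ := by
    have := h.ne_zero
    rw [lagCoeff, ladderNum, linkFactor, Finset.prod_inv_distrib]
    field_simp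
  rw [lagPoly, Finset.prod_mul_distrib, ← map_prod]
  have e3 := congrArg (C : K → K[X]) e2
  simp only [map_mul, map_neg] at e3
  linear_combination (-∏ s ∈ (Finset.range n).erase j, (X - C (x n s + a))) * e3

/-- The points are the interpolation nodes of the Lagrange basis, so one term survives. -/
lemma leftEval_ladderPoly (h : Shifts N x t τ) {n m k : ℕ} (hn : n < N) (hk : k < n) (a : K) :
    leftEval (mulHom K (x n k + a)) (ladderPoly x t τ n m a) =
      mulHom K (linkFactor x t n m k) * (τ n k).toLinearMap := by
  have hk' := Finset.mem_range.2 hk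
  rw [ladderPoly, map_sum, Finset.sum_eq_single_of_mem k hk']
  · rw [leftEval_mul_C, leftEval_map, eval_mul, eval_C, lagPoly, eval_prod,
      Finset.prod_eq_one, one_mul]
    intro s hs
    have := h.sub_ne_index hn hk (Finset.ne_of_mem_erase hs).symm
    simp [this]
  · intro j _ hjk
    rw [leftEval_mul_C, leftEval_map, eval_mul, eval_C, lagPoly, eval_prod,
      Finset.prod_eq_zero (Finset.mem_erase.2 ⟨hjk.symm, hk'⟩) (by simp)]
    simp

end Shifts

/-! ### The inductive computation of the leading quantum minors -/

/-- Operators `E i j` that satisfy the relations of `gl(N)` and are given by the Gelfand–Zetlin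
formulas for the simple generators. -/
structure GZOps (N : ℕ) (x : ℕ → ℕ → K) (h : ℂ) (τ τ' : ℕ → ℕ → K →ₐ[ℂ] K)
    (E : Fin N → Fin N → Module.End ℂ K) : Prop where
  shifts : Shifts N x (algebraMap ℂ K h) τ
  shifts' : Shifts N x (-algebraMap ℂ K h) τ'
  inv : ∀ n j f, τ' n j (τ n j f) = f
  gl : IsGlRep E
  diag : ∀ (i : ℕ) (hi : i < N),
    E ⟨i, hi⟩ ⟨i, hi⟩ = mulHom K (weight x (algebraMap ℂ K h) i)
  raise : ∀ (i : ℕ) (hi : i + 1 < N),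
    E ⟨i, by omega⟩ ⟨i + 1, hi⟩ = ladder x (algebraMap ℂ K h) τ (i + 1) (i + 2)
  lower : ∀ (i : ℕ) (hi : i + 1 < N),
    E ⟨i + 1, hi⟩ ⟨i, by omega⟩ = ladder x (-algebraMap ℂ K h) τ' (i + 1) i

namespace GZOps

variable {h : ℂ} {E : Fin N → Fin N → Module.End ℂ K}

/-- E_{nr} with r < n is an iterated bracket of simple lowering operators that shift the levels up
to n, so commuting with those is enough. -/
lemma commute_lower (H : GZOps N x h τ τ' E) {n : ℕ} (hn : n < N) (z : Module.End ℂ K)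
    (hz : ∀ k < n, Commute z (ladder x (-algebraMap ℂ K h) τ' (k + 1) k)) (r : ℕ) (hr : r < n) :
    Commute z (E ⟨n, hn⟩ ⟨r, by omega⟩) := by
  obtain ⟨d, rfl⟩ := Nat.exists_eq_add_of_le (Nat.succ_le_of_lt hr)
  induction d with
  | zero =>
    change Commute z (E ⟨r + 1, hn⟩ ⟨r, _⟩)
    rw [H.lower r hn]
    exact hz r (by omega)
  | succ d ih =>
    have e := H.gl ⟨r + 1 + d + 1, hn⟩ ⟨r + 1 + d, by omega⟩ ⟨r + 1 + d, by omega⟩ ⟨r, by omega⟩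
    rw [if_pos rfl, if_neg (by simp only [Fin.mk.injEq]; omega), sub_zero, Ring.lie_def,
      H.lower] at e
    have h1 := hz (r + 1 + d) (by omega)
    have h2 := ih (by omega) (fun k hk => hz k (by simp at hk ⊢; omega)) (by simp; omega)
    have := (h1.mul_right h2).sub_right (h2.mul_right h1)
    simp only [Nat.succ_eq_add_one] at this e ⊢
    rw [e] at this
    exact this

lemma _root_.GZ.commute_mulHom_ladder {k : ℕ} {q : K}
    (hq : ∀ j, τ' (k + 1) j q = q) :
    Commute (mulHom K q) (ladder x t τ' (k + 1) k) := by
  refine Commute.sum_right _ _ _ fun j _ => ?_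
  rw [Commute, SemiconjBy, diffOp_mul_mulHom, hq]
  ext f
  simp [Module.End.mul_apply]
  ring

lemma commute_ladder_shift (H : GZOps N x h τ τ' E) {n k : ℕ} (hk : k + 1 < n) (j : ℕ) :
    Commute (τ' n j).toLinearMap (ladder x (-algebraMap ℂ K h) τ' (k + 1) k) := by
  refine Commute.sum_right _ _ _ fun i _ => ?_
  ext f
  simp only [Module.End.mul_apply, AlgHom.toLinearMap_apply, diffOp_apply, map_mul,
    H.shifts'.map_lagCoeff_ladderNum H.shifts'.fix (show n ≠ k + 1 by omega)
      (show n ≠ k by omega), H.shifts'.comm n j]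

/-- `E_{ir}` with `r < i` commutes with the variables and the shifts of level `n = i + 1`. -/
lemma commute_lower_var (H : GZOps N x h τ τ' E) {i : ℕ} (hi : i < N) (r : ℕ) (hr : r < i) (j : ℕ)
    (a : ℂ) : Commute (mulHom K (x (i + 1) j + algebraMap ℂ K a)) (E ⟨i, hi⟩ ⟨r, by omega⟩) :=
  H.commute_lower hi _ (fun k hk => commute_mulHom_ladder fun l => by
    rw [map_add, AlgHom.commutes, H.shifts'.ne_level _ _ (by omega)]) r hr

lemma commute_lower_shift (H : GZOps N x h τ τ' E) {i : ℕ} (hi : i < N) (r : ℕ) (hr : r < i)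
    (j : ℕ) : Commute (τ' (i + 1) j).toLinearMap (E ⟨i, hi⟩ ⟨r, by omega⟩) :=
  H.commute_lower hi _ (fun k hk => H.commute_ladder_shift (by omega) j) r hr

lemma _root_.GZ.commute_map_charPoly {A : Type*} [Ring A] (m : K →+* A) {n : ℕ} {a : K} {z : A}
    (hz : ∀ j < n, Commute (m (x n j + a)) z) : Commute ((charPoly x n a).map m) (C z) := by
  refine Finset.prod_induction _ (fun q : K[X] => Commute (q.map m) (C z)) ?_ ?_ ?_
  · intro p q hp hq
    rw [Polynomial.map_mul]
    exact hp.mul_left hq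
  · rw [Polynomial.map_one]
    exact Commute.one_left _
  · intro j hj
    rw [Polynomial.map_sub, map_X, map_C]
    exact (commute_X _).sub_left ((hz j (Finset.mem_range.1 hj)).map C)

lemma coeff_eq_of_nextCoeff {p q : K[X]} (hp : p.Monic) (hq : q.Monic) {n : ℕ}
    (dp : p.natDegree = n + 1) (dq : q.natDegree = n + 1) (hpq : p.nextCoeff = q.nextCoeff) {k : ℕ}
    (hk : n ≤ k) : p.coeff k = q.coeff k := by
  rw [nextCoeff_of_natDegree_pos (by omega), nextCoeff_of_natDegree_pos (by omega), dp, dq,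
    Nat.add_sub_cancel] at hpq
  obtain rfl | rfl | hk' : k = n ∨ k = n + 1 ∨ n + 1 < k := by omega
  · exact hpq
  · have h1 := hp.coeff_natDegree
    have h2 := hq.coeff_natDegree
    rw [dp] at h1
    rw [dq] at h2
    rw [h1, h2]
  · rw [coeff_eq_zero_of_natDegree_lt (by omega), coeff_eq_zero_of_natDegree_lt (by omega)]

/-- The quantum minor of the next level has the right values as soon as it has the right left
substitutions. -/
lemma qminor_succ_of_leftEval (H : GZOps N x h τ τ' E) {n : ℕ} (hn : n < N) (a : ℂ)
    (ih : qminor h E (a + h / 2) (firstIdx hn.le) (firstIdx hn.le) =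
      (charPoly x n (algebraMap ℂ K (a + h / 2))).map (mulHom K))
    (hev : ∀ k < n, leftEval (mulHom K (x n k + algebraMap ℂ K (a + h / 2)))
        (qminor h E a (firstIdx hn) (firstIdx hn)) =
      mulHom K ((charPoly x (n + 1) (algebraMap ℂ K a)).eval
        (x n k + algebraMap ℂ K (a + h / 2)))) :
    qminor h E a (firstIdx hn) (firstIdx hn) =
      (charPoly x (n + 1) (algebraMap ℂ K a)).map (mulHom K) := by
  have t0 := H.shifts.ne_zero
  set q := charPoly x n (algebraMap ℂ K (a + h / 2)) with hq
  set w : K := algebraMap ℂ K (a + qshift h (n + 1) n) + algebraMap ℂ K h *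
    weight x (algebraMap ℂ K h) n with hw
  have hl : lMat h E (a + qshift h (n + 1) n) ⟨n, hn⟩ ⟨n, hn⟩ = (X - C w).map (mulHom K) := by
    have e1 : algebraMap ℂ (Module.End ℂ K) (a + qshift h (n + 1) n) =
        mulHom K (algebraMap ℂ K (a + qshift h (n + 1) n)) := by
      ext f
      simp [Algebra.smul_def]
    have e2 : h • mulHom K (weight x (algebraMap ℂ K h) n) =
        mulHom K (algebraMap ℂ K h * weight x (algebraMap ℂ K h) n) := by
      ext f
      simp [Algebra.smul_def]
    rw [lMat, if_pos rfl, H.diag, e1, e2, Polynomial.map_sub, map_X, map_C, hw, map_add (mulHom K),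
      C_add, sub_sub]
  rw [← sub_eq_zero]
  refine eq_zero_of_leftEval_eq_zero (n := n)
    (fun k => x n k + algebraMap ℂ K (a + h / 2)) ?_ _ ?_ ?_
  · intro i hi j hj hij
    by_contra hne
    exact H.shifts.sub_ne_index hn hi hne (by linear_combination hij)
  -- Degrees at least n. The brackets contribute nothing, since their coefficients there are
  -- brackets with 1 or 0. The product q (X - w) has the right next coefficient because h times the
  -- weight is the difference of the level sums, and the shifts n h/2 and -n h/2 cancel.
  · intro k hk
    rw [qminor_first_succ H.gl, ih, hl, ← Polynomial.map_mul, coeff_sub, coeff_sub, coeff_map,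
      coeff_map, finsetSum_coeff, Finset.sum_eq_zero, sub_zero, ← map_sub]
    · have mq : q.Monic := charPoly_monic _ _
      have hnat : (q * (X - C w)).natDegree = n + 1 := by
        rw [mq.natDegree_mul (monic_X_sub_C w), hq, charPoly_natDegree, natDegree_X_sub_C]
      have h1 : q.nextCoeff = -∑ j ∈ Finset.range n, (x n j + algebraMap ℂ K (a + h / 2)) :=
        prod_X_sub_C_nextCoeff _
      have h2 : (charPoly x (n + 1) (algebraMap ℂ K a)).nextCoeff =
          -∑ j ∈ Finset.range (n + 1), (x (n + 1) j + algebraMap ℂ K a) :=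
        prod_X_sub_C_nextCoeff _
      rw [coeff_eq_of_nextCoeff (mq.mul (monic_X_sub_C w)) (charPoly_monic _ _) hnat
        (charPoly_natDegree _ _) _ hk, sub_self, map_zero]
      rw [mq.nextCoeff_mul (monic_X_sub_C w), nextCoeff_X_sub_C, h1, h2]
      simp only [Finset.sum_add_distrib, Finset.sum_const, Finset.card_range, nsmul_eq_mul, hw,
        weight, qshift, map_add, map_mul, map_div₀, map_sub, map_natCast, map_ofNat, map_one]
      have : CharZero K := charZero_of_injective_algebraMap (algebraMap ℂ K).injective
      push_cast
      field_simp
      ring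
    · intro r _
      rw [coeff_mul_C, Ring.lie_def, coeff_sub, coeff_C_mul, coeff_mul_C, coeff_map]
      have hqk : q.coeff k = if k = n then 1 else 0 := by
        split_ifs with hkn
        · rw [hkn]
          have := (charPoly_monic (x := x) n (algebraMap ℂ K (a + h / 2))).coeff_natDegree
          rwa [charPoly_natDegree, ← hq] at this
        · exact coeff_eq_zero_of_natDegree_lt (by rw [hq, charPoly_natDegree]; omega)
      rw [hqk]
      split_ifs <;> simp
  · intro k hk
    have e1 := hev k hk
    have e2 := leftEval_map (mulHom K) (x n k + algebraMap ℂ K (a + h / 2))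
      (charPoly x (n + 1) (algebraMap ℂ K a))
    rw [← e1, ← sub_eq_zero, ← map_sub] at e2
    rw [← neg_eq_zero, ← map_neg, neg_sub]
    exact e2

/-- The left substitutions in the quantum minor of level `i + 2`. -/
lemma leftEval_qminor (H : GZOps N x h τ τ' E) {i : ℕ} (hi : i + 1 < N) (a : ℂ)
    (ih : ∀ a, qminor h E a (firstIdx hi.le) (firstIdx hi.le) =
      (charPoly x (i + 1) (algebraMap ℂ K a)).map (mulHom K))
    (ih' : qminor h E (a + h / 2) (firstIdx (Nat.le_of_succ_le hi.le))
        (firstIdx (Nat.le_of_succ_le hi.le)) =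
      (charPoly x i (algebraMap ℂ K (a + h / 2))).map (mulHom K)) {k : ℕ} (hk : k < i + 1) :
    leftEval (mulHom K (x (i + 1) k + algebraMap ℂ K (a + h / 2)))
        (qminor h E a (firstIdx hi) (firstIdx hi)) =
      mulHom K ((charPoly x (i + 2) (algebraMap ℂ K a)).eval
        (x (i + 1) k + algebraMap ℂ K (a + h / 2))) := by
  have hiN : i < N := by omega
  set t := algebraMap ℂ K h with ht
  set Q := (charPoly x (i + 1) (algebraMap ℂ K (a + h / 2))).map (mulHom K) with hQ
  set P := (charPoly x i (algebraMap ℂ K (a + h / 2))).map (mulHom K) with hP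
  -- Three points at distance h/2: κ below μ and ν above it. Here μ is a root of Q, κ is the node at
  -- which B is known, and T conjugates κ to ν.
  set μ := mulHom K (x (i + 1) k + algebraMap ℂ K (a + h / 2)) with hμ
  set κ := mulHom K (x (i + 1) k + algebraMap ℂ K a) with hκ
  set ν := mulHom K (x (i + 1) k + algebraMap ℂ K (a + h)) with hν
  set T : Module.End ℂ K := (τ' (i + 1) k).toLinearMap with hT
  set ℓ := mulHom K (linkFactor x (-t) (i + 1) i k) with hℓ
  have hcE : ∀ (r : ℕ) (hr : r < i) (b : ℂ),
      Commute (mulHom K (x (i + 1) k + algebraMap ℂ K b)) (E ⟨i, hiN⟩ ⟨r, by omega⟩) :=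
    fun r hr b => H.commute_lower_var hiN r hr k b
  have hevP : leftEval ν P = ℓ := by
    rw [hP, hν, leftEval_map, charPoly_eval, hℓ, linkFactor]
    congr 1
    refine Finset.prod_congr rfl fun r _ => ?_
    simp only [map_add, map_div₀, map_ofNat, ← ht]
    have : CharZero K := charZero_of_injective_algebraMap (algebraMap ℂ K).injective
    field_simp
    ring
  have hC : leftEval μ ⁅C (E ⟨i + 1, hi⟩ ⟨i, hiN⟩), Q⁆ = -(ℓ * T) := by
    have e : ⁅C (E ⟨i + 1, hi⟩ ⟨i, hiN⟩), Q⁆ =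
        -ladderPoly x (-t) τ' (i + 1) i (algebraMap ℂ K (a + h / 2)) := by
      rw [H.lower i hi, ← H.shifts'.lie_charPoly_ladder hi fun j => AlgHom.commutes _ _]
      exact ringLie_swap _ _
    rw [e, map_neg, hμ, H.shifts'.leftEval_ladderPoly hi hk]
  -- Write E_{i+1,r} = [e, g] with g = E_{ir}. As g commutes with Q, the bracket with Q is [[e, Q],
  -- g], whose value follows from that of [e, Q] because g commutes with μ and T. The factor ℓ is P
  -- at ν, so a bracket of g with P appears.
  have hM : ∀ (r : ℕ) (hr : r < i), leftEval μ ⁅C (E ⟨i + 1, hi⟩ ⟨r, by omega⟩), Q⁆ =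
      leftEval ν ⁅C (E ⟨i, hiN⟩ ⟨r, by omega⟩), P⁆ * T := by
    intro r hr
    set g := E ⟨i, hiN⟩ ⟨r, by omega⟩ with hg
    set e := E ⟨i + 1, hi⟩ ⟨i, hiN⟩ with he
    have h1 : E ⟨i + 1, hi⟩ ⟨r, by omega⟩ = e * g - g * e := by
      have := H.gl ⟨i + 1, hi⟩ ⟨i, hiN⟩ ⟨i, hiN⟩ ⟨r, by omega⟩
      rw [if_pos rfl, if_neg (by simp only [Fin.mk.injEq]; omega), sub_zero, Ring.lie_def] at this
      exact this.symm
    have h2 : Q * C g = C g * Q := commute_map_charPoly _ fun j _ => H.commute_lower_var hiN r hr j _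
    have h3 : ⁅C (E ⟨i + 1, hi⟩ ⟨r, by omega⟩), Q⁆ = ⁅C e, Q⁆ * C g - C g * ⁅C e, Q⁆ := by
      rw [h1, C_sub, C_mul, C_mul]
      exact ringLie_lie_of_commute (C e) (C g) Q h2
    have h6 : T * g = g * T := H.commute_lower_shift hiN r hr k
    rw [h3, map_sub, leftEval_mul_C, ← mul_leftEval (hcE r hr _).symm, hC, Ring.lie_def, map_sub,
      leftEval_mul_C, ← mul_leftEval (hcE r hr _).symm, hevP]
    exact sub_of_commute_right ℓ T g h6
  have hTP : Commute P (C T) := commute_map_charPoly _ fun j _ => by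
    rw [Commute, SemiconjBy, hT, toLinearMap_mul_mulHom, map_add (τ' (i + 1) k), AlgHom.commutes,
      H.shifts'.ne_level k j (show i + 1 ≠ i by omega)]
  have hTκ : T * κ = ν * T := by
    rw [hT, hκ, hν, toLinearMap_mul_mulHom, map_add (τ' (i + 1) k), AlgHom.commutes,
      H.shifts'.self hi hk, map_add (algebraMap ℂ K), ← ht]
    congr 2
    ring
  have hTev : ∀ R : (Module.End ℂ K)[X], Commute R (C T) →
      T * leftEval κ R = leftEval ν R * T := fun R hR => by
    rw [mul_leftEval hTκ, ← leftEval_mul_C, hR.eq]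
  -- B is expressed in two ways, by its last-column expansion and as the commutator of A with the
  -- raising operator. Both are substituted at κ and multiplied by T from the left.
  have hB := qminor_skip_succ (h := h) H.gl hi a
  rw [qminor_first_skip H.gl, ih, ih', H.raise i hi,
    H.shifts.lie_charPoly_ladder hi fun j => AlgHom.commutes _ _] at hB
  have hB' := congrArg (fun R => T * leftEval κ R) hB
  simp only [hκ, H.shifts.leftEval_ladderPoly hi hk] at hB'
  rw [← hκ, map_sub, map_sum, mul_sub, Finset.mul_sum] at hB'
  simp only [leftEval_mul_C] at hB'
  rw [← mul_assoc T (leftEval κ P), hTev P hTP, hevP] at hB'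
  rw [qminor_first_succ H.gl hi a, ih, lMat, map_sub, leftEval_map_mul, map_sum,
    Fin.sum_univ_castSucc]
  have hz : (charPoly x (i + 1) (algebraMap ℂ K (a + h / 2))).eval
      (x (i + 1) k + algebraMap ℂ K (a + h / 2)) = 0 := by
    rw [charPoly_eval, Finset.prod_eq_zero (Finset.mem_range.2 hk) (sub_self _)]
  rw [hz, map_zero, zero_mul, zero_sub]
  simp only [leftEval_mul_C]
  have hup : T * (mulHom K (linkFactor x t (i + 1) (i + 2) k) * (τ (i + 1) k).toLinearMap) =
      mulHom K ((charPoly x (i + 2) (algebraMap ℂ K a)).eval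
        (x (i + 1) k + algebraMap ℂ K (a + h / 2))) := by
    rw [← mul_assoc, hT, toLinearMap_mul_mulHom, mul_assoc, linkFactor, charPoly_eval,
      map_prod (τ' (i + 1) k)]
    have e : (τ' (i + 1) k).toLinearMap * (τ (i + 1) k).toLinearMap = (1 : Module.End ℂ K) := by
      ext f
      exact H.inv _ _ _
    rw [e, mul_one]
    congr 1
    refine Finset.prod_congr rfl fun r _ => ?_
    have : CharZero K := charZero_of_injective_algebraMap (algebraMap ℂ K).injective
    rw [map_sub (τ' (i + 1) k), map_sub (τ' (i + 1) k), H.shifts'.self hi hk,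
      H.shifts'.ne_level k r (show i + 1 ≠ i + 2 by omega), map_div₀ (τ' (i + 1) k), ht,
      AlgHom.commutes, map_ofNat (τ' (i + 1) k), map_add (algebraMap ℂ K),
      map_div₀ (algebraMap ℂ K), map_ofNat (algebraMap ℂ K)]
    field_simp
    ring
  rw [← hup]
  -- The first term of the expansion of A vanishes at μ. What is left matches the transported
  -- expansion of B: the row r = i gives the leading term, and the rows r < i match by `hM`.
  refine Eq.trans ?_ hB'.symm
  have hrE : E ⟨i, hiN⟩ ⟨i + 1, hi⟩ = ladder x t τ (i + 1) (i + 2) := H.raise i hi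
  rw [neg_add, neg_add_eq_sub]
  refine congrArg₂ (· - ·) ?_ (Finset.sum_congr rfl fun r _ => ?_)
  · rw [← hrE]
    exact neg_mul_of_eq_neg _ _ _ hC
  · have hgT : Commute (C (E ⟨i, hiN⟩ ⟨r, by omega⟩)) (C T) :=
      (show Commute _ _ from (H.commute_lower_shift hiN r r.2 k).symm).map C
    rw [← mul_assoc T]
    refine congrArg₂ (· * ·) ((hM r r.2).trans (hTev _ ?_).symm) rfl
    exact (hgT.mul_left hTP).sub_left (hTP.mul_left hgT)

/-- The quantum minors of the first rows and columns act by multiplication. -/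
theorem qminor_first (H : GZOps N x h τ τ' E) (n : ℕ) (hn : n ≤ N) (a : ℂ) :
    qminor h E a (firstIdx hn) (firstIdx hn) =
      (charPoly x n (algebraMap ℂ K a)).map (mulHom K) := by
  induction n using Nat.strong_induction_on generalizing a with
  | _ n ih =>
    -- Each step uses the two preceding levels. Level 1 needs no substitution, since its top
    -- coefficients already determine it.
    match n with
    | 0 => simp [qminor, ncdet_zero, charPoly]
    | 1 => exact H.qminor_succ_of_leftEval hn a (ih 0 one_pos _ _) fun k hk => by omega
    | i + 2 =>
      exact H.qminor_succ_of_leftEval hn a (ih (i + 1) (by omega) _ _) fun k hk =>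
        H.leftEval_qminor hn a (fun b => ih (i + 1) (by omega) _ b) (ih i (by omega) _ _) hk

theorem qminor_first_skip_eq (H : GZOps N x h τ τ' E) {i : ℕ} (hi : i + 1 < N) (a : ℂ) :
    qminor h E a (firstIdx hi.le) (skipIdx hi) =
      ladderPoly x (algebraMap ℂ K h) τ (i + 1) (i + 2) (algebraMap ℂ K a) := by
  rw [qminor_first_skip H.gl, H.qminor_first, H.raise i hi,
    H.shifts.lie_charPoly_ladder hi fun j => AlgHom.commutes _ _]

theorem qminor_skip_first_eq (H : GZOps N x h τ τ' E) {i : ℕ} (hi : i + 1 < N) (a : ℂ) :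
    qminor h E a (skipIdx hi) (firstIdx hi.le) =
      -ladderPoly x (-algebraMap ℂ K h) τ' (i + 1) i (algebraMap ℂ K a) := by
  rw [qminor_skip_first H.gl, H.qminor_first, H.lower i hi,
    ← H.shifts'.lie_charPoly_ladder hi fun j => AlgHom.commutes _ _]
  exact ringLie_swap _ _

end GZOps

end

/-! ### Laurent series of operators -/

section Laurent

variable {A B : Type*} [Ring A] [Ring B]

/-- The coefficientwise action of a ring homomorphism on Laurent series. -/
def laurentMap (f : A →+* B) : LaurentSeries A →+* LaurentSeries B where
  toFun x := x.map f
  map_one' := (HahnSeries.map_single (a := (0 : ℤ)) (f : ZeroHom A B)).trans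
    (congrArg (HahnSeries.single (0 : ℤ)) (map_one f))
  map_mul' _ _ := HahnSeries.map_mul (f : A →ₙ+* B)
  map_zero' := HahnSeries.ext (funext fun _ => map_zero f)
  map_add' _ _ := HahnSeries.map_add (f : A →+ B)

@[simp] lemma laurentMap_coeff (f : A →+* B) (x : LaurentSeries A) (m : ℤ) :
    (laurentMap f x).coeff m = f (x.coeff m) := rfl

lemma laurentMap_cst (f : A →+* B) (a : A) : laurentMap f (cst a) = cst (f a) :=
  HahnSeries.map_C a f

lemma laurentMap_lam (f : A →+* B) : laurentMap f (lam A) = lam B :=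
  (HahnSeries.map_single (a := (-1 : ℤ)) (f : ZeroHom A B)).trans
    (congrArg (HahnSeries.single (-1 : ℤ)) (map_one f))

lemma lam_commute (x : LaurentSeries A) : Commute (lam A) x := by
  ext m
  rw [lam, HahnSeries.coeff_single_mul, HahnSeries.coeff_mul_single, one_mul, mul_one]

/-- Polynomials as Laurent series in `λ⁻¹`, with `X ↦ λ`. -/
def toLaurent (A : Type*) [Ring A] : A[X] →+* LaurentSeries A :=
  eval₂RingHom' HahnSeries.C (lam A) fun _ => (lam_commute _).symm

@[simp] lemma toLaurent_C (a : A) : toLaurent A (C a) = cst a := eval₂_C _ _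

@[simp] lemma toLaurent_X : toLaurent A X = lam A := eval₂_X _ _

lemma laurentMap_toLaurent (f : A →+* B) (P : A[X]) :
    laurentMap f (toLaurent A P) = toLaurent B (P.map f) := by
  have h : (laurentMap f).comp (toLaurent A) = (toLaurent B).comp (mapRingHom f) := by
    refine ringHom_ext (fun a => ?_) ?_
    · rw [RingHom.comp_apply, RingHom.comp_apply, toLaurent_C, laurentMap_cst, coe_mapRingHom,
        map_C, toLaurent_C]
    · simp [laurentMap_lam]
  exact congrArg (fun g => g P) h

end Laurent

lemma map_shiftedT {A : Type*} [Ring A] [Algebra ℂ A] {N : ℕ} {ħ : ℂ} (Φ : Yangian N ħ →ₐ[ℂ] A)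
    (c : ℂ) (j k : Fin N) (m : ℤ) :
    Φ ((shiftedT N ħ c j k).coeff m) = ∑ r ∈ Finset.Icc (-1) m,
      (lamSubPow c (-r)).coeff m • Φ (coeffT (yangianT N ħ) r j k) := by
  change Φ (∑ r ∈ Finset.Icc (-1) m, (lamSubPow c (-r)).coeff m • coeffT (yangianT N ħ) r j k) = _
  rw [map_sum]
  refine Finset.sum_congr rfl fun r _ => ?_
  exact map_smul Φ _ _

/-- The series `T_{jk}(λ - c)` if only its first two coefficients survive. -/
lemma laurentMap_shiftedT {A : Type*} [Ring A] [Algebra ℂ A] {N : ℕ} {ħ : ℂ}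
    (Φ : Yangian N ħ →ₐ[ℂ] A) {E : Fin N → Fin N → A} {h : ℂ}
    (hΦ : ∀ r j k, Φ (yangianT N ħ r j k) = if r = 0 then -(h • E j k) else 0)
    (c : ℂ) (j k : Fin N) :
    laurentMap (Φ : Yangian N ħ →+* A) (shiftedT N ħ c j k) = toLaurent A (lMat h E c j k) := by
  have hT : ∀ r, Φ (coeffT (yangianT N ħ) r j k) = coeffT (fun r => Matrix.of fun j k =>
      if r = 0 then -(h • E j k) else 0) r j k := fun r => coeffT_map Φ _ _ hΦ r j k
  have h1 : lamSubPow c (- -1) = lam ℂ - cst c := by rw [neg_neg, lamSubPow, zpow_one]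
  have h0 : lamSubPow c (-0) = 1 := by rw [neg_zero, lamSubPow, zpow_zero]
  have hz : ∀ r : ℤ, r ≠ -1 → r ≠ 0 → coeffT (fun r => Matrix.of fun j k =>
      if r = 0 then -(h • E j k) else (0 : A)) r j k = 0 := by
    intro r hr1 hr0
    match r with
    | Int.ofNat 0 => exact absurd rfl hr0
    | Int.ofNat (n + 1) => simp [coeffT]
    | Int.negSucc 0 => exact absurd rfl hr1
    | Int.negSucc (n + 1) => simp [coeffT]
  have hm1 : coeffT (fun r => Matrix.of fun j k =>
      if r = 0 then -(h • E j k) else (0 : A)) (-1) j k = if j = k then 1 else 0 :=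
    Matrix.one_apply
  have hm0 : coeffT (fun r => Matrix.of fun j k =>
      if r = 0 then -(h • E j k) else (0 : A)) 0 j k = -(h • E j k) := rfl
  have hR : toLaurent A (lMat h E c j k) =
      (if j = k then lam A - cst (algebraMap ℂ A c) else 0) - cst (h • E j k) := by
    rw [lMat]
    split_ifs <;> simp
  ext m
  rw [laurentMap_coeff, RingHom.coe_coe, map_shiftedT, hR]
  simp only [hT]
  obtain hm | rfl | hm : m < -1 ∨ m = -1 ∨ 0 ≤ m := by omega
  · rw [Finset.Icc_eq_empty (by omega), Finset.sum_empty]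
    split_ifs <;>
      simp [lam, HahnSeries.coeff_single_of_ne (show m ≠ -1 by omega),
        HahnSeries.coeff_single_of_ne (show m ≠ 0 by omega), HahnSeries.C_apply]
  · rw [Finset.Icc_self, Finset.sum_singleton, hm1, h1]
    split_ifs <;> simp [lam, HahnSeries.C_apply]
  · rw [← Finset.sum_subset (s₁ := {-1, 0}), Finset.sum_pair (by norm_num), hm1, hm0, h1, h0]
    · rcases hm.eq_or_lt with rfl | hm
      · split_ifs <;> simp [lam, HahnSeries.C_apply, Algebra.algebraMap_eq_smul_one, sub_eq_add_neg]
      · split_ifs <;>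
          simp [lam, HahnSeries.coeff_single_of_ne (show m ≠ -1 by omega),
            HahnSeries.coeff_single_of_ne (show m ≠ 0 by omega), HahnSeries.C_apply,
            HahnSeries.coeff_one, hm.ne']
    · intro r hr
      simp only [Finset.mem_insert, Finset.mem_singleton] at hr
      rw [Finset.mem_Icc]
      omega
    · intro r _ hr
      simp only [Finset.mem_insert, Finset.mem_singleton, not_or] at hr
      rw [hz r hr.1 hr.2, smul_zero]

lemma qdet_eq_ncdet (N : ℕ) (ħ : ℂ) {n : ℕ} (row col : Fin n → Fin N) :
    qdet N ħ row col = ncdet fun r k =>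
      shiftedT N ħ (qshift (Complex.I * ħ) n k) (row r) (col k) := rfl

lemma laurentMap_qdet {A : Type*} [Ring A] [Algebra ℂ A] {N : ℕ} {ħ : ℂ}
    (Φ : Yangian N ħ →ₐ[ℂ] A) {E : Fin N → Fin N → A}
    (hΦ : ∀ r j k, Φ (yangianT N ħ r j k) = if r = 0 then -((Complex.I * ħ) • E j k) else 0)
    {n : ℕ} (row col : Fin n → Fin N) :
    laurentMap (Φ : Yangian N ħ →+* A) (qdet N ħ row col) =
      toLaurent A (qminor (Complex.I * ħ) E 0 row col) := by
  rw [qdet_eq_ncdet, map_ncdet, qminor, map_ncdet]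
  simp only [laurentMap_shiftedT Φ hΦ, zero_add]

lemma toLaurent_charPoly {K : Type*} [Field K] (x : ℕ → ℕ → K) (n : ℕ) :
    toLaurent K (charPoly x n 0) = ∏ j : Fin n, (lam K - cst (x n j)) := by
  rw [charPoly, map_prod, Fin.prod_univ_eq_prod_range (fun j => lam K - cst (x n j))]
  simp

lemma toLaurent_lagPoly {K : Type*} [Field K] (x : ℕ → ℕ → K) (n : ℕ) (j : Fin n) :
    toLaurent K (lagPoly x n 0 j) = ∏ s ∈ Finset.univ.erase j,
      (lam K - cst (x n s)) * cst (x n j - x n s)⁻¹ := by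
  rw [lagPoly, map_prod, prod_erase_fin j (fun s => (lam K - cst (x n s)) * cst (x n j - x n s)⁻¹)]
  simp

lemma toLaurent_ladderPoly {K : Type*} [Field K] [Algebra ℂ K] (x : ℕ → ℕ → K) (t : K)
    (τ : ℕ → ℕ → K →ₐ[ℂ] K) (n m : ℕ) :
    toLaurent _ (ladderPoly x t τ n m 0) = ∑ j : Fin n,
      laurentMap (mulHom K) ((∏ s ∈ Finset.univ.erase j,
        (lam K - cst (x n s)) * cst (x n j - x n s)⁻¹) * cst (linkFactor x t n m j)) *
        cst ((τ n j).toLinearMap : Module.End ℂ K) := by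
  rw [ladderPoly, map_sum, ← Fin.sum_univ_eq_sum_range]
  refine Finset.sum_congr rfl fun j _ => ?_
  rw [map_mul, ← laurentMap_toLaurent, map_mul, toLaurent_lagPoly, toLaurent_C, toLaurent_C]

/-- The operators of a Gelfand–Zetlin representation. -/
lemma IsGZRep.gzOps {N : ℕ} {ħ : ℂ} (hħ : ħ ≠ 0) {label : Fin N → ℂ}
    {ρ : Ugl N →ₐ[ℂ] Module.End ℂ (GZSpace N)} (h : IsGZRep N ħ label ρ) :
    GZOps N (gamNat label) (Complex.I * ħ) (gamShiftNat N (-(Complex.I * ħ)))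
      (gamShiftNat N (Complex.I * ħ)) fun j k => ρ (genE N j k) := by
  have hc : Complex.I * ħ ≠ 0 := mul_ne_zero Complex.I_ne_zero hħ
  have h1 := gamNat_shifts label (neg_ne_zero.2 hc)
  have h2 := gamNat_shifts label hc
  rw [neg_neg] at h1
  rw [map_neg] at h2
  obtain ⟨e1, e2, e3⟩ := (isGZRep_iff ħ label ρ).1 h
  refine ⟨h1, h2, fun n j f => ?_, fun i j k l => ?_, e1, e2, e3⟩
  · have := gamShiftNat_neg (N := N) (-(Complex.I * ħ)) n j f
    rwa [neg_neg] at this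
  · have := congrArg ρ (genE_commutator N i j k l)
    simp only [map_sub, map_mul, apply_ite ρ, map_zero] at this
    exact this

/-- The Drinfeld generators act by the explicit difference operators. -/
theorem IsGZRep.drinfeldFormulas {N : ℕ} {ħ : ℂ} (hħ : ħ ≠ 0) {label : Fin N → ℂ}
    {ρ : Ugl N →ₐ[ℂ] Module.End ℂ (GZSpace N)} (h : IsGZRep N ħ label ρ) :
    DrinfeldFormulas N ħ label (ρ.comp (evalHom N ħ)) := by
  have H := h.gzOps hħ
  have hΦ : ∀ r j k, (ρ.comp (evalHom N ħ)) (yangianT N ħ r j k) =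
      if r = 0 then -((Complex.I * ħ) • ρ (genE N j k)) else 0 := by
    intro r j k
    rw [AlgHom.comp_apply, evalHom_T, evalT, Matrix.of_apply]
    split_ifs <;> simp
  have hq := fun {n : ℕ} (row col : Fin n → Fin N) =>
    laurentMap_qdet (ρ.comp (evalHom N ħ)) (E := fun j k => ρ (genE N j k)) hΦ row col
  refine ⟨fun n hn => (hq _ _).trans ?_, fun i hi => (hq _ _).trans ?_,
    fun i hi => (hq _ _).trans ?_⟩
  · rw [H.qminor_first, map_zero, ← laurentMap_toLaurent, toLaurent_charPoly]
    simp only [gam_eq]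
    rfl
  · rw [H.qminor_first_skip_eq, map_zero, toLaurent_ladderPoly]
    refine Finset.sum_congr rfl fun j _ => ?_
    rw [lagrange, upFactor_eq, gamShift_eq]
    simp only [gam_eq]
    rfl
  · rw [H.qminor_skip_first_eq, map_zero, map_neg, toLaurent_ladderPoly]
    refine congrArg Neg.neg (Finset.sum_congr rfl fun j _ => ?_)
    rw [lagrange, downFactor_eq, gamShift_eq]
    simp only [gam_eq, linkFactor, neg_div, sub_neg_eq_add]
    rfl

/-! ### Leading coefficients -/

section coeff

variable {A : Type*} [Ring A]

lemma coeff_mul_eq_zero {x y : LaurentSeries A} {a b : ℤ} (hx : ∀ i < a, x.coeff i = 0)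
    (hy : ∀ i < b, y.coeff i = 0) {m : ℤ} (hm : m < a + b) : (x * y).coeff m = 0 := by
  rw [HahnSeries.coeff_mul]
  refine Finset.sum_eq_zero fun ij hij => ?_
  rw [Finset.mem_antidiagonal] at hij
  by_cases h : ij.1 < a
  · rw [hx _ h, zero_mul]
  · rw [hy _ (by omega), mul_zero]

lemma coeff_mul_lowest {x y : LaurentSeries A} {a b m : ℤ} (hx : ∀ i < a, x.coeff i = 0)
    (hy : ∀ i < b, y.coeff i = 0) (hm : m = a + b) :
    (x * y).coeff m = x.coeff a * y.coeff b := by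
  subst hm
  rw [HahnSeries.coeff_mul]
  refine Finset.sum_eq_single (a, b) (fun ij hij hne => ?_) fun h => ?_
  · rw [Finset.mem_antidiagonal] at hij
    by_cases h : ij.1 < a
    · rw [hx _ h, zero_mul]
    · have : ij.2 < b := by
        by_contra h'
        exact hne (Prod.ext (by simp; omega) (by simp; omega))
      rw [hy _ this, mul_zero]
  · rw [Finset.mem_antidiagonal] at h
    by_contra h'
    exact h ⟨fun h1 => h' (by simp [h1]), fun h2 => h' (by simp [h2]), rfl⟩

/-- Series of the form `τ λ + ⋯`. -/
structure HasTop (x : LaurentSeries A) (τ : ℤ) : Prop where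
  coeff_eq_zero : ∀ i < -1, x.coeff i = 0
  coeff_neg_one : x.coeff (-1) = τ

lemma coeff_prod_ofFn {n : ℕ} {U : Fin n → LaurentSeries A} {τ : Fin n → ℤ}
    (h : ∀ k, HasTop (U k) (τ k)) :
    (∀ i : ℤ, i < -n → (List.ofFn U).prod.coeff i = 0) ∧
      (List.ofFn U).prod.coeff (-n : ℤ) = ((∏ k, τ k : ℤ) : A) := by
  induction n with
  | zero =>
    constructor
    · intro i hi
      simp only [Nat.cast_zero, neg_zero] at hi
      simp [HahnSeries.coeff_one, hi.ne]
    · simp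
  | succ n ih =>
    obtain ⟨ih1, ih2⟩ := ih fun k => h k.succ
    rw [List.ofFn_succ, List.prod_cons]
    constructor
    · intro i hi
      exact coeff_mul_eq_zero (h 0).1 ih1 (by push_cast at hi; omega)
    · rw [coeff_mul_lowest (h 0).1 ih1 (by push_cast; omega), (h 0).2, ih2, Fin.prod_univ_succ,
        Int.cast_mul]

/-- The first coefficient at which two products of series can differ. -/
lemma coeff_prod_ofFn_sub {n : ℕ} {U V : Fin n → LaurentSeries A} {τ : Fin n → ℤ} {y : Fin n → A}
    {s : ℤ} (hU : ∀ k, HasTop (U k) (τ k)) (hV : ∀ k, HasTop (V k) (τ k))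
    (h0 : ∀ k, ∀ i < s, (U k - V k).coeff i = 0) (h1 : ∀ k, (U k - V k).coeff s = y k) :
    (∀ i < s + 1 - n, ((List.ofFn U).prod - (List.ofFn V).prod).coeff i = 0) ∧
      ((List.ofFn U).prod - (List.ofFn V).prod).coeff (s + 1 - n) =
        ∑ k, (∏ l, if l = k then 1 else τ l) • y k := by
  induction n with
  | zero => simp
  | succ n ih =>
    obtain ⟨ih1, ih2⟩ := ih (fun k => hU k.succ) (fun k => hV k.succ) (fun k => h0 k.succ)
      fun k => h1 k.succ
    obtain ⟨p1, p2⟩ := coeff_prod_ofFn fun k : Fin n => hV k.succ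
    -- Telescoping: in each summand one factor is a difference, and only leading parts of the other
    -- factors reach the coefficient in question.
    have e : (List.ofFn U).prod - (List.ofFn V).prod =
        U 0 * ((List.ofFn fun k => U (Fin.succ k)).prod - (List.ofFn fun k => V (Fin.succ k)).prod) +
          (U 0 - V 0) * (List.ofFn fun k => V (Fin.succ k)).prod := by
      rw [List.ofFn_succ, List.ofFn_succ, List.prod_cons, List.prod_cons]
      noncomm_ring
    rw [e]
    constructor
    · intro i hi
      push_cast at hi
      rw [HahnSeries.coeff_add, coeff_mul_eq_zero (hU 0).1 ih1 (by omega),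
        coeff_mul_eq_zero (h0 0) p1 (by omega), add_zero]
    · rw [HahnSeries.coeff_add, coeff_mul_lowest (hU 0).1 ih1 (by push_cast; omega),
        coeff_mul_lowest (h0 0) p1 (by push_cast; omega), (hU 0).2, ih2, h1, p2,
        Fin.sum_univ_succ, add_comm]
      congr 1
      · rw [Fin.prod_univ_succ, if_pos rfl, one_mul]
        simp [zsmul_eq_mul, (Int.cast_commute _ (y 0)).eq, Fin.succ_ne_zero]
      · rw [Finset.mul_sum]
        refine Finset.sum_congr rfl fun k _ => ?_
        rw [Fin.prod_univ_succ, if_neg (Fin.succ_ne_zero k).symm, mul_smul, zsmul_eq_mul (_ : A)]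
        simp only [Fin.succ_inj, ← zsmul_eq_mul]

/-- The first coefficient at which two column determinants can differ, when the leading parts of
their matrices vanish off the diagonal. -/
lemma coeff_ncdet_sub {n : ℕ} {U V : Fin n → Fin n → LaurentSeries A} {τ : Fin n → Fin n → ℤ}
    {y : Fin n → Fin n → A} {s : ℤ} (hU : ∀ r k, HasTop (U r k) (τ r k))
    (hV : ∀ r k, HasTop (V r k) (τ r k)) (h0 : ∀ r k, ∀ i < s, (U r k - V r k).coeff i = 0)
    (h1 : ∀ r k, (U r k - V r k).coeff s = y r k) (hτ : ∀ r k, r ≠ k → τ r k = 0) :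
    (ncdet U - ncdet V).coeff (s + 1 - n) = ∑ k, (∏ l, if l = k then 1 else τ l l) • y k k := by
  have key : ∀ p : Equiv.Perm (Fin n),
      (((Equiv.Perm.sign p : ℤˣ) : ℤ) • (List.ofFn fun k => U (p k) k).prod -
        ((Equiv.Perm.sign p : ℤˣ) : ℤ) • (List.ofFn fun k => V (p k) k).prod).coeff (s + 1 - n) =
      ((Equiv.Perm.sign p : ℤˣ) : ℤ) •
        ∑ k, (∏ l, if l = k then 1 else τ (p l) l) • y (p k) k := fun p => by
    rw [← smul_sub, HahnSeries.coeff_smul, (coeff_prod_ofFn_sub (fun k => hU (p k) k)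
      (fun k => hV (p k) k) (fun k => h0 (p k) k) fun k => h1 (p k) k).2]
  rw [ncdet, ncdet, ← Finset.sum_sub_distrib, HahnSeries.coeff_sum]
  simp only [key]
  rw [Finset.sum_eq_single_of_mem 1 (Finset.mem_univ _)]
  · simp
  · intro p _ hp
    rw [Finset.sum_eq_zero, smul_zero]
    intro k _
    -- A nontrivial permutation moves at least two points. So even when the factor k is omitted, an
    -- off-diagonal leading part remains, and it is zero.
    obtain ⟨l, hl, hlk⟩ : ∃ l, p l ≠ l ∧ l ≠ k := by
      by_contra! hcon
      refine hp (Equiv.ext fun l => ?_)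
      by_cases hl : p l = l
      · exact hl
      · have hl' := hcon l hl
        subst hl'
        have h2 : p (p l) = p l := by
          by_contra h3
          exact hl (hcon _ h3)
        exact absurd (p.injective h2) hl
    rw [Finset.prod_eq_zero (Finset.mem_univ l), zero_smul]
    rw [if_neg hlk, hτ _ _ hl]

end coeff

/-- The expansion of (λ - c)^k starts with λ^k. Hence re-expanding T(λ - c) is a unitriangular
change of coefficients. -/
lemma coeff_lamSubPow (c : ℂ) (k : ℤ) : (lamSubPow c k).coeff (-k) = 1 := by
  set x := lam ℂ - cst c with hx
  have hx0 : ∀ i < -1, x.coeff i = 0 := fun i hi => by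
    simp [hx, lam, HahnSeries.C_apply, HahnSeries.coeff_single_of_ne (show i ≠ -1 by omega),
      HahnSeries.coeff_single_of_ne (show i ≠ 0 by omega)]
  have hx1 : x.coeff (-1) = 1 := by
    simp [hx, lam, HahnSeries.C_apply]
  have hne : x ≠ 0 := fun h => by simp [h] at hx1
  have ho : x.order = -1 := by
    refine le_antisymm (HahnSeries.order_le_of_coeff_ne_zero (by rw [hx1]; exact one_ne_zero)) ?_
    by_contra h
    exact HahnSeries.leadingCoeff_ne_zero.2 hne
      (HahnSeries.leadingCoeff_eq.trans (hx0 _ (not_le.1 h)))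
  have hl : x.leadingCoeff = 1 := by rw [HahnSeries.leadingCoeff_eq, ho, hx1]
  have hnat : ∀ n : ℕ, (x ^ n).order = -n ∧ (x ^ n).leadingCoeff = 1 := fun n => by
    refine ⟨by rw [HahnSeries.order_pow, ho]; simp, ?_⟩
    induction n with
    | zero => simp
    | succ n ih => rw [pow_succ, HahnSeries.leadingCoeff_mul, ih, hl, one_mul]
  suffices h : (x ^ k).order = -k ∧ (x ^ k).leadingCoeff = 1 by
    rw [← h.1]
    exact HahnSeries.leadingCoeff_eq.symm.trans h.2
  obtain ⟨n, rfl | rfl⟩ := Int.eq_nat_or_neg k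
  · rw [zpow_natCast]
    exact hnat n
  · obtain ⟨h1, h2⟩ := hnat n
    have h3 : x ^ n * x ^ (-n : ℤ) = 1 := by
      rw [zpow_neg, zpow_natCast]
      exact mul_inv_cancel₀ (pow_ne_zero n hne)
    have h4 := congrArg HahnSeries.order h3
    have h5 := congrArg HahnSeries.leadingCoeff h3
    rw [HahnSeries.order_mul (pow_ne_zero n hne) (zpow_ne_zero _ hne), h1,
      HahnSeries.order_one] at h4
    rw [HahnSeries.leadingCoeff_mul, h2, one_mul, HahnSeries.leadingCoeff_one] at h5
    exact ⟨by omega, h5⟩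

/-! ### A representation of the Yangian is determined by the Drinfeld generators -/

section uniqueness

variable {A : Type*} [Ring A] [Algebra ℂ A] {N : ℕ} {ħ : ℂ}

lemma map_coeffT (Φ : Yangian N ħ →ₐ[ℂ] A) (r : ℤ) (j k : Fin N) :
    Φ (coeffT (yangianT N ħ) r j k) =
      coeffT (fun r => Matrix.of fun j k => Φ (yangianT N ħ r j k)) r j k :=
  coeffT_map Φ _ _ (fun _ _ _ => rfl) r j k

lemma hasTop_shiftedT (Φ : Yangian N ħ →ₐ[ℂ] A) (c : ℂ) (j k : Fin N) :
    HasTop (laurentMap (Φ : Yangian N ħ →+* A) (shiftedT N ħ c j k)) (if j = k then 1 else 0) := by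
  constructor
  · intro i hi
    rw [laurentMap_coeff, RingHom.coe_coe, map_shiftedT, Finset.Icc_eq_empty (by omega),
      Finset.sum_empty]
  · rw [laurentMap_coeff, RingHom.coe_coe, map_shiftedT, Finset.Icc_self, Finset.sum_singleton,
      map_coeffT]
    have h1 : (lamSubPow c (- -1)).coeff (-1) = 1 := coeff_lamSubPow c (- -1)
    have h2 : coeffT (fun r => Matrix.of fun j k => Φ (yangianT N ħ r j k)) (-1) j k =
        if j = k then 1 else 0 := Matrix.one_apply
    rw [h1, h2, one_smul]
    split_ifs <;> simp

variable {Φ Ψ : Yangian N ħ →ₐ[ℂ] A} {s : ℤ}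

/-- By unitriangularity, the first possible discrepancy does not see the shift c. -/
lemma coeff_shiftedT_sub
    (h : ∀ r < s, ∀ j k, Φ (coeffT (yangianT N ħ) r j k) = Ψ (coeffT (yangianT N ħ) r j k))
    (hs : -1 ≤ s) (c : ℂ) (j k : Fin N) :
    (∀ i < s, (laurentMap (Φ : Yangian N ħ →+* A) (shiftedT N ħ c j k) -
        laurentMap (Ψ : Yangian N ħ →+* A) (shiftedT N ħ c j k)).coeff i = 0) ∧
      (laurentMap (Φ : Yangian N ħ →+* A) (shiftedT N ħ c j k) -
        laurentMap (Ψ : Yangian N ħ →+* A) (shiftedT N ħ c j k)).coeff s =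
        Φ (coeffT (yangianT N ħ) s j k) - Ψ (coeffT (yangianT N ħ) s j k) := by
  simp only [HahnSeries.coeff_sub, laurentMap_coeff, RingHom.coe_coe, map_shiftedT,
    ← Finset.sum_sub_distrib, ← smul_sub]
  constructor
  · intro i hi
    refine Finset.sum_eq_zero fun r hr => ?_
    rw [Finset.mem_Icc] at hr
    rw [h r (by omega), sub_self, smul_zero]
  · rw [Finset.sum_eq_single_of_mem s (Finset.mem_Icc.2 ⟨hs, le_rfl⟩)]
    · have := coeff_lamSubPow c (-s)
      rw [neg_neg] at this
      rw [this, one_smul]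
    · intro r hr hrs
      rw [Finset.mem_Icc] at hr
      rw [h r (by omega), sub_self, smul_zero]

/-- The first coefficient at which the images of a quantum determinant can differ. -/
lemma sum_sub_eq_zero_of_qdet
    (h : ∀ r < s, ∀ j k, Φ (coeffT (yangianT N ħ) r j k) = Ψ (coeffT (yangianT N ħ) r j k))
    (hs : -1 ≤ s) {n : ℕ} {row col : Fin n → Fin N} (hrc : ∀ r k, row r = col k → r = k)
    (hq : laurentMap (Φ : Yangian N ħ →+* A) (qdet N ħ row col) =
      laurentMap (Ψ : Yangian N ħ →+* A) (qdet N ħ row col)) :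
    ∑ k, (∏ l, if l = k then 1 else if row l = col l then 1 else 0 : ℤ) •
      (Φ (coeffT (yangianT N ħ) s (row k) (col k)) -
        Ψ (coeffT (yangianT N ħ) s (row k) (col k))) = 0 := by
  rw [qdet_eq_ncdet, map_ncdet, map_ncdet, ← sub_eq_zero] at hq
  rw [← coeff_ncdet_sub (s := s) (τ := fun r k => if row r = col k then 1 else 0)
    (y := fun r k => Φ (coeffT (yangianT N ħ) s (row r) (col k)) -
      Ψ (coeffT (yangianT N ħ) s (row r) (col k)))
    (fun r k => hasTop_shiftedT Φ _ (row r) (col k))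
    (fun r k => hasTop_shiftedT Ψ _ (row r) (col k))
    (fun r k => (coeff_shiftedT_sub h hs _ (row r) (col k)).1)
    (fun r k => (coeff_shiftedT_sub h hs _ (row r) (col k)).2)
    (fun r k hrk => if_neg fun e => hrk (hrc r k e)), hq, HahnSeries.coeff_zero]

/-- The commutators of `T^{(0)}` and `T^{(s)}`. -/
lemma map_yangianT_commutator (Φ : Yangian N ħ →ₐ[ℂ] A) (s : ℕ) (i j k l : Fin N) :
    Φ (yangianT N ħ 0 i j) * Φ (yangianT N ħ s k l) -
        Φ (yangianT N ħ s k l) * Φ (yangianT N ħ 0 i j) =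
      (Complex.I * ħ) • ((if i = l then Φ (yangianT N ħ s k j) else 0) -
        if k = j then Φ (yangianT N ħ s i l) else 0) := by
  -- Take the relation at r = -1, where the coefficient of T is the identity. The two terms with
  -- T^{(s+1)} are then equal and cancel.
  have h := congrArg Φ
    (RingQuot.mkAlgHom_rel ℂ (YangianRel.rtt (N := N) (ħ := ħ) (-1) s (i, k) (j, l)))
  set S : ℕ → Matrix (Fin N) (Fin N) A := fun r => Matrix.of fun j k => Φ (yangianT N ħ r j k)
  have hT : ∀ (r : ℤ) (a b : Fin N), (Φ.comp (RingQuot.mkAlgHom ℂ (YangianRel N ħ)))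
      (coeffT (freeT N) r a b) = coeffT S r a b :=
    coeffT_map (Φ.comp (RingQuot.mkAlgHom ℂ (YangianRel N ħ))) (freeT N) S fun r i j => rfl
  have h1 : ∀ a b : Fin N, coeffT S (-1) a b = if a = b then 1 else 0 :=
    fun a b => Matrix.one_apply
  have h0 : ∀ a b, coeffT S (-1 + 1) a b = Φ (yangianT N ħ 0 a b) := fun a b => rfl
  have hs : ∀ a b, coeffT S (s : ℤ) a b = Φ (yangianT N ħ s a b) := fun a b => rfl
  rw [rttLeft_apply, rttRight_apply, ← AlgHom.comp_apply, ← AlgHom.comp_apply] at h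
  simp only [map_add, map_sub, map_mul, map_smul, hT, h1, h0, hs, ite_mul, mul_ite, one_mul,
    mul_one, zero_mul, mul_zero] at h
  split_ifs at h ⊢ <;> linear_combination (norm := module) h

/-- For B and C the only diagonal position with zero leading part is the last one. Every term that
keeps this position among its leading factors vanishes, so the last entry alone survives. -/
lemma sum_prod_ite_last {n : ℕ} (δ : Fin (n + 1) → Prop) [DecidablePred δ]
    (hδ : ∀ l, δ l ↔ l ≠ Fin.last n) (y : Fin (n + 1) → A) :
    ∑ k, (∏ l, if l = k then 1 else if δ l then 1 else 0 : ℤ) • y k = y (Fin.last n) := by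
  rw [Finset.sum_eq_single_of_mem (Fin.last n) (Finset.mem_univ _), Finset.prod_eq_one, one_smul]
  · intro l _
    by_cases h : l = Fin.last n
    · rw [if_pos h]
    · rw [if_neg h, if_pos ((hδ l).2 h)]
  · intro k _ hk
    rw [Finset.prod_eq_zero (Finset.mem_univ (Fin.last n)), zero_smul]
    rw [if_neg (Ne.symm hk), if_neg fun h => (hδ _).1 h rfl]

lemma firstIdx_eq_skipIdx {i : ℕ} (hi : i + 1 < N) (l : Fin (i + 1)) :
    firstIdx hi.le l = skipIdx hi l ↔ l ≠ Fin.last i := by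
  rw [skipIdx_eq]
  split_ifs with h
  · simp only [firstIdx, Fin.ext_iff, Fin.val_castLE, ne_eq, h, not_true, iff_false]
    omega
  · simp [h]

/-- A homomorphism from the Yangian is determined by the images of the Drinfeld generators. -/
theorem yangian_hom_ext (hħ : ħ ≠ 0)
    (hA : ∀ (n : ℕ) (hn : n ≤ N), laurentMap (Φ : Yangian N ħ →+* A) (drinfeldA N ħ hn) =
      laurentMap (Ψ : Yangian N ħ →+* A) (drinfeldA N ħ hn))
    (hB : ∀ (i : ℕ) (hi : i + 1 < N), laurentMap (Φ : Yangian N ħ →+* A) (drinfeldB N ħ hi) =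
      laurentMap (Ψ : Yangian N ħ →+* A) (drinfeldB N ħ hi))
    (hC : ∀ (i : ℕ) (hi : i + 1 < N), laurentMap (Φ : Yangian N ħ →+* A) (drinfeldC N ħ hi) =
      laurentMap (Ψ : Yangian N ħ →+* A) (drinfeldC N ħ hi)) : Φ = Ψ := by
  have hc : Complex.I * ħ ≠ 0 := mul_ne_zero Complex.I_ne_zero hħ
  have cont : ∀ (s : ℕ), (∀ r < s, ∀ j k, Φ (yangianT N ħ r j k) = Ψ (yangianT N ħ r j k)) →
      ∀ r < (s : ℤ), ∀ j k, Φ (coeffT (yangianT N ħ) r j k) = Ψ (coeffT (yangianT N ħ) r j k) := by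
    intro s h r hr j k
    match r with
    | Int.ofNat r => exact h r (by simpa using hr) j k
    | Int.negSucc r =>
      rw [map_coeffT, map_coeffT]
      cases r <;> rfl
  have hinj : ∀ {n : ℕ} (hn : n ≤ N) (r k : Fin n), firstIdx hn r = firstIdx hn k → r = k :=
    fun hn r k e => Fin.castLE_injective hn e
  have hskip : ∀ {i : ℕ} (hi : i + 1 < N) (r k : Fin (i + 1)),
      skipIdx hi r = firstIdx hi.le k → r = k := by
    intro i hi r k e
    rw [skipIdx_eq] at e
    split_ifs at e with h
    · simp only [firstIdx, Fin.ext_iff, Fin.val_castLE] at e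
      omega
    · exact hinj hi.le r k e
  have diag : ∀ (s : ℕ), (∀ r < s, ∀ j k, Φ (yangianT N ħ r j k) = Ψ (yangianT N ħ r j k)) →
      ∀ j, Φ (yangianT N ħ s j j) = Ψ (yangianT N ħ s j j) := by
    intro s h j
    -- The determinants A_n give the partial sums of the diagonal discrepancies; consecutive
    -- differences give the single entries.
    have hsum : ∀ (n : ℕ) (hn : n ≤ N), ∑ k : Fin n, (Φ (yangianT N ħ s (firstIdx hn k)
        (firstIdx hn k)) - Ψ (yangianT N ħ s (firstIdx hn k) (firstIdx hn k))) = 0 := by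
      intro n hn
      refine Eq.trans (Finset.sum_congr rfl fun k _ => ?_)
        (sum_sub_eq_zero_of_qdet (cont s h) (by omega) (hinj hn) (hA n hn))
      rw [Finset.prod_eq_one fun l _ => by rw [if_pos rfl, ite_self], one_smul]
      rfl
    have h1 := hsum (j + 1) j.2
    rw [Fin.sum_univ_castSucc] at h1
    have h2 := hsum j j.2.le
    exact sub_eq_zero.1 ((zero_add _).symm.trans
      ((congrArg (· + (Φ (yangianT N ħ s j j) - Ψ (yangianT N ħ s j j))) h2.symm).trans h1))
  have up : ∀ (i : ℕ) (hi : i + 1 < N), Φ (yangianT N ħ 0 ⟨i, by omega⟩ ⟨i + 1, hi⟩) =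
      Ψ (yangianT N ħ 0 ⟨i, by omega⟩ ⟨i + 1, hi⟩) := by
    intro i hi
    have h := sum_sub_eq_zero_of_qdet (cont 0 (by simp)) (by simp)
      (fun r k e => (hskip hi k r e.symm).symm) (hB i hi)
    rw [sum_prod_ite_last _ (firstIdx_eq_skipIdx hi), skipIdx_eq, if_pos rfl] at h
    exact sub_eq_zero.1 h
  have down : ∀ (i : ℕ) (hi : i + 1 < N), Φ (yangianT N ħ 0 ⟨i + 1, hi⟩ ⟨i, by omega⟩) =
      Ψ (yangianT N ħ 0 ⟨i + 1, hi⟩ ⟨i, by omega⟩) := by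
    intro i hi
    have h := sum_sub_eq_zero_of_qdet (cont 0 (by simp)) (by simp) (hskip hi) (hC i hi)
    rw [sum_prod_ite_last _ fun l => eq_comm.trans (firstIdx_eq_skipIdx hi l), skipIdx_eq,
      if_pos rfl] at h
    exact sub_eq_zero.1 h
  have comm : ∀ (s : ℕ) (i j l : Fin N), i ≠ l → Φ (yangianT N ħ 0 i j) = Ψ (yangianT N ħ 0 i j) →
      Φ (yangianT N ħ s j l) = Ψ (yangianT N ħ s j l) →
      Φ (yangianT N ħ s i l) = Ψ (yangianT N ħ s i l) := by
    intro s i j l hil h1 h2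
    -- For i ≠ l, an entry T^{(s)}_{il} is a commutator of T^{(0)}_{ij} with T^{(s)}_{jl}, divided
    -- by -iħ. This is where ħ ≠ 0 enters.
    have e : ∀ Θ : Yangian N ħ →ₐ[ℂ] A, Θ (yangianT N ħ s i l) = -(Complex.I * ħ)⁻¹ •
        (Θ (yangianT N ħ 0 i j) * Θ (yangianT N ħ s j l) -
          Θ (yangianT N ħ s j l) * Θ (yangianT N ħ 0 i j)) := fun Θ => by
      rw [map_yangianT_commutator, if_neg hil, if_pos rfl, zero_sub, smul_neg, neg_smul, smul_neg,
        neg_neg, smul_smul, inv_mul_cancel₀ hc, one_smul]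
    rw [e Φ, e Ψ, h1, h2]
  have off : ∀ (d i : ℕ) (hi : i + d + 1 < N),
      Φ (yangianT N ħ 0 ⟨i, by omega⟩ ⟨i + d + 1, hi⟩) =
        Ψ (yangianT N ħ 0 ⟨i, by omega⟩ ⟨i + d + 1, hi⟩) ∧
      Φ (yangianT N ħ 0 ⟨i + d + 1, hi⟩ ⟨i, by omega⟩) =
        Ψ (yangianT N ħ 0 ⟨i + d + 1, hi⟩ ⟨i, by omega⟩) := by
    intro d
    induction d with
    | zero => exact fun i hi => ⟨up i hi, down i hi⟩
    | succ d ih =>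
      intro i hi
      obtain ⟨h1, h2⟩ := ih i (by omega)
      exact ⟨comm 0 _ ⟨i + d + 1, by omega⟩ _ (by simp only [ne_eq, Fin.mk.injEq]; omega) h1
          (up (i + d + 1) hi),
        comm 0 _ ⟨i + d + 1, by omega⟩ _ (by simp only [ne_eq, Fin.mk.injEq]; omega)
          (down (i + d + 1) hi) h2⟩
  have zero : ∀ j k, Φ (yangianT N ħ 0 j k) = Ψ (yangianT N ħ 0 j k) := by
    rintro ⟨j, hj⟩ ⟨k, hk⟩
    obtain h | rfl | h := lt_trichotomy j k
    · obtain ⟨d, rfl⟩ := Nat.exists_eq_add_of_lt h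
      exact (off d j hk).1
    · exact diag 0 (by simp) _
    · obtain ⟨d, rfl⟩ := Nat.exists_eq_add_of_lt h
      exact (off d k hj).2
  -- For s > 0 no information from B or C is needed: bracketing T^{(0)}_{jk} with the diagonal entry
  -- T^{(s)}_{kk} produces T^{(s)}_{jk}.
  have all : ∀ s j k, Φ (yangianT N ħ s j k) = Ψ (yangianT N ħ s j k) := by
    intro s
    induction s using Nat.strong_induction_on with
    | _ s ih =>
      intro j k
      by_cases hjk : j = k
      · rw [hjk]
        exact diag s ih k
      · exact comm s j k k hjk (zero j k) (diag s ih k)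
  refine RingQuot.ringQuot_ext' ℂ _ _ (FreeAlgebra.hom_ext (funext fun x => ?_))
  exact all x.1 x.2.1 x.2.2

end uniqueness

end GZ

end

theorem proposition4p1 (N : ℕ) (ħ : ℂ) (hħ : ħ ≠ 0) (label : Fin N → ℂ) :
    (∃! ρ : GZ.Ugl N →ₐ[ℂ] Module.End ℂ (GZ.GZSpace N), GZ.IsGZRep N ħ label ρ) ∧
    (∀ ρ : GZ.Ugl N →ₐ[ℂ] Module.End ℂ (GZ.GZSpace N), GZ.IsGZRep N ħ label ρ →
      GZ.DrinfeldFormulas N ħ label (ρ.comp (GZ.evalHom N ħ))) ∧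
    (∃! Φ : GZ.Yangian N ħ →ₐ[ℂ] Module.End ℂ (GZ.GZSpace N),
      GZ.DrinfeldFormulas N ħ label Φ) := by
  have h2 : ∀ ρ : GZ.Ugl N →ₐ[ℂ] Module.End ℂ (GZ.GZSpace N), GZ.IsGZRep N ħ label ρ →
      GZ.DrinfeldFormulas N ħ label (ρ.comp (GZ.evalHom N ħ)) := fun ρ h => h.drinfeldFormulas hħ
  obtain ⟨ρ, hρ, hu⟩ := GZ.existsUnique_isGZRep N hħ label
  refine ⟨⟨ρ, hρ, hu⟩, h2, ρ.comp (GZ.evalHom N ħ), h2 ρ hρ, fun Φ hΦ => ?_⟩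
  have h := h2 ρ hρ
  exact GZ.yangian_hom_ext hħ (fun n hn => (hΦ.formA n hn).trans (h.formA n hn).symm)
    (fun i hi => (hΦ.formB i hi).trans (h.formB i hi).symm)
    (fun i hi => (hΦ.formC i hi).trans (h.formC i hi).symm)
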